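/- For a group $G$ with finite generating set $S$, let $\ell_{G,S}(g)$ be the least $n$ such that $g=x_1\cdots x_n$ with all $x_i\in S\cup S^{-1}$, let $F_{G,S}(n)$ be the number of $g\in G$ with $\ell_{G,S}(g)\le n$, put $\omega(G,S)=\lim_{n\to\infty}F_{G,S}(n)^{1/n}$ (this limit always exists), and for finitely generated $G$ let $\Omega(G)=\inf_S\omega(G,S)$ be the minimal exponential growth rate of $G$, the infimum being over all finite generating sets $S$ of $G$. Write $C_2$ for the cyclic group of order $2$ and $D_{2k}$ for the group of symmetries of a regular $k$-gon (of order $2k$). The polynomial $z^3-z-1$ has a unique positive root $\alpha$ (the plastic number), and: 1. $\mathrm{PGL}(2,\mathbb Z)\cong (C_2\times C_2)*_{C_2}D_6$, where $C_2$ is embedded in $C_2\times C_2$ as the first factor and in $D_6$ as the subgroup generated by a reflection; and $\mathrm{GL}(2,\mathbb Z)\cong D_8*_{C_2\times C_2}D_{12}$, where in both $D_8$ and $D_{12}$ the generator of the first factor of $C_2\times C_2$ is sent to the nontrivial central rotation and the generator of the second factor to a reflection. In both cases the amalgam $A*_CB$ satisfies $([A:C]-1)([B:C]-1)\ge 2$.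 2. $\Omega(\mathrm{PGL}(2,\mathbb Z))=\Omega(\mathrm{GL}(2,\mathbb Z))=\alpha$. 3. Consequently the constant $\alpha$ in Mann's lower bound (which says that $\Omega(A*_CB)\ge\alpha$ for every amalgamated product with $([A:C]-1)([B:C]-1)\ge2$) is sharp: there is a finitely generated amalgamated product $A*_CB$ with $([A:C]-1)([B:C]-1)\ge 2$ and $\Omega(A*_CB)=\alpha$. 4. There is a finitely generated amalgamated product $A*_CB$ with $([A:C]-1)([B:C]-1)\ge 2$ and $\Omega(A*_CB)<\sqrt2$ (a positive answer to a question of Mann). -/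

import Mathlib

open Filter Topology

universe u v

/-- Word length of `g` with respect to `S`: the least `n` such that `g = x₁ ⋯ xₙ` with all
`xᵢ ∈ S ∪ S⁻¹` (and `⊤` if there is no such expression). -/
noncomputable def wordLength {G : Type u} [Group G] (S : Finset G) (g : G) : ℕ∞ :=
  ⨅ (l : List G) (_ : (∀ x ∈ l, x ∈ S ∨ x⁻¹ ∈ S) ∧ l.prod = g), (l.length : ℕ∞)

/-- The growth function: the number of elements of word length at most `n`. -/
noncomputable def growthFunction {G : Type u} [Group G] (S : Finset G) (n : ℕ) : ℕ :=
  Set.ncard {g : G | wordLength S g ≤ n}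

/-- The exponential growth rate `ω(G, S) = lim F(n) ^ (1 / n)`; the limit exists for every finite
`S`, see `tendsto_expGrowthRate`. -/
noncomputable def expGrowthRate {G : Type u} [Group G] (S : Finset G) : ℝ :=
  limUnder atTop (fun n : ℕ => (growthFunction S n : ℝ) ^ ((1 : ℝ) / (n : ℝ)))

/-- The minimal exponential growth rate `Ω(G)`: the infimum of `ω(G, S)` over all finite generating
sets `S` of `G`. (Only meaningful if `G` is finitely generated; otherwise the value is `0`.) -/
noncomputable def minGrowthRate (G : Type u) [Group G] : ℝ :=
  sInf {w : ℝ | ∃ S : Finset G, Subgroup.closure (S : Set G) = ⊤ ∧ expGrowthRate S = w}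

section Growth

variable {G : Type u} [Group G]

theorem wordLength_le_iff (S : Finset G) (g : G) (n : ℕ) :
    wordLength S g ≤ n ↔
      ∃ l : List G, (∀ x ∈ l, x ∈ S ∨ x⁻¹ ∈ S) ∧ l.prod = g ∧ l.length ≤ n := by
  constructor
  · intro h
    have h1 : wordLength S g < ((n + 1 : ℕ) : ℕ∞) :=
      lt_of_le_of_lt h (by exact_mod_cast Nat.lt_succ_self n)
    unfold wordLength at h1
    simp only [iInf_lt_iff] at h1
    obtain ⟨l, hl, hlen⟩ := h1
    exact ⟨l, hl.1, hl.2, Nat.lt_succ_iff.mp (by exact_mod_cast hlen)⟩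
  · rintro ⟨l, hl, hp, hlen⟩
    exact (iInf₂_le l ⟨hl, hp⟩).trans (by exact_mod_cast hlen)

theorem wordBall_add (S : Finset G) (m n : ℕ) :
    {g : G | wordLength S g ≤ ((m + n : ℕ) : ℕ∞)} ⊆
      Set.image2 (· * ·) {g : G | wordLength S g ≤ m} {g : G | wordLength S g ≤ n} := by
  intro g hg
  obtain ⟨l, hl, hp, hlen⟩ := (wordLength_le_iff S g (m + n)).1 hg
  refine ⟨(l.take m).prod, (wordLength_le_iff S _ m).2
      ⟨l.take m, fun x hx => hl x (List.mem_of_mem_take hx), rfl, by simp⟩,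
    (l.drop m).prod, (wordLength_le_iff S _ n).2
      ⟨l.drop m, fun x hx => hl x (List.mem_of_mem_drop hx), rfl, ?_⟩, ?_⟩
  · simp only [List.length_drop]; omega
  · simp only [List.prod_take_mul_prod_drop, hp]

theorem wordBall_finite (S : Finset G) (n : ℕ) : {g : G | wordLength S g ≤ (n : ℕ∞)}.Finite := by
  induction n with
  | zero =>
    refine (Set.finite_singleton (1 : G)).subset fun g hg => ?_
    obtain ⟨l, -, hp, hlen⟩ := (wordLength_le_iff S g 0).1 hg
    have : l = [] := List.length_eq_zero_iff.1 (by omega)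
    subst this
    simpa using hp.symm
  | succ n ih =>
    refine (ih.image2 (· * ·) ?_).subset (wordBall_add S n 1)
    have hfin : ({1} ∪ (S : Set G) ∪ (S : Set G)⁻¹).Finite :=
      ((Set.finite_singleton _).union S.finite_toSet).union S.finite_toSet.inv
    refine hfin.subset fun g hg => ?_
    obtain ⟨l, hl, hp, hlen⟩ := (wordLength_le_iff S g 1).1 hg
    match l, hl, hp, hlen with
    | [], _, hp, _ => left; left; simpa using hp.symm
    | [x], hl, hp, _ =>
      have hx : x = g := by simpa using hp
      subst hx
      rcases hl x (by simp) with h | h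
      · left; right; exact h
      · right; exact h
    | _ :: _ :: _, _, _, hlen => simp at hlen

theorem growthFunction_pos (S : Finset G) (n : ℕ) : 0 < growthFunction S n :=
  (Set.ncard_pos (wordBall_finite S n)).2 ⟨1, (wordLength_le_iff S 1 n).2 ⟨[], by simp, rfl, by simp⟩⟩

theorem growthFunction_add_le (S : Finset G) (m n : ℕ) :
    growthFunction S (m + n) ≤ growthFunction S m * growthFunction S n := by
  have hfin := (wordBall_finite S m).prod (wordBall_finite S n)
  have h1 := Set.ncard_le_ncard (wordBall_add S m n)
    ((wordBall_finite S m).image2 _ (wordBall_finite S n))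
  rw [← Set.image_prod] at h1
  refine h1.trans ((Set.ncard_image_le hfin).trans ?_)
  rw [Set.ncard_prod]
  rfl

/-- The limit defining `ω(G, S)` exists. -/
theorem tendsto_expGrowthRate (S : Finset G) :
    Tendsto (fun n : ℕ => (growthFunction S n : ℝ) ^ ((1 : ℝ) / (n : ℝ))) atTop
      (𝓝 (expGrowthRate S)) := by
  have hpos : ∀ n, (0 : ℝ) < growthFunction S n := fun n => by
    exact_mod_cast growthFunction_pos S n
  have hsub : Subadditive fun n : ℕ => Real.log (growthFunction S n) := by
    intro m n
    rw [← Real.log_mul (hpos m).ne' (hpos n).ne']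
    exact Real.log_le_log (hpos _) (by exact_mod_cast growthFunction_add_le S m n)
  have hbdd : BddBelow (Set.range fun n : ℕ => Real.log (growthFunction S n) / n) := by
    refine ⟨0, ?_⟩
    rintro _ ⟨n, rfl⟩
    exact div_nonneg (Real.log_natCast_nonneg _) (Nat.cast_nonneg n)
  have h := (Real.continuous_exp.tendsto _).comp (hsub.tendsto_lim hbdd)
  refine tendsto_nhds_limUnder ⟨_, h.congr fun n => ?_⟩
  simp only [Function.comp]
  rw [Real.rpow_def_of_pos (hpos n), mul_one_div]

end Growth

/-- The two factors of an amalgamated product, as a family. -/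
def AmalgamFactor (A B : Type u) : Bool → Type u
  | false => A
  | true => B

instance (A B : Type u) [Group A] [Group B] : ∀ i, Group (AmalgamFactor A B i)
  | false => inferInstanceAs (Group A)
  | true => inferInstanceAs (Group B)

/-- The two maps from the amalgamated group to the factors, as a family. -/
def amalgamHom {A B : Type u} {C : Type v} [Group A] [Group B] [Group C] (φ : C →* A) (ψ : C →* B) :
    ∀ i, C →* AmalgamFactor A B i
  | false => φ
  | true => ψ

/-- The pushout of groups `A *_C B` along `φ : C → A` and `ψ : C → B`; it is the amalgamated
product when `φ` and `ψ` are injective. -/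
abbrev Amalgam {A B : Type u} {C : Type v} [Group A] [Group B] [Group C]
    (φ : C →* A) (ψ : C →* B) : Type (max u v) :=
  Monoid.PushoutI (amalgamHom φ ψ)

/-- `φ` and `ψ` embed `C` in `A` and `B`, and `([A : C] - 1) ([B : C] - 1) ≥ 2`
(indices may be infinite). -/
structure IsNondegenerateAmalgam {A B : Type u} {C : Type v} [Group A] [Group B] [Group C]
    (φ : C →* A) (ψ : C →* B) : Prop where
  injective_left : Function.Injective φ
  injective_right : Function.Injective ψ
  two_le_index : 2 ≤ (ENat.card (A ⧸ φ.range) - 1) * (ENat.card (B ⧸ ψ.range) - 1)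

/-- The cyclic group of order two. -/
abbrev C2 : Type := Multiplicative (ZMod 2)

/-- `C₂ → C₂ × C₂`, the inclusion of the first factor. -/
def c2ToKlein : C2 →* C2 × C2 := MonoidHom.inl C2 C2

/-- `C₂ → D₆` (symmetries of the triangle), sending the generator to a reflection. -/
def c2ToD6 : C2 →* DihedralGroup 3 where
  toFun x := DihedralGroup.sr 0 ^ x.toAdd.val
  map_one' := by decide
  map_mul' := by decide

/-- `C₂ × C₂ → D₈` (symmetries of the square): the first generator goes to the central rotation,
the second one to a reflection. -/
def kleinToD8 : C2 × C2 →* DihedralGroup 4 where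
  toFun x := DihedralGroup.r 2 ^ x.1.toAdd.val * DihedralGroup.sr 0 ^ x.2.toAdd.val
  map_one' := by decide
  map_mul' := by decide

/-- `C₂ × C₂ → D₁₂` (symmetries of the hexagon): the first generator goes to the central rotation,
the second one to a reflection. -/
def kleinToD12 : C2 × C2 →* DihedralGroup 6 where
  toFun x := DihedralGroup.r 3 ^ x.1.toAdd.val * DihedralGroup.sr 0 ^ x.2.toAdd.val
  map_one' := by decide
  map_mul' := by decide

/-! ### Comparison of growth rates; passage to quotients with finite kernel. -/

section GrowthComparison

variable {G : Type u} [Group G]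

/-! `GL(2, ℤ)` maps onto `PGL(2, ℤ)` with kernel `±1`, and a finite kernel does not affect the
minimal growth rate (`minGrowthRate_eq_of_surjective`), so the upper bound may be proved in `PGL`
and the lower bound in `GL`.

Upper bound. `PGL(2, ℤ)` is generated by reflections `a`, `b`, `c` with `(ab)² = (bc)³ = 1`. Every
element is `x v z` with `x` in the finite group of `b, c`, `z` in that of `a, b`, and `v` a product
of the syllables `ac` and `abc`; the length of `v` is controlled by word length. Syllables of
lengths two and three give the recursion `E(n+3) = E(n+1) + E(n)` and hence the root of `z³ - z - 1`
(`IsCoxeterTriple.expGrowthRate_le`). The same normal form shows that a group generated by such a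
triple has no kernel over `PGL(2, ℤ)` (`IsCoxeterTriple.injective`), which yields both amalgam
decompositions.

Lower bound. If some words of lengths at most two and three freely generate a monoid, the same
recursion bounds the growth from below (`FreePair.le_expGrowthRate`). Such a pair is found in every
finite generating set `S` of `GL(2, ℤ)` (`hasFreePair_of_closure_eq_top`). The group acts on the
trivalent Farey tree. The double cone `P = {xy > 0}` and its opposite `P' = {xy < 0}` play the role
of the two half-trees at a base edge, and half-trees are nested, disjoint or covering
(`coneMonoid_total`).

A letter moving a half-tree strictly into itself has a partner in `S` that does not preserve its
axis, and ping-pong gives the pair (`hasFreePair_of_skewer`). Two letters turning opposite sides of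
an edge have a product of this kind (`hasFreePair_of_turnPair`). If neither situation occurs at any
edge, all letters point to the same side of every edge; following that direction decreases the total
entry norm, until all letters fix a vertex and cannot generate. -/

theorem wordLength_mul_le (S : Finset G) {g h : G} {m n : ℕ} (hg : wordLength S g ≤ m)
    (hh : wordLength S h ≤ n) : wordLength S (g * h) ≤ (m + n : ℕ) := by
  obtain ⟨l, hl, rfl, hlm⟩ := (wordLength_le_iff S g m).1 hg
  obtain ⟨k, hk, rfl, hkn⟩ := (wordLength_le_iff S h n).1 hh
  refine (wordLength_le_iff S _ _).2 ⟨l ++ k, fun x hx => ?_, by simp, by simp; omega⟩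
  rcases List.mem_append.1 hx with h | h
  exacts [hl x h, hk x h]

theorem wordLength_one_le (S : Finset G) (n : ℕ) : wordLength S (1 : G) ≤ n :=
  (wordLength_le_iff S 1 n).2 ⟨[], by simp, rfl, by simp⟩

theorem expGrowthRate_nonneg (S : Finset G) : 0 ≤ expGrowthRate S :=
  ge_of_tendsto' (tendsto_expGrowthRate S) fun _ => Real.rpow_nonneg (Nat.cast_nonneg _) _

theorem tendsto_const_rpow_inv {K : ℝ} (hK : 0 < K) :
    Tendsto (fun n : ℕ => K ^ ((1 : ℝ) / (n : ℝ))) atTop (𝓝 1) := by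
  have h : Tendsto (fun n : ℕ => (1 : ℝ) / (n : ℝ)) atTop (𝓝 0) :=
    tendsto_one_div_atTop_nhds_zero_nat
  simpa using tendsto_const_nhds.rpow h (Or.inl hK.ne')

theorem tendsto_mul_pow_rpow_inv {K a : ℝ} (hK : 0 < K) (ha : 0 ≤ a) :
    Tendsto (fun n : ℕ => (K * a ^ n) ^ ((1 : ℝ) / (n : ℝ))) atTop (𝓝 a) := by
  have h := (tendsto_const_rpow_inv hK).mul_const a
  rw [one_mul] at h
  refine h.congr' ?_
  filter_upwards [eventually_ne_atTop 0] with n hn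
  rw [Real.mul_rpow hK.le (pow_nonneg ha n), one_div, Real.pow_rpow_inv_natCast ha hn]

theorem expGrowthRate_le_of_growthFunction_le {S : Finset G} {K a : ℝ} (hK : 0 < K) (ha : 0 ≤ a)
    (h : ∀ n, (growthFunction S n : ℝ) ≤ K * a ^ n) : expGrowthRate S ≤ a :=
  le_of_tendsto_of_tendsto' (tendsto_expGrowthRate S) (tendsto_mul_pow_rpow_inv hK ha) fun n =>
    Real.rpow_le_rpow (Nat.cast_nonneg _) (h n) (by positivity)

theorem le_expGrowthRate_of_le_growthFunction {S : Finset G} {K a : ℝ} (hK : 0 < K) (ha : 0 ≤ a)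
    (h : ∀ n, K * a ^ n ≤ (growthFunction S n : ℝ)) : a ≤ expGrowthRate S :=
  le_of_tendsto_of_tendsto' (tendsto_mul_pow_rpow_inv hK ha) (tendsto_expGrowthRate S) fun n =>
    Real.rpow_le_rpow (by positivity) (h n) (by positivity)

theorem expGrowthRate_le_of_le_mul {H : Type v} [Group H] {S : Finset G} {T : Finset H} {K : ℕ}
    (hK : 0 < K) (h : ∀ n, growthFunction S n ≤ K * growthFunction T n) :
    expGrowthRate S ≤ expGrowthRate T := by
  have hlim := (tendsto_const_rpow_inv (K := (K : ℝ)) (by exact_mod_cast hK)).mul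
    (tendsto_expGrowthRate T)
  rw [one_mul] at hlim
  refine le_of_tendsto_of_tendsto' (tendsto_expGrowthRate S) hlim fun n => ?_
  rw [← Real.mul_rpow (Nat.cast_nonneg _) (Nat.cast_nonneg _)]
  exact Real.rpow_le_rpow (Nat.cast_nonneg _) (by exact_mod_cast h n) (by positivity)

theorem minGrowthRate_le {S : Finset G} (hS : Subgroup.closure (S : Set G) = ⊤) :
    minGrowthRate G ≤ expGrowthRate S :=
  csInf_le ⟨0, by rintro _ ⟨T, -, rfl⟩; exact expGrowthRate_nonneg T⟩ ⟨S, hS, rfl⟩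

theorem le_minGrowthRate {a : ℝ} (hfg : Group.FG G)
    (h : ∀ S : Finset G, Subgroup.closure (S : Set G) = ⊤ → a ≤ expGrowthRate S) :
    a ≤ minGrowthRate G := by
  obtain ⟨S, hS⟩ := Group.fg_def.1 hfg
  refine le_csInf ⟨_, S, hS, rfl⟩ ?_
  rintro _ ⟨T, hT, rfl⟩
  exact h T hT

open Classical in
/-- The ball in a quotient is the image of the ball. -/
theorem wordBall_image {H : Type v} [Group H] (φ : G →* H) (S : Finset G) (n : ℕ) :
    φ '' {g : G | wordLength S g ≤ n} = {h : H | wordLength (S.image φ) h ≤ n} := by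
  ext h
  constructor
  · rintro ⟨g, hg, rfl⟩
    obtain ⟨l, hl, rfl, hlen⟩ := (wordLength_le_iff S g n).1 hg
    refine (wordLength_le_iff _ _ n).2 ⟨l.map φ, ?_, (map_list_prod φ l).symm, by simpa using hlen⟩
    intro x hx
    obtain ⟨y, hy, rfl⟩ := List.mem_map.1 hx
    rcases hl y hy with h | h
    · exact Or.inl (Finset.mem_image_of_mem _ h)
    · exact Or.inr (by rw [← map_inv]; exact Finset.mem_image_of_mem _ h)
  · intro hh
    obtain ⟨l, hl, rfl, hlen⟩ := (wordLength_le_iff _ h n).1 hh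
    have key : ∀ l : List H, (∀ x ∈ l, x ∈ S.image φ ∨ x⁻¹ ∈ S.image φ) →
        ∃ k : List G, (∀ x ∈ k, x ∈ S ∨ x⁻¹ ∈ S) ∧ φ k.prod = l.prod ∧ k.length = l.length := by
      intro l
      induction l with
      | nil => exact fun _ => ⟨[], by simp, by simp, rfl⟩
      | cons x l ih =>
        intro hl
        obtain ⟨k, hk, hkp, hkl⟩ := ih fun y hy => hl y (List.mem_cons_of_mem _ hy)
        obtain ⟨y, hy, hyx⟩ : ∃ y, (y ∈ S ∨ y⁻¹ ∈ S) ∧ φ y = x := by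
          rcases hl x List.mem_cons_self with h | h
          · obtain ⟨y, hy, rfl⟩ := Finset.mem_image.1 h
            exact ⟨y, Or.inl hy, rfl⟩
          · obtain ⟨y, hy, hyx⟩ := Finset.mem_image.1 h
            exact ⟨y⁻¹, Or.inr (by simpa using hy), by simp [hyx]⟩
        refine ⟨y :: k, ?_, by simp [hyx, hkp], by simp [hkl]⟩
        intro z hz
        rcases List.mem_cons.1 hz with rfl | hz
        exacts [hy, hk z hz]
    obtain ⟨k, hk, hkp, hkl⟩ := key l hl
    exact ⟨k.prod, (wordLength_le_iff _ _ n).2 ⟨k, hk, rfl, by omega⟩, hkp⟩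

open Classical in
theorem expGrowthRate_image_le {H : Type v} [Group H] (φ : G →* H) (S : Finset G) :
    expGrowthRate (S.image φ) ≤ expGrowthRate S := by
  refine expGrowthRate_le_of_le_mul one_pos fun n => ?_
  rw [one_mul, growthFunction, ← wordBall_image]
  exact Set.ncard_image_le (wordBall_finite S n)

open Classical in
-- An element of the ball is a kernel element times a chosen preimage of its image, so the balls
-- differ in size by at most the factor `Nat.card φ.ker`.
theorem expGrowthRate_le_image {H : Type v} [Group H] (φ : G →* H) [Finite φ.ker] (S : Finset G) :
    expGrowthRate S ≤ expGrowthRate (S.image φ) := by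
  refine expGrowthRate_le_of_le_mul (K := Nat.card φ.ker) Nat.card_pos fun n => ?_
  have hfin := wordBall_finite (S.image φ) n
  let r : H → G := Function.invFun φ
  have hfin2 : ((φ.ker : Set G) ×ˢ (r '' {h : H | wordLength (S.image φ) h ≤ n})).Finite :=
    (Set.toFinite _).prod (hfin.image r)
  have hsub : {g : G | wordLength S g ≤ n} ⊆ (fun p : G × G => p.1 * p.2) ''
      ((φ.ker : Set G) ×ˢ (r '' {h : H | wordLength (S.image φ) h ≤ n})) := by
    intro g hg
    have h1 : φ (r (φ g)) = φ g := Function.invFun_eq ⟨g, rfl⟩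
    refine ⟨(g * (r (φ g))⁻¹, r (φ g)), ⟨?_, φ g, ?_, rfl⟩, by simp⟩
    · simp [MonoidHom.mem_ker, h1]
    · rw [← wordBall_image]
      exact ⟨g, hg, rfl⟩
  calc growthFunction S n ≤ _ := Set.ncard_le_ncard hsub (hfin2.image _)
    _ ≤ _ := Set.ncard_image_le hfin2
    _ = Nat.card φ.ker * (r '' {h : H | wordLength (S.image φ) h ≤ n}).ncard := by
        rw [Set.ncard_prod]; rfl
    _ ≤ _ := Nat.mul_le_mul_left _ (Set.ncard_image_le hfin)

theorem expGrowthRate_insert_one [DecidableEq G] (S : Finset G) :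
    expGrowthRate (insert 1 S) ≤ expGrowthRate S := by
  refine expGrowthRate_le_of_le_mul one_pos fun n => ?_
  rw [one_mul]
  refine Set.ncard_le_ncard (fun g hg => ?_) (wordBall_finite S n)
  obtain ⟨l, hl, rfl, hlen⟩ := (wordLength_le_iff _ g n).1 hg
  refine (wordLength_le_iff _ _ n).2
    ⟨l.filter (· ≠ 1), fun x hx => ?_, ?_, (List.length_filter_le _ _).trans hlen⟩
  · obtain ⟨h1, h2⟩ := List.mem_filter.1 hx
    have h2 : x ≠ 1 := by simpa using h2
    have := hl x h1
    simpa [Finset.mem_insert, h2] using this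
  · clear hl hlen hg
    induction l with
    | nil => rfl
    | cons x l ih =>
      by_cases hx : x = 1
      · simpa [hx] using ih
      · simpa [hx] using ih

/-- The minimal growth rate does not change under surjections with finite kernel. -/
theorem minGrowthRate_eq_of_surjective {H : Type v} [Group H] (φ : G →* H)
    (hφ : Function.Surjective φ) [Finite φ.ker] : minGrowthRate G = minGrowthRate H := by
  classical
  have h1 : ∀ S : Finset G, Subgroup.closure (S : Set G) = ⊤ →
      Subgroup.closure ((S.image φ : Finset H) : Set H) = ⊤ := by
    intro S hS
    rw [Finset.coe_image, ← MonoidHom.map_closure, hS, ← MonoidHom.range_eq_map]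
    exact MonoidHom.range_eq_top.2 hφ
  have h2 : ∀ T : Finset H, Subgroup.closure (T : Set H) = ⊤ → ∃ S : Finset G,
      Subgroup.closure (S : Set G) = ⊤ ∧ expGrowthRate S ≤ expGrowthRate T := by
    intro T hT
    -- Adding the whole kernel makes the lifts generate, and in the quotient it only adds the
    -- trivial letter.
    let S : Finset G := T.image (Function.surjInv hφ) ∪ (Set.toFinite (φ.ker : Set G)).toFinset
    refine ⟨S, ?_, (expGrowthRate_le_image φ S).trans ?_⟩
    · have hker : φ.ker ≤ Subgroup.closure (S : Set G) := fun x hx =>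
        Subgroup.subset_closure (by simp [S, MonoidHom.mem_ker.1 hx])
      have hmap : (Subgroup.closure (S : Set G)).map φ = ⊤ := by
        rw [eq_top_iff, ← hT, Subgroup.closure_le]
        intro t ht
        exact ⟨Function.surjInv hφ t, Subgroup.subset_closure (by
          simp only [S, Finset.coe_union, Finset.coe_image]
          exact Or.inl ⟨t, ht, rfl⟩), Function.surjInv_eq hφ t⟩
      have := congrArg (Subgroup.comap φ) hmap
      rwa [Subgroup.comap_map_eq_self hker, Subgroup.comap_top] at this
    · have himg : S.image φ = insert 1 T := by
        ext x
        simp only [S, Finset.mem_image, Finset.mem_union, Set.Finite.mem_toFinset, SetLike.mem_coe,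
          MonoidHom.mem_ker, Finset.mem_insert]
        constructor
        · rintro ⟨y, ⟨t, ht, rfl⟩ | hy, rfl⟩
          · exact Or.inr (by rwa [Function.surjInv_eq hφ t])
          · exact Or.inl hy
        · rintro (rfl | hx)
          · exact ⟨1, Or.inr (map_one φ), map_one φ⟩
          · exact ⟨_, Or.inl ⟨x, hx, rfl⟩, Function.surjInv_eq hφ x⟩
      rw [himg]
      exact expGrowthRate_insert_one T
  unfold minGrowthRate
  -- Without finite generation both infima are taken over the empty set.
  rcases Set.eq_empty_or_nonempty
    {w : ℝ | ∃ S : Finset G, Subgroup.closure (S : Set G) = ⊤ ∧ expGrowthRate S = w} with he | hne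
  · rw [he]
    congr 1
    symm
    rw [Set.eq_empty_iff_forall_notMem]
    rintro _ ⟨T, hT, -⟩
    obtain ⟨S, hS, -⟩ := h2 T hT
    exact (Set.eq_empty_iff_forall_notMem.1 he) _ ⟨S, hS, rfl⟩
  · apply le_antisymm
    · obtain ⟨_, S, hS, -⟩ := hne
      refine le_csInf ⟨_, _, h1 S hS, rfl⟩ ?_
      rintro _ ⟨T, hT, rfl⟩
      obtain ⟨S', hS', hle⟩ := h2 T hT
      exact (minGrowthRate_le hS').trans hle
    · refine le_csInf hne ?_
      rintro _ ⟨S, hS, rfl⟩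
      exact (minGrowthRate_le (h1 S hS)).trans (expGrowthRate_image_le φ S)

theorem minGrowthRate_congr {H : Type v} [Group H] (e : G ≃* H) :
    minGrowthRate G = minGrowthRate H := by
  have : Finite (e.toMonoidHom).ker := by
    rw [(MonoidHom.ker_eq_bot_iff _).2 e.injective]
    infer_instance
  exact minGrowthRate_eq_of_surjective e.toMonoidHom e.surjective

end GrowthComparison

/-! ### Free pairs of short words and the growth they force. -/

section FreePairs

variable {G : Type u} [Group G]

/-- `x` and `y` freely generate a free monoid: no word starting with `x` equals a word starting
with `y`. -/
def FreePair (x y : G) : Prop :=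
  ∀ u ∈ Submonoid.closure {x, y}, ∀ v ∈ Submonoid.closure {x, y}, x * u ≠ y * v

theorem FreePair.symm {x y : G} (h : FreePair x y) : FreePair y x := by
  intro u hu v hv huv
  rw [Set.pair_comm] at hu hv
  exact h v hv u hu huv.symm

/-- All words preserve `Y`, so two words with different first letters send a point of `Y` into the
disjoint sets `x Y` and `y Y`. -/
theorem FreePair.of_ping_pong {x y : G} (Y : Set G) (hY : Y.Nonempty) (hx : ∀ a ∈ Y, x * a ∈ Y)
    (hy : ∀ a ∈ Y, y * a ∈ Y) (hxy : ∀ a ∈ Y, ∀ b ∈ Y, x * a ≠ y * b) : FreePair x y := by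
  have key : ∀ u ∈ Submonoid.closure {x, y}, ∀ a ∈ Y, u * a ∈ Y := by
    intro u hu
    induction hu using Submonoid.closure_induction with
    | mem z hz =>
      rcases hz with rfl | rfl
      exacts [hx, hy]
    | one => simp
    | mul z z' _ _ h h' =>
      intro a ha
      rw [mul_assoc]
      exact h _ (h' a ha)
  obtain ⟨a, ha⟩ := hY
  intro u hu v hv huv
  refine hxy _ (key u hu a ha) _ (key v hv a ha) ?_
  rw [← mul_assoc, huv, mul_assoc]

theorem FreePair.of_conj (c : G) {x y : G} (h : FreePair (c * x * c⁻¹) (c * y * c⁻¹)) :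
    FreePair x y := by
  have key : ∀ u ∈ Submonoid.closure {x, y},
      c * u * c⁻¹ ∈ Submonoid.closure {c * x * c⁻¹, c * y * c⁻¹} := by
    intro u hu
    have h1 := Submonoid.mem_map_of_mem (MulAut.conj c).toMonoidHom hu
    rw [MonoidHom.map_mclosure] at h1
    simpa [Set.image_pair] using h1
  intro u hu v hv huv
  refine h _ (key u hu) _ (key v hv) ?_
  have e (z z' : G) : c * z * c⁻¹ * (c * z' * c⁻¹) = c * (z * z') * c⁻¹ := by group
  rw [e, e, huv]

/-- Cancelling `h` leaves `k * u = v`, where `v` is empty or starts with `h`. This undoes one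
subtraction in the Euclidean descent of `commute_or_freePair_of_mem`. -/
theorem FreePair.mul_left {h k : G} (hk : FreePair h k) : FreePair (h * k) h := by
  have hle : Submonoid.closure {h * k, h} ≤ Submonoid.closure {h, k} := by
    rw [Submonoid.closure_le]
    have h1 : h ∈ Submonoid.closure {h, k} := Submonoid.subset_closure (by simp)
    have h2 : k ∈ Submonoid.closure {h, k} := Submonoid.subset_closure (by simp)
    rintro z (rfl | rfl)
    exacts [mul_mem h1 h2, h1]
  have hform : ∀ v ∈ Submonoid.closure {h * k, h}, v = 1 ∨
      ∃ v' ∈ Submonoid.closure {h, k}, v = h * v' := by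
    intro v hv
    induction hv using Submonoid.closure_induction_left with
    | one => exact Or.inl rfl
    | mul_left z hz y hy _ =>
      rcases hz with rfl | rfl
      · exact Or.inr ⟨k * y, mul_mem (Submonoid.subset_closure (by simp)) (hle hy), mul_assoc _ _ _⟩
      · exact Or.inr ⟨y, hle hy, rfl⟩
  intro u hu v hv huv
  rw [mul_assoc, mul_right_inj] at huv
  rcases hform v hv with rfl | ⟨v', hv', rfl⟩
  -- For empty `v`, multiplying `k * u = 1` by `h` on the right restores two words with different
  -- first letters.
  · refine hk 1 (one_mem _) (u * h) (mul_mem (hle hu) (Submonoid.subset_closure (by simp))) ?_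
    rw [← mul_assoc, huv, mul_one, one_mul]
  · exact hk v' hv' u (hle hu) huv.symm

/-- Freeness makes `x E(n+1)` and `y E(n)` disjoint inside the ball of radius `n + 3`. The factor `α
^ 2` absorbs the cases `n < 3`. -/
theorem FreePair.exists_finset_card {S : Finset G} {x y : G} (h : FreePair x y)
    (hx : wordLength S x ≤ (2 : ℕ)) (hy : wordLength S y ≤ (3 : ℕ)) {α : ℝ} (hα : 1 ≤ α)
    (hroot : α ^ 3 = α + 1) (n : ℕ) :
    ∃ E : Finset G, (∀ g ∈ E, g ∈ Submonoid.closure {x, y} ∧ wordLength S g ≤ n) ∧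
      α ^ n ≤ α ^ 2 * E.card := by
  classical
  induction n using Nat.strong_induction_on with
  | _ n ih =>
    rcases lt_or_ge n 3 with hn | hn
    · refine ⟨{1}, ?_, ?_⟩
      · simp only [Finset.mem_singleton]
        rintro g rfl
        exact ⟨one_mem _, wordLength_one_le S n⟩
      · simpa using pow_le_pow_right₀ hα (by omega : n ≤ 2)
    · obtain ⟨m, rfl⟩ := Nat.exists_eq_add_of_le' hn
      obtain ⟨A, hA, hAc⟩ := ih (m + 1) (by omega)
      obtain ⟨B, hB, hBc⟩ := ih m (by omega)
      refine ⟨A.image (x * ·) ∪ B.image (y * ·), ?_, ?_⟩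
      · intro g hg
        rcases Finset.mem_union.1 hg with hg | hg
        · obtain ⟨a, ha, rfl⟩ := Finset.mem_image.1 hg
          refine ⟨mul_mem (Submonoid.subset_closure (by simp)) (hA a ha).1, ?_⟩
          have := wordLength_mul_le S hx (hA a ha).2
          rwa [show 2 + (m + 1) = m + 3 by ring] at this
        · obtain ⟨a, ha, rfl⟩ := Finset.mem_image.1 hg
          refine ⟨mul_mem (Submonoid.subset_closure (by simp)) (hB a ha).1, ?_⟩
          have := wordLength_mul_le S hy (hB a ha).2
          rwa [show 3 + m = m + 3 by ring] at this
      · rw [Finset.card_union_of_disjoint, Finset.card_image_of_injective _ (mul_right_injective x),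
          Finset.card_image_of_injective _ (mul_right_injective y)]
        · push_cast
          calc α ^ (m + 3) = α ^ (m + 1) + α ^ m := by rw [pow_add, hroot]; ring
            _ ≤ _ := by linarith
        · rw [Finset.disjoint_left]
          intro g hg hg'
          obtain ⟨a, ha, rfl⟩ := Finset.mem_image.1 hg
          obtain ⟨b, hb, hab⟩ := Finset.mem_image.1 hg'
          exact h a (hA a ha).1 b (hB b hb).1 hab.symm

/-- A free pair of elements of lengths two and three forces growth at least the plastic number. -/
theorem FreePair.le_expGrowthRate {S : Finset G} {x y : G} (h : FreePair x y)
    (hx : wordLength S x ≤ (2 : ℕ)) (hy : wordLength S y ≤ (3 : ℕ)) {α : ℝ} (hα : 1 ≤ α)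
    (hroot : α ^ 3 = α + 1) : α ≤ expGrowthRate S := by
  have hpos : 0 < α := by linarith
  refine le_expGrowthRate_of_le_growthFunction (K := (α ^ 2)⁻¹) (by positivity) hpos.le fun n => ?_
  obtain ⟨E, hE, hc⟩ := h.exists_finset_card hx hy hα hroot n
  rw [inv_mul_le_iff₀ (by positivity)]
  refine hc.trans (mul_le_mul_of_nonneg_left ?_ (by positivity))
  rw [← Set.ncard_coe_finset]
  exact_mod_cast Set.ncard_le_ncard (fun g hg => (hE g hg).2) (wordBall_finite S n)

/-- `x` is trivial, or an element of `S ∪ S⁻¹`. -/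
def IsLetter (S : Set G) (x : G) : Prop := x = 1 ∨ x ∈ S ∨ x⁻¹ ∈ S

/-- Some elements of length at most two and three with respect to `S` form a free pair. -/
def HasFreePair (S : Set G) : Prop :=
  ∃ x₁ x₂ y₁ y₂ y₃ : G, IsLetter S x₁ ∧ IsLetter S x₂ ∧ IsLetter S y₁ ∧ IsLetter S y₂ ∧
    IsLetter S y₃ ∧ FreePair (x₁ * x₂) (y₁ * y₂ * y₃)

theorem IsLetter.one (S : Set G) : IsLetter S 1 := Or.inl rfl

theorem IsLetter.of_mem {S : Set G} {x : G} (h : x ∈ S) : IsLetter S x := Or.inr (Or.inl h)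

theorem IsLetter.inv {S : Set G} {x : G} (h : IsLetter S x) : IsLetter S x⁻¹ := by
  rcases h with h | h | h
  · exact Or.inl (by simp [h])
  · exact Or.inr (Or.inr (by simpa using h))
  · exact Or.inr (Or.inl h)

theorem IsLetter.conj {S : Set G} {x : G} (c : G) (h : IsLetter S x) :
    IsLetter ((fun s => c * s * c⁻¹) '' S) (c * x * c⁻¹) := by
  rcases h with h | h | h
  · exact Or.inl (by simp [h])
  · exact Or.inr (Or.inl ⟨x, h, rfl⟩)
  · exact Or.inr (Or.inr ⟨_, h, by simp [mul_assoc]⟩)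

theorem HasFreePair.of_letters {S T : Set G} (h : HasFreePair S)
    (hST : ∀ x ∈ S, IsLetter T x) : HasFreePair T := by
  have key : ∀ x, IsLetter S x → IsLetter T x := by
    rintro x (h | h | h)
    · exact Or.inl h
    · exact hST x h
    · simpa using (hST _ h).inv
  obtain ⟨x₁, x₂, y₁, y₂, y₃, h1, h2, h3, h4, h5, h6⟩ := h
  exact ⟨x₁, x₂, y₁, y₂, y₃, key _ h1, key _ h2, key _ h3, key _ h4, key _ h5, h6⟩

/-- Conjugation invariance is what later allows the base edge of the tree to be moved. -/
theorem HasFreePair.conj {S : Set G} (c : G) (h : HasFreePair S) :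
    HasFreePair ((fun s => c * s * c⁻¹) '' S) := by
  obtain ⟨x₁, x₂, y₁, y₂, y₃, h1, h2, h3, h4, h5, h6⟩ := h
  refine ⟨_, _, _, _, _, h1.conj c, h2.conj c, h3.conj c, h4.conj c, h5.conj c,
    FreePair.of_conj c⁻¹ ?_⟩
  simpa [mul_assoc] using h6

theorem HasFreePair.of_conj {S : Set G} (c : G)
    (h : HasFreePair ((fun s => c * s * c⁻¹) '' S)) : HasFreePair S := by
  have := h.conj c⁻¹
  rw [Set.image_image] at this
  simpa [mul_assoc] using this

theorem HasFreePair.of_conj_pair {g s : G} (c : G)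
    (h : HasFreePair {c * g * c⁻¹, c * s * c⁻¹}) : HasFreePair {g, s} :=
  HasFreePair.of_conj c (by simpa [Set.image_pair] using h)

theorem IsLetter.wordLength_le {S : Finset G} {x : G} (h : IsLetter (S : Set G) x) :
    wordLength S x ≤ (1 : ℕ) := by
  rcases h with rfl | h
  · exact wordLength_one_le S 1
  · exact (wordLength_le_iff S x 1).2 ⟨[x], by simpa using h, by simp, by simp⟩

theorem HasFreePair.le_expGrowthRate {S : Finset G} (h : HasFreePair (S : Set G)) {α : ℝ}
    (hα : 1 ≤ α) (hroot : α ^ 3 = α + 1) : α ≤ expGrowthRate S := by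
  obtain ⟨x₁, x₂, y₁, y₂, y₃, h1, h2, h3, h4, h5, h6⟩ := h
  exact h6.le_expGrowthRate (wordLength_mul_le S h1.wordLength_le h2.wordLength_le)
    (wordLength_mul_le S (wordLength_mul_le S h3.wordLength_le h4.wordLength_le)
      h5.wordLength_le) hα hroot

end FreePairs

/-! ### The double cone, its translates as half-trees, and the entry norm. -/

section Cone

open Matrix

/-- The reflection `diag(1, -1)`. -/
def reflW : GL (Fin 2) ℤ := ⟨!![1, 0; 0, -1], !![1, 0; 0, -1], by decide, by decide⟩

/-- The reflection exchanging the coordinates. -/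
def swapF : GL (Fin 2) ℤ := ⟨!![0, 1; 1, 0], !![0, 1; 1, 0], by decide, by decide⟩

/-- The lower elementary matrix. -/
def lowerL : GL (Fin 2) ℤ := ⟨!![1, 0; 1, 1], !![1, 0; -1, 1], by decide, by decide⟩

/-- The upper elementary matrix. -/
def upperR : GL (Fin 2) ℤ := ⟨!![1, 1; 0, 1], !![1, -1; 0, 1], by decide, by decide⟩

theorem GL_two_ext {M N : GL (Fin 2) ℤ} (h00 : M.1 0 0 = N.1 0 0) (h01 : M.1 0 1 = N.1 0 1)
    (h10 : M.1 1 0 = N.1 1 0) (h11 : M.1 1 1 = N.1 1 1) : M = N := by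
  apply Units.ext
  ext i j
  fin_cases i <;> fin_cases j <;> assumption

theorem GL_two_det (M : GL (Fin 2) ℤ) :
    M.1 0 0 * M.1 1 1 - M.1 0 1 * M.1 1 0 = 1 ∨ M.1 0 0 * M.1 1 1 - M.1 0 1 * M.1 1 0 = -1 := by
  rw [← Matrix.det_fin_two]
  exact Int.isUnit_iff.1 ((Matrix.isUnit_iff_isUnit_det _).1 M.isUnit)

theorem GL_two_mul (M N : GL (Fin 2) ℤ) (i j : Fin 2) :
    (M * N).1 i j = M.1 i 0 * N.1 0 j + M.1 i 1 * N.1 1 j := by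
  rw [Units.val_mul, Matrix.mul_apply, Fin.sum_univ_two]

theorem GL_two_inv (M : GL (Fin 2) ℤ) : ∃ δ : ℤ, (δ = 1 ∨ δ = -1) ∧
    M.1 0 0 * M.1 1 1 - M.1 0 1 * M.1 1 0 = δ ∧
    M⁻¹.1 0 0 = δ * M.1 1 1 ∧ M⁻¹.1 0 1 = -(δ * M.1 0 1) ∧
    M⁻¹.1 1 0 = -(δ * M.1 1 0) ∧ M⁻¹.1 1 1 = δ * M.1 0 0 := by
  refine ⟨M.1 0 0 * M.1 1 1 - M.1 0 1 * M.1 1 0, GL_two_det M, rfl, ?_⟩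
  set δ := M.1 0 0 * M.1 1 1 - M.1 0 1 * M.1 1 0 with hδ
  have hδ2 : δ * δ = 1 := by
    rcases GL_two_det M with h | h <;> rw [← hδ] at h <;> rw [h] <;> norm_num
  have h : M.1 * !![δ * M.1 1 1, -(δ * M.1 0 1); -(δ * M.1 1 0), δ * M.1 0 0] = 1 := by
    ext i j
    fin_cases i <;> fin_cases j <;> simp [Matrix.mul_apply, Fin.sum_univ_two] <;>
      first
        | linear_combination hδ2 - δ * hδ
        | ring
  have h2 : M⁻¹.1 = !![δ * M.1 1 1, -(δ * M.1 0 1); -(δ * M.1 1 0), δ * M.1 0 0] := by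
    calc M⁻¹.1 = M⁻¹.1 * (M.1 * !![δ * M.1 1 1, -(δ * M.1 0 1); -(δ * M.1 1 0), δ * M.1 0 0]) := by
          rw [h, mul_one]
      _ = _ := by rw [← mul_assoc, Units.inv_mul, one_mul]
  rw [h2]
  simp

@[simp] theorem reflW_00 : reflW.1 0 0 = 1 := rfl
@[simp] theorem reflW_01 : reflW.1 0 1 = 0 := rfl
@[simp] theorem reflW_10 : reflW.1 1 0 = 0 := rfl
@[simp] theorem reflW_11 : reflW.1 1 1 = -1 := rfl
@[simp] theorem swapF_00 : swapF.1 0 0 = 0 := rfl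
@[simp] theorem swapF_01 : swapF.1 0 1 = 1 := rfl
@[simp] theorem swapF_10 : swapF.1 1 0 = 1 := rfl
@[simp] theorem swapF_11 : swapF.1 1 1 = 0 := rfl
@[simp] theorem lowerL_00 : lowerL.1 0 0 = 1 := rfl
@[simp] theorem lowerL_01 : lowerL.1 0 1 = 0 := rfl
@[simp] theorem lowerL_10 : lowerL.1 1 0 = 1 := rfl
@[simp] theorem lowerL_11 : lowerL.1 1 1 = 1 := rfl
@[simp] theorem upperR_00 : upperR.1 0 0 = 1 := rfl
@[simp] theorem upperR_01 : upperR.1 0 1 = 1 := rfl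
@[simp] theorem upperR_10 : upperR.1 1 0 = 0 := rfl
@[simp] theorem upperR_11 : upperR.1 1 1 = 1 := rfl

@[simp] theorem reflW_mul_self : reflW * reflW = 1 := Units.ext reflW.3

@[simp] theorem swapF_mul_self : swapF * swapF = 1 := Units.ext swapF.3

@[simp] theorem reflW_inv : reflW⁻¹ = reflW := rfl

@[simp] theorem swapF_inv : swapF⁻¹ = swapF := rfl

@[simp] theorem reflW_mul_cancel (M : GL (Fin 2) ℤ) : reflW * (reflW * M) = M := by
  rw [← mul_assoc, reflW_mul_self, one_mul]

/-- The matrices whose entries all have the same sign. They are those mapping the double cone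
`{x y > 0}` into itself. -/
def coneMonoid : Submonoid (GL (Fin 2) ℤ) where
  carrier := {M | (∀ i j, 0 ≤ M.1 i j) ∨ ∀ i j, M.1 i j ≤ 0}
  one_mem' := Or.inl (by simp [Fin.forall_fin_two])
  mul_mem' := by
    intro M N hM hN
    simp only [Set.mem_ofPred_eq, GL_two_mul]
    rcases hM with hM | hM <;> rcases hN with hN | hN
    · exact Or.inl fun i j => add_nonneg (mul_nonneg (hM _ _) (hN _ _)) (mul_nonneg (hM _ _) (hN _ _))
    · exact Or.inr fun i j => add_nonpos (mul_nonpos_of_nonneg_of_nonpos (hM _ _) (hN _ _))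
        (mul_nonpos_of_nonneg_of_nonpos (hM _ _) (hN _ _))
    · exact Or.inr fun i j => add_nonpos (mul_nonpos_of_nonpos_of_nonneg (hM _ _) (hN _ _))
        (mul_nonpos_of_nonpos_of_nonneg (hM _ _) (hN _ _))
    · exact Or.inl fun i j => add_nonneg (mul_nonneg_of_nonpos_of_nonpos (hM _ _) (hN _ _))
        (mul_nonneg_of_nonpos_of_nonpos (hM _ _) (hN _ _))

theorem mem_coneMonoid {M : GL (Fin 2) ℤ} : M ∈ coneMonoid ↔
    (0 ≤ M.1 0 0 ∧ 0 ≤ M.1 0 1 ∧ 0 ≤ M.1 1 0 ∧ 0 ≤ M.1 1 1) ∨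
    (M.1 0 0 ≤ 0 ∧ M.1 0 1 ≤ 0 ∧ M.1 1 0 ≤ 0 ∧ M.1 1 1 ≤ 0) := by
  change ((∀ i j, 0 ≤ M.1 i j) ∨ ∀ i j, M.1 i j ≤ 0) ↔ _
  simp only [Fin.forall_fin_two, and_assoc]

theorem neg_mem_coneMonoid {M : GL (Fin 2) ℤ} (h : M ∈ coneMonoid) : -M ∈ coneMonoid := by
  rw [mem_coneMonoid] at *
  simp only [Units.val_neg, Matrix.neg_apply]
  omega

/-- Matrices agree up to sign with a matrix with nonnegative entries. -/
theorem exists_nonneg_of_mem {M : GL (Fin 2) ℤ} (h : M ∈ coneMonoid) :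
    ∃ M' : GL (Fin 2) ℤ, (M' = M ∨ M' = -M) ∧
      0 ≤ M'.1 0 0 ∧ 0 ≤ M'.1 0 1 ∧ 0 ≤ M'.1 1 0 ∧ 0 ≤ M'.1 1 1 := by
  rcases mem_coneMonoid.1 h with h | h
  · exact ⟨M, Or.inl rfl, h⟩
  · refine ⟨-M, Or.inr rfl, ?_⟩
    simp only [Units.val_neg, Matrix.neg_apply]
    omega

/-- Complements reverse inclusions: `M P ⊆ P` gives `M⁻¹ P' ⊆ P'`, where `P' = reflW P`. -/
theorem conj_inv_mem_coneMonoid {M : GL (Fin 2) ℤ} (h : M ∈ coneMonoid) :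
    reflW * M⁻¹ * reflW ∈ coneMonoid := by
  rw [mem_coneMonoid] at *
  obtain ⟨δ, hδ, -, h1, h2, h3, h4⟩ := GL_two_inv M
  simp only [GL_two_mul, h1, h2, h3, h4, reflW_00, reflW_01, reflW_10, reflW_11]
  rcases hδ with rfl | rfl <;> omega

/-- Half-trees never cross: `M P` lies in `P`, contains it, lies in `P'`, or covers everything
together with `P`. -/
theorem coneMonoid_total (M : GL (Fin 2) ℤ) : M ∈ coneMonoid ∨ M⁻¹ ∈ coneMonoid ∨
    reflW * M ∈ coneMonoid ∨ M * reflW ∈ coneMonoid := by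
  have hinv : reflW * M * reflW ∈ coneMonoid → M⁻¹ ∈ coneMonoid := by
    intro h
    have := conj_inv_mem_coneMonoid h
    simpa [mul_assoc] using this
  suffices H : M ∈ coneMonoid ∨ reflW * M * reflW ∈ coneMonoid ∨
      reflW * M ∈ coneMonoid ∨ M * reflW ∈ coneMonoid by
    rcases H with h | h | h | h
    exacts [Or.inl h, Or.inr (Or.inl (hinv h)), Or.inr (Or.inr (Or.inl h)),
      Or.inr (Or.inr (Or.inr h))]
  simp only [mem_coneMonoid, GL_two_mul, reflW_00, reflW_01, reflW_10, reflW_11]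
  have hdet := GL_two_det M
  generalize M.1 0 0 = a at *
  generalize M.1 0 1 = b at *
  generalize M.1 1 0 = c at *
  generalize M.1 1 1 = d at *
  -- Products of strictly opposite sign would make the determinant at least two in absolute value.
  have key : ¬ (0 < a * d ∧ b * c < 0) ∧ ¬ (a * d < 0 ∧ 0 < b * c) := by omega
  obtain ⟨k1, k2⟩ := key
  rcases lt_trichotomy a 0 with ha | ha | ha <;> rcases lt_trichotomy d 0 with hd | hd | hd <;>
    first
    | (subst ha; omega)
    | (subst hd; omega)
    | (rcases lt_trichotomy b 0 with hb | hb | hb <;> rcases lt_trichotomy c 0 with hc | hc | hc <;>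
      first
      | omega
      | exact absurd ⟨by nlinarith, by nlinarith⟩ k1
      | exact absurd ⟨by nlinarith, by nlinarith⟩ k2)

/-- `P` and `P'` are disjoint; algebraically, a row of `M` would vanish. -/
theorem not_mem_of_reflW_mul_mem {M : GL (Fin 2) ℤ} (h : M ∈ coneMonoid) :
    reflW * M ∉ coneMonoid := by
  intro h'
  rw [mem_coneMonoid] at *
  have hdet := GL_two_det M
  simp only [GL_two_mul, reflW_00, reflW_01, reflW_10, reflW_11] at h'
  have : (M.1 0 0 = 0 ∧ M.1 0 1 = 0) ∨ (M.1 1 0 = 0 ∧ M.1 1 1 = 0) := by omega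
  rcases this with ⟨h1, h2⟩ | ⟨h1, h2⟩ <;> simp [h1, h2] at hdet

/-- The inverse is the adjugate up to sign, where diagonal and off-diagonal entries have opposite
signs; so one of the two diagonals of `M` is zero. -/
theorem eq_of_mem_of_inv_mem {M : GL (Fin 2) ℤ} (h : M ∈ coneMonoid) (h' : M⁻¹ ∈ coneMonoid) :
    (M = 1 ∨ M = -1) ∨ M = swapF ∨ M = -swapF := by
  obtain ⟨δ, hδ, hd, h1, h2, h3, h4⟩ := GL_two_inv M
  rw [mem_coneMonoid, h1, h2, h3, h4] at h'
  rw [mem_coneMonoid] at h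
  have hcases : (M.1 0 1 = 0 ∧ M.1 1 0 = 0) ∨ (M.1 0 0 = 0 ∧ M.1 1 1 = 0) := by
    rcases hδ with rfl | rfl <;> omega
  rcases hcases with ⟨hb, hc⟩ | ⟨ha, hd'⟩
  · left
    rw [hb, hc] at hd
    have hu : M.1 0 0 * M.1 1 1 = 1 := by
      have : 0 ≤ M.1 0 0 * M.1 1 1 := by
        rcases h with h | h
        · exact mul_nonneg h.1 h.2.2.2
        · exact mul_nonneg_of_nonpos_of_nonpos h.1 h.2.2.2
      omega
    rcases Int.mul_eq_one_iff_eq_one_or_neg_one.1 hu with ⟨e1, e2⟩ | ⟨e1, e2⟩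
    · left; apply GL_two_ext <;> simp [hb, hc, e1, e2]
    · right; apply GL_two_ext <;> simp [hb, hc, e1, e2]
  · right
    rw [ha, hd'] at hd
    have hu : M.1 0 1 * M.1 1 0 = 1 := by
      have : 0 ≤ M.1 0 1 * M.1 1 0 := by
        rcases h with h | h
        · exact mul_nonneg h.2.1 h.2.2.1
        · exact mul_nonneg_of_nonpos_of_nonpos h.2.1 h.2.2.1
      omega
    rcases Int.mul_eq_one_iff_eq_one_or_neg_one.1 hu with ⟨e1, e2⟩ | ⟨e1, e2⟩
    · left; apply GL_two_ext <;> simp [ha, hd', e1, e2]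
    · right; apply GL_two_ext <;> simp [ha, hd', e1, e2]

theorem swapF_mem_coneMonoid : swapF ∈ coneMonoid := by simp [mem_coneMonoid]

theorem lowerL_mem_coneMonoid : lowerL ∈ coneMonoid := by simp [mem_coneMonoid]

theorem upperR_mem_coneMonoid : upperR ∈ coneMonoid := by simp [mem_coneMonoid]

theorem reflW_not_mem_coneMonoid : reflW ∉ coneMonoid := by
  simpa using not_mem_of_reflW_mul_mem (one_mem coneMonoid)

/-- Sum of the absolute values of the entries. -/
def entryNorm (M : GL (Fin 2) ℤ) : ℕ :=
  (M.1 0 0).natAbs + (M.1 0 1).natAbs + (M.1 1 0).natAbs + (M.1 1 1).natAbs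

@[simp] theorem entryNorm_neg (M : GL (Fin 2) ℤ) : entryNorm (-M) = entryNorm M := by
  simp [entryNorm]

@[simp] theorem entryNorm_reflW_mul (M : GL (Fin 2) ℤ) : entryNorm (reflW * M) = entryNorm M := by
  simp [entryNorm, GL_two_mul]

@[simp] theorem entryNorm_mul_reflW (M : GL (Fin 2) ℤ) : entryNorm (M * reflW) = entryNorm M := by
  simp [entryNorm, GL_two_mul]

theorem mem_of_neg_mem {M : GL (Fin 2) ℤ} (h : -M ∈ coneMonoid) : M ∈ coneMonoid := by
  simpa using neg_mem_coneMonoid h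

theorem inv_mem_of_eq_one_or_swapF {M : GL (Fin 2) ℤ} (h : M = 1 ∨ M = swapF) :
    M⁻¹ ∈ coneMonoid := by
  rcases h with rfl | rfl
  · simp [one_mem]
  · simpa using swapF_mem_coneMonoid

/-- With column sums `p, q` of `M` and row sums `r, t` of `N`, all at least one, the norm of the
product is `p r + q t`. The sums are both one only for the identity and the swap. -/
theorem entryNorm_mul_of_nonneg {M N : GL (Fin 2) ℤ}
    (hM : 0 ≤ M.1 0 0 ∧ 0 ≤ M.1 0 1 ∧ 0 ≤ M.1 1 0 ∧ 0 ≤ M.1 1 1)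
    (hN : 0 ≤ N.1 0 0 ∧ 0 ≤ N.1 0 1 ∧ 0 ≤ N.1 1 0 ∧ 0 ≤ N.1 1 1) :
    (entryNorm N ≤ entryNorm (M * N) ∧ entryNorm M ≤ entryNorm (M * N)) ∧
    (M⁻¹ ∉ coneMonoid → entryNorm N < entryNorm (M * N)) ∧
    (N⁻¹ ∉ coneMonoid → entryNorm M < entryNorm (M * N)) := by
  obtain ⟨hM1, hM2, hM3, hM4⟩ := hM
  obtain ⟨hN1, hN2, hN3, hN4⟩ := hN
  have dM := GL_two_det M
  have dN := GL_two_det N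
  have eM : M.1 0 0 + M.1 1 0 = 1 → M.1 0 1 + M.1 1 1 = 1 → M⁻¹ ∈ coneMonoid := by
    intro h1 h2
    apply inv_mem_of_eq_one_or_swapF
    have : M.1 1 0 = 1 - M.1 0 0 := by omega
    have : M.1 1 1 = 1 - M.1 0 1 := by omega
    have hc1 : M.1 0 0 = 0 ∨ M.1 0 0 = 1 := by omega
    have hc2 : M.1 0 1 = 0 ∨ M.1 0 1 = 1 := by omega
    rcases hc1 with hc1 | hc1 <;> rcases hc2 with hc2 | hc2 <;> simp_all
    · right; apply GL_two_ext <;> simp_all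
    · left; apply GL_two_ext <;> simp_all
  have eN : N.1 0 0 + N.1 0 1 = 1 → N.1 1 0 + N.1 1 1 = 1 → N⁻¹ ∈ coneMonoid := by
    intro h1 h2
    apply inv_mem_of_eq_one_or_swapF
    have : N.1 0 1 = 1 - N.1 0 0 := by omega
    have : N.1 1 1 = 1 - N.1 1 0 := by omega
    have hc1 : N.1 0 0 = 0 ∨ N.1 0 0 = 1 := by omega
    have hc2 : N.1 1 0 = 0 ∨ N.1 1 0 = 1 := by omega
    rcases hc1 with hc1 | hc1 <;> rcases hc2 with hc2 | hc2 <;> simp_all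
    · right; apply GL_two_ext <;> simp_all
    · left; apply GL_two_ext <;> simp_all
  have s1 : 1 ≤ M.1 0 0 + M.1 1 0 := by
    by_contra h
    have h1 : M.1 0 0 = 0 := by omega
    have h2 : M.1 1 0 = 0 := by omega
    simp [h1, h2] at dM
  have s2 : 1 ≤ M.1 0 1 + M.1 1 1 := by
    by_contra h
    have h1 : M.1 0 1 = 0 := by omega
    have h2 : M.1 1 1 = 0 := by omega
    simp [h1, h2] at dM
  have s3 : 1 ≤ N.1 0 0 + N.1 0 1 := by
    by_contra h
    have h1 : N.1 0 0 = 0 := by omega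
    have h2 : N.1 0 1 = 0 := by omega
    simp [h1, h2] at dN
  have s4 : 1 ≤ N.1 1 0 + N.1 1 1 := by
    by_contra h
    have h1 : N.1 1 0 = 0 := by omega
    have h2 : N.1 1 1 = 0 := by omega
    simp [h1, h2] at dN
  have nM : (entryNorm M : ℤ) = (M.1 0 0 + M.1 1 0) + (M.1 0 1 + M.1 1 1) := by
    unfold entryNorm; omega
  have nN : (entryNorm N : ℤ) = (N.1 0 0 + N.1 0 1) + (N.1 1 0 + N.1 1 1) := by
    unfold entryNorm; omega
  have nMN : (entryNorm (M * N) : ℤ) = (M.1 0 0 + M.1 1 0) * (N.1 0 0 + N.1 0 1) +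
      (M.1 0 1 + M.1 1 1) * (N.1 1 0 + N.1 1 1) := by
    unfold entryNorm
    simp only [GL_two_mul]
    push_cast
    rw [abs_of_nonneg (by positivity), abs_of_nonneg (by positivity), abs_of_nonneg (by positivity),
      abs_of_nonneg (by positivity)]
    ring
  generalize M.1 0 0 + M.1 1 0 = p at *
  generalize M.1 0 1 + M.1 1 1 = q at *
  generalize N.1 0 0 + N.1 0 1 = r at *
  generalize N.1 1 0 + N.1 1 1 = t at *
  zify
  rw [nM, nN, nMN]
  refine ⟨⟨by nlinarith, by nlinarith⟩, fun h => ?_, fun h => ?_⟩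
  · have : 2 ≤ p ∨ 2 ≤ q := by
      by_contra h'
      exact h (eM (by omega) (by omega))
    rcases this with h' | h' <;> nlinarith
  · have : 2 ≤ r ∨ 2 ≤ t := by
      by_contra h'
      exact h (eN (by omega) (by omega))
    rcases this with h' | h' <;> nlinarith

theorem entryNorm_mul {M N : GL (Fin 2) ℤ} (hM : M ∈ coneMonoid) (hN : N ∈ coneMonoid) :
    (entryNorm N ≤ entryNorm (M * N) ∧ entryNorm M ≤ entryNorm (M * N)) ∧
    (M⁻¹ ∉ coneMonoid → entryNorm N < entryNorm (M * N)) ∧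
    (N⁻¹ ∉ coneMonoid → entryNorm M < entryNorm (M * N)) := by
  have hneg (X : GL (Fin 2) ℤ) : -X ∈ coneMonoid ↔ X ∈ coneMonoid :=
    ⟨mem_of_neg_mem, neg_mem_coneMonoid⟩
  obtain ⟨M', h1, hM'⟩ := exists_nonneg_of_mem hM
  obtain ⟨N', h2, hN'⟩ := exists_nonneg_of_mem hN
  have := entryNorm_mul_of_nonneg hM' hN'
  rcases h1 with rfl | rfl <;> rcases h2 with rfl | rfl <;> simpa [inv_neg, hneg] using this

/-- The swap exchanges the two parts of `P` on either side of the line `x = y`, and `g P` lies in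
one of them because one row of `g` dominates the other. Hence the swap moves `g P` off itself. -/
theorem reflW_mul_inv_mul_swapF_mul_mem {g : GL (Fin 2) ℤ} (h : g ∈ coneMonoid)
    (h' : g⁻¹ ∉ coneMonoid) : reflW * (g⁻¹ * swapF * g) ∈ coneMonoid := by
  wlog hpos : 0 ≤ g.1 0 0 ∧ 0 ≤ g.1 0 1 ∧ 0 ≤ g.1 1 0 ∧ 0 ≤ g.1 1 1 generalizing g
  · have hneg : 0 ≤ (-g).1 0 0 ∧ 0 ≤ (-g).1 0 1 ∧ 0 ≤ (-g).1 1 0 ∧ 0 ≤ (-g).1 1 1 := by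
      have := (mem_coneMonoid.1 h).resolve_left hpos
      simp only [Units.val_neg, Matrix.neg_apply]
      omega
    have := this (neg_mem_coneMonoid h)
      (fun h2 => h' (mem_of_neg_mem (by rwa [inv_neg] at h2))) hneg
    simpa [inv_neg] using this
  obtain ⟨δ, hδ, hd, h1, h2, h3, h4⟩ := GL_two_inv g
  -- If neither row dominates, the determinant exceeds in absolute value the sum of the two smaller
  -- entries, so these vanish and `g` is the identity or the swap.
  have hrow : (g.1 0 0 ≤ g.1 1 0 ∧ g.1 0 1 ≤ g.1 1 1) ∨ (g.1 1 0 ≤ g.1 0 0 ∧ g.1 1 1 ≤ g.1 0 1) := by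
    by_contra hcon
    apply h'
    apply inv_mem_of_eq_one_or_swapF
    have hc : (g.1 1 0 < g.1 0 0 ∧ g.1 0 1 < g.1 1 1) ∨ (g.1 0 0 < g.1 1 0 ∧ g.1 1 1 < g.1 0 1) := by
      omega
    obtain ⟨p1, p2, p3, p4⟩ := hpos
    rcases hc with ⟨c1, c2⟩ | ⟨c1, c2⟩
    · have : g.1 1 0 + g.1 0 1 + 1 ≤ g.1 0 0 * g.1 1 1 - g.1 0 1 * g.1 1 0 := by nlinarith
      have hb : g.1 0 1 = 0 := by omega
      have hc : g.1 1 0 = 0 := by omega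
      rw [hb, hc] at hd
      have hu : g.1 0 0 * g.1 1 1 = 1 := by
        have : 0 ≤ g.1 0 0 * g.1 1 1 := mul_nonneg p1 p4
        omega
      rcases Int.mul_eq_one_iff_eq_one_or_neg_one.1 hu with ⟨e1, e2⟩ | ⟨e1, e2⟩
      · left; apply GL_two_ext <;> simp [hb, hc, e1, e2]
      · omega
    · have : g.1 0 0 + g.1 1 1 + 1 ≤ g.1 0 1 * g.1 1 0 - g.1 0 0 * g.1 1 1 := by nlinarith
      have hb : g.1 0 0 = 0 := by omega
      have hc : g.1 1 1 = 0 := by omega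
      rw [hb, hc] at hd
      have hu : g.1 0 1 * g.1 1 0 = 1 := by
        have : 0 ≤ g.1 0 1 * g.1 1 0 := mul_nonneg p2 p3
        omega
      rcases Int.mul_eq_one_iff_eq_one_or_neg_one.1 hu with ⟨e1, e2⟩ | ⟨e1, e2⟩
      · right; apply GL_two_ext <;> simp [hb, hc, e1, e2]
      · omega
  clear hd h'
  rw [mem_coneMonoid]
  simp only [GL_two_mul, h1, h2, h3, h4, reflW_00, reflW_01, reflW_10, reflW_11, swapF_00, swapF_01,
    swapF_10, swapF_11]
  generalize g.1 0 0 = a at *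
  generalize g.1 0 1 = b at *
  generalize g.1 1 0 = c at *
  generalize g.1 1 1 = d at *
  obtain ⟨p1, p2, p3, p4⟩ := hpos
  rcases hrow with ⟨r1, r2⟩ | ⟨r1, r2⟩
  · have q1 : a * b ≤ c * d := mul_le_mul r1 r2 p2 p3
    have q2 : a * a ≤ c * c := mul_le_mul r1 r1 p1 p3
    have q3 : b * b ≤ d * d := mul_le_mul r2 r2 p2 p4
    rcases hδ with rfl | rfl
    · left; refine ⟨?_, ?_, ?_, ?_⟩ <;> linarith
    · right; refine ⟨?_, ?_, ?_, ?_⟩ <;> linarith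
  · have q1 : c * d ≤ a * b := mul_le_mul r1 r2 p4 p1
    have q2 : c * c ≤ a * a := mul_le_mul r1 r1 p3 p1
    have q3 : d * d ≤ b * b := mul_le_mul r2 r2 p4 p2
    rcases hδ with rfl | rfl
    · right; refine ⟨?_, ?_, ?_, ?_⟩ <;> linarith
    · left; refine ⟨?_, ?_, ?_, ?_⟩ <;> linarith

end Cone

/-! ### Ping-pong inside the cone monoid. -/

section PingPong

local notation "w" => reflW

/-- Inclusion of the half-trees `X • P` and `Y • P`, where `P` is the double cone. -/
def HalfLE (X Y : GL (Fin 2) ℤ) : Prop := Y⁻¹ * X ∈ coneMonoid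

variable {X Y Z : GL (Fin 2) ℤ}

theorem HalfLE.trans (h : HalfLE X Y) (h' : HalfLE Y Z) : HalfLE X Z := by
  have := mul_mem h' h
  unfold HalfLE
  rwa [show Z⁻¹ * Y * (Y⁻¹ * X) = Z⁻¹ * X by group] at this

theorem HalfLE.mul_left (c : GL (Fin 2) ℤ) (h : HalfLE X Y) : HalfLE (c * X) (c * Y) := by
  unfold HalfLE
  rwa [show (c * Y)⁻¹ * (c * X) = Y⁻¹ * X by group]

theorem HalfLE.compl (h : HalfLE X Y) : HalfLE (Y * w) (X * w) := by
  have := conj_inv_mem_coneMonoid h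
  unfold HalfLE
  simpa [mul_assoc] using this

theorem halfLE_total (X Y : GL (Fin 2) ℤ) :
    HalfLE X Y ∨ HalfLE Y X ∨ HalfLE X (Y * w) ∨ HalfLE (X * w) Y := by
  have := coneMonoid_total (Y⁻¹ * X)
  simpa [HalfLE, mul_assoc] using this

theorem HalfLE.not_le_compl (h : HalfLE X Y) : ¬ HalfLE X (Y * w) := by
  have := not_mem_of_reflW_mul_mem h
  simpa [HalfLE, mul_assoc] using this

theorem halfLE_one {X : GL (Fin 2) ℤ} : HalfLE X 1 ↔ X ∈ coneMonoid := by simp [HalfLE]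

theorem mul_self_eq_one_of_inv_mem {M : GL (Fin 2) ℤ} (h : M ∈ coneMonoid)
    (h' : M⁻¹ ∈ coneMonoid) : M * M = 1 := by
  rcases eq_of_mem_of_inv_mem h h' with (rfl | rfl) | rfl | rfl <;> simp

theorem inv_not_mem_of_mul_self_ne_one {M : GL (Fin 2) ℤ} (h : M ∈ coneMonoid)
    (h' : M * M ≠ 1) : M⁻¹ ∉ coneMonoid := fun h2 => h' (mul_self_eq_one_of_inv_mem h h2)

theorem mul_self_ne_one_of_inv_not_mem {M : GL (Fin 2) ℤ} (h : M ∈ coneMonoid)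
    (h' : M⁻¹ ∉ coneMonoid) : M * M ≠ 1 := fun h2 => h' (by rwa [inv_eq_of_mul_eq_one_right h2])

theorem reflW_mul_conj_mem {g k : GL (Fin 2) ℤ} (hg : g ∈ coneMonoid) (hg' : g⁻¹ ∉ coneMonoid)
    (hk : k ∈ coneMonoid) (hk' : k⁻¹ ∈ coneMonoid) (h1 : ¬ (k = 1 ∨ k = -1)) :
    w * (g⁻¹ * k * g) ∈ coneMonoid := by
  have := reflW_mul_inv_mul_swapF_mul_mem hg hg'
  rcases (eq_of_mem_of_inv_mem hk hk').resolve_left h1 with rfl | rfl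
  · exact this
  · simpa using neg_mem_coneMonoid this

/-- Plain ping-pong on `P` fails, since `g P = g k P`. But a nonempty word is `g n` with `n` in the
monoid, so a relation becomes `g n' = k g n`, impossible because `k` moves `g P` off itself. Empty
words would force `k = 1` or make `g` invertible in the monoid. -/
theorem freePair_mul_right {g k : GL (Fin 2) ℤ} (hg : g ∈ coneMonoid) (hg' : g⁻¹ ∉ coneMonoid)
    (hk : k ∈ coneMonoid) (hk' : k⁻¹ ∈ coneMonoid) (h1 : ¬ (k = 1 ∨ k = -1)) :
    FreePair g (g * k) := by
  have hw := reflW_mul_conj_mem hg hg' hk hk' h1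
  have hle : Submonoid.closure {g, g * k} ≤ coneMonoid := by
    rw [Submonoid.closure_le]
    rintro z (rfl | rfl)
    exacts [hg, mul_mem hg hk]
  have hform : ∀ v ∈ Submonoid.closure {g, g * k}, v = 1 ∨ ∃ n ∈ coneMonoid, v = g * n := by
    intro v hv
    induction hv using Submonoid.closure_induction_left with
    | one => exact Or.inl rfl
    | mul_left z hz y hy _ =>
      rcases hz with rfl | rfl
      · exact Or.inr ⟨y, hle hy, rfl⟩
      · exact Or.inr ⟨k * y, mul_mem hk (hle hy), mul_assoc _ _ _⟩
  intro v hv u hu huv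
  rw [mul_assoc, mul_right_inj] at huv
  rcases hform u hu with rfl | ⟨n, hn, rfl⟩ <;> rcases hform v hv with rfl | ⟨n', hn', rfl⟩
  · exact h1 (Or.inl (by simpa using huv.symm))
  · apply hg'
    have : g⁻¹ = n' * k := by
      rw [inv_eq_iff_mul_eq_one, ← mul_assoc, huv, mul_one,
        mul_self_eq_one_of_inv_mem hk hk']
    rw [this]
    exact mul_mem hn' hk
  · apply hg'
    have : g⁻¹ = n * k := by
      rw [inv_eq_iff_mul_eq_one, ← mul_assoc]
      exact mul_eq_one_comm.1 huv.symm
    rw [this]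
    exact mul_mem hn hk
  · have : n' = g⁻¹ * k * g * n := by
      rw [mul_assoc, mul_assoc, ← huv]; group
    refine not_mem_of_reflW_mul_mem hn' ?_
    rw [this, ← mul_assoc]
    exact mul_mem hw hn

theorem freePair_mul_left {g k : GL (Fin 2) ℤ} (hg : g ∈ coneMonoid) (hg' : g⁻¹ ∉ coneMonoid)
    (hk : k ∈ coneMonoid) (hk' : k⁻¹ ∈ coneMonoid) (h1 : ¬ (k = 1 ∨ k = -1)) :
    FreePair g (k * g) := by
  refine FreePair.of_ping_pong (coneMonoid : Set _) ⟨1, one_mem _⟩ (fun a ha => mul_mem hg ha)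
    (fun a ha => mul_mem (mul_mem hk hg) ha) fun a ha b hb hab => ?_
  refine not_mem_of_reflW_mul_mem ha ?_
  have : a = g⁻¹ * k * g * b := by
    rw [mul_assoc, mul_assoc, ← mul_assoc k, ← hab]; group
  rw [this, ← mul_assoc]
  exact mul_mem (reflW_mul_conj_mem hg hg' hk hk' h1) hb

theorem freePair_of_disjoint {g h : GL (Fin 2) ℤ} (hg : g ∈ coneMonoid) (hh : h ∈ coneMonoid)
    (H : w * (g⁻¹ * h) ∈ coneMonoid) : FreePair g h := by
  refine FreePair.of_ping_pong (coneMonoid : Set _) ⟨1, one_mem _⟩ (fun a ha => mul_mem hg ha)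
    (fun a ha => mul_mem hh ha) fun a ha b hb hab => ?_
  refine not_mem_of_reflW_mul_mem ha ?_
  have : a = g⁻¹ * h * b := by
    rw [mul_assoc, ← hab]; group
  rw [this, ← mul_assoc]
  exact mul_mem H hb

/-- Two nontrivial elements of the cone monoid commute or generate a free monoid. -/
theorem commute_or_freePair_of_mem {g h : GL (Fin 2) ℤ} (hg : g ∈ coneMonoid)
    (hg' : g⁻¹ ∉ coneMonoid) (hh : h ∈ coneMonoid) (hh' : h⁻¹ ∉ coneMonoid) :
    Commute g h ∨ FreePair g h := by
  induction hn : entryNorm g + entryNorm h using Nat.strong_induction_on generalizing g h with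
  | _ n ih =>
    -- Euclidean step: if `h P ⊆ g P`, then `h = g k` with `k` in the monoid, and the pair `g, k`
    -- has smaller total norm.
    have step : ∀ {g h : GL (Fin 2) ℤ}, g ∈ coneMonoid → g⁻¹ ∉ coneMonoid →
        entryNorm g + entryNorm h = n → g⁻¹ * h ∈ coneMonoid → Commute g h ∨ FreePair g h := by
      intro g h hg hg' hn hk
      obtain ⟨k, rfl⟩ : ∃ k, h = g * k := ⟨g⁻¹ * h, by group⟩
      rw [inv_mul_cancel_left] at hk
      by_cases hk' : k⁻¹ ∈ coneMonoid
      · by_cases h1 : k = 1 ∨ k = -1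
        · left
          rcases h1 with rfl | rfl <;> simp [Commute, SemiconjBy]
        · exact Or.inr (freePair_mul_right hg hg' hk hk' h1)
      · have hlt := (entryNorm_mul hg hk).2.1 hg'
        rcases ih (entryNorm g + entryNorm k) (by omega) hg hg' hk hk' rfl with hc | hf
        · exact Or.inl ((Commute.refl g).mul_right hc)
        · exact Or.inr hf.mul_left.symm
    rcases halfLE_total h g with H | H | H | H
    · exact step hg hg' hn H
    · rcases step hh hh' (by omega) H with hc | hf
      exacts [Or.inl hc.symm, Or.inr hf.symm]
    · right
      refine freePair_of_disjoint hg hh ?_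
      simpa [HalfLE, mul_assoc] using H
    -- The half-trees cannot cover, as both lie in `P`.
    · exfalso
      have h1 : HalfLE (1 * w) (h * w) := (halfLE_one.2 hh).compl
      have h2 := (h1.trans H).trans (halfLE_one.2 hg)
      rw [halfLE_one, one_mul] at h2
      exact reflW_not_mem_coneMonoid h2

/-- Conjugation by `x⁻¹` moves the common half-tree `x P` to `P`; there a nontrivial square means
that the inverse is outside the monoid. -/
theorem commute_or_freePair (x : GL (Fin 2) ℤ) {g h : GL (Fin 2) ℤ}
    (hg : HalfLE (g * x) x) (hg' : g * g ≠ 1) (hh : HalfLE (h * x) x) (hh' : h * h ≠ 1) :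
    Commute g h ∨ FreePair g h := by
  have hsq : ∀ {k : GL (Fin 2) ℤ}, k * k ≠ 1 → x⁻¹ * k * x⁻¹⁻¹ * (x⁻¹ * k * x⁻¹⁻¹) ≠ 1 := by
    intro k hk h1
    apply hk
    rw [show k * k = x * (x⁻¹ * k * x⁻¹⁻¹ * (x⁻¹ * k * x⁻¹⁻¹)) * x⁻¹ by group, h1]
    group
  have hg1 : x⁻¹ * g * x⁻¹⁻¹ ∈ coneMonoid := by simpa [HalfLE, mul_assoc] using hg
  have hh1 : x⁻¹ * h * x⁻¹⁻¹ ∈ coneMonoid := by simpa [HalfLE, mul_assoc] using hh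
  rcases commute_or_freePair_of_mem hg1 (inv_not_mem_of_mul_self_ne_one hg1 (hsq hg')) hh1
    (inv_not_mem_of_mul_self_ne_one hh1 (hsq hh')) with hc | hf
  · exact Or.inl ((Commute.conj_iff _).1 hc)
  · exact Or.inr (FreePair.of_conj _ hf)

end PingPong

/-! ### A hyperbolic element against an arbitrary second letter. -/

section Skew

local notation "w" => reflW

theorem HasFreePair.of_freePair {G : Type u} [Group G] {S : Set G} {x y₁ y₂ y₃ : G}
    (hx : IsLetter S x) (h1 : IsLetter S y₁) (h2 : IsLetter S y₂) (h3 : IsLetter S y₃)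
    (h : FreePair x (y₁ * y₂ * y₃)) : HasFreePair S :=
  ⟨x, 1, y₁, y₂, y₃, hx, IsLetter.one S, h1, h2, h3, by simpa using h⟩

theorem isLetter_left {G : Type u} [Group G] (g s : G) : IsLetter {g, s} g :=
  IsLetter.of_mem (by simp)

theorem isLetter_right {G : Type u} [Group G] (g s : G) : IsLetter {g, s} s :=
  IsLetter.of_mem (by simp)

theorem isLetter_pair_subset {G : Type u} [Group G] {g s : G} {T : Set G} (hg : IsLetter T g)
    (hs : IsLetter T s) : ∀ x ∈ ({g, s} : Set G), IsLetter T x := by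
  rintro x (rfl | rfl)
  exacts [hg, hs]

variable {g s : GL (Fin 2) ℤ}

/-- If `s` preserves `P` and is not `±1`, it is the swap up to sign and the pair is `g, s g`;
otherwise the dichotomy applies to `g` and `s` themselves. -/
theorem hasFreePair_or_commute_of_mem (hg : g ∈ coneMonoid) (hg' : g⁻¹ ∉ coneMonoid)
    (hs : s ∈ coneMonoid) : HasFreePair {g, s} ∨ Commute (s * g * s⁻¹) g := by
  have hcomm : Commute g s → Commute (s * g * s⁻¹) g := by
    intro h
    rw [← h.eq, mul_inv_cancel_right]
  by_cases hs' : s⁻¹ ∈ coneMonoid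
  · by_cases h1 : s = 1 ∨ s = -1
    · right
      apply hcomm
      rcases h1 with rfl | rfl <;> simp [Commute, SemiconjBy]
    · refine Or.inl (HasFreePair.of_freePair (y₃ := 1) (isLetter_left g s) (isLetter_right g s)
        (isLetter_left g s) (IsLetter.one _) ?_)
      rw [mul_one]
      exact freePair_mul_left hg hg' hs hs' h1
  · rcases commute_or_freePair_of_mem hg hg' hs hs' with h | h
    · exact Or.inr (hcomm h)
    · refine Or.inl (HasFreePair.of_freePair (y₂ := 1) (y₃ := 1) (isLetter_left g s)
        (isLetter_right g s) (IsLetter.one _) (IsLetter.one _) ?_)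
      simpa using h

theorem hasFreePair_or_commute_of_inv_right
    (h : HasFreePair {g, s⁻¹} ∨ Commute (s⁻¹ * g * s⁻¹⁻¹) g) :
    HasFreePair {g, s} ∨ Commute (s * g * s⁻¹) g := by
  refine h.imp (fun h => h.of_letters (isLetter_pair_subset (isLetter_left g s)
    (isLetter_right g s).inv)) fun h => ?_
  rw [← Commute.conj_iff s] at h
  simpa [mul_assoc] using h.symm

theorem hasFreePair_or_commute_of_conj (c : GL (Fin 2) ℤ)
    (h : HasFreePair {c * g * c⁻¹, c * s * c⁻¹} ∨
      Commute ((c * s * c⁻¹) * (c * g * c⁻¹) * (c * s * c⁻¹)⁻¹) (c * g * c⁻¹)) :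
    HasFreePair {g, s} ∨ Commute (s * g * s⁻¹) g := by
  refine h.imp (fun h => h.of_conj_pair c) fun h => ?_
  rw [show (c * s * c⁻¹) * (c * g * c⁻¹) * (c * s * c⁻¹)⁻¹ = c * (s * g * s⁻¹) * c⁻¹ by group] at h
  exact (Commute.conj_iff c).1 h

/-- The word `s g⁻¹ s⁻¹` of length three shrinks the same half-tree as `g`, so the two commute or
are free. -/
theorem hasFreePair_or_commute_of_flip {x : GL (Fin 2) ℤ} (hsq : g * g ≠ 1)
    (h1 : HalfLE (g * x) x) (h2 : HalfLE (s * g⁻¹ * s⁻¹ * x) x) :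
    HasFreePair {g, s} ∨ Commute (s * g * s⁻¹) g := by
  have hsq' : s * g⁻¹ * s⁻¹ * (s * g⁻¹ * s⁻¹) ≠ 1 := by
    intro h
    apply hsq
    have := congrArg (fun z => (s⁻¹ * z * s)⁻¹) h
    simpa [mul_assoc] using this
  rcases commute_or_freePair x h1 hsq h2 hsq' with h | h
  · right
    have := h.symm.inv_left
    rwa [show (s * g⁻¹ * s⁻¹)⁻¹ = s * g * s⁻¹ by group] at this
  · exact Or.inl (HasFreePair.of_freePair (isLetter_left g s) (isLetter_right g s)
      (isLetter_left g s).inv (isLetter_right g s).inv h)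

theorem HalfLE.compl_right {X Y : GL (Fin 2) ℤ} (h : HalfLE X (Y * w)) : HalfLE Y (X * w) := by
  simpa [mul_assoc] using h.compl

/-- Here `s P' ⊆ P`, and `s g P` is disjoint from `g P`. If `s P'` or `s⁻¹ P'` is nested with `g P`,
then `g` and a conjugate of `g⁻¹` shrink a common half-tree. If both are disjoint from `g P`, then
`g` and `s g s⁻¹` play ping-pong on `g P ∪ s g P`. -/
theorem hasFreePair_or_commute_of_turn (hg : g ∈ coneMonoid) (hg' : g⁻¹ ∉ coneMonoid)
    (h1 : HalfLE (s * w) 1) (h2 : HalfLE (s * g) (g * w)) :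
    HasFreePair {g, s} ∨ Commute (s * g * s⁻¹) g := by
  have hsq := mul_self_ne_one_of_inv_not_mem hg hg'
  have hg1 : HalfLE g 1 := halfLE_one.2 hg
  have hgg : ∀ {x}, HalfLE x 1 → HalfLE (g * x) g := fun h => by simpa using h.mul_left g
  have hcompl : HalfLE w (g * w) := by simpa using hg1.compl
  -- the two nested configurations
  have nested : ∀ s : GL (Fin 2) ℤ, HalfLE (s * w) 1 → HalfLE (s * g) (g * w) →
      HalfLE (s * w) g ∨ HalfLE g (s * w) → HasFreePair {g, s} ∨ Commute (s * g * s⁻¹) g := by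
    intro s h1 h2 h
    have h3 : HalfLE g (s * (g * w)) := by simpa [mul_assoc] using h2.compl_right
    rcases h with h | h
    · refine hasFreePair_or_commute_of_flip hsq (hgg hg1) (x := g) ?_
      have h4 : HalfLE (g⁻¹ * s⁻¹ * g) w := by
        have := h3.mul_left (g⁻¹ * s⁻¹)
        simpa [mul_assoc] using this
      have h5 := h4.mul_left s
      simp only [← mul_assoc] at h5
      exact h5.trans h
    · refine hasFreePair_or_commute_of_flip hsq (x := s * w) ((hgg h1).trans h) ?_
      have h4 : HalfLE (g⁻¹ * w) w := by simpa using hcompl.mul_left g⁻¹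
      simpa [mul_assoc] using h4.mul_left s
  -- If `s P'` and `g P` covered everything, then `P' ⊆ g P' ⊆ s P' ⊆ P`.
  have cover : ∀ s : GL (Fin 2) ℤ, HalfLE (s * w) 1 → ¬ HalfLE (s * w * w) g := by
    intro s h1 h
    have h4 : HalfLE s g := by simpa [mul_assoc] using h
    have h5 : HalfLE (g * w) 1 := h4.compl.trans h1
    have h6 := hcompl.trans h5
    exact reflW_not_mem_coneMonoid (halfLE_one.1 h6)
  have h1' : HalfLE (s⁻¹ * w) 1 := by
    have := (h1.mul_left s⁻¹).compl
    simpa [mul_assoc] using this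
  have h2' : HalfLE (s⁻¹ * g) (g * w) := by
    simpa [mul_assoc] using (h2.mul_left s⁻¹).compl
  rcases halfLE_total (s * w) g with h | h | h | h
  · exact nested s h1 h2 (Or.inl h)
  · exact nested s h1 h2 (Or.inr h)
  · rcases halfLE_total (s⁻¹ * w) g with h' | h' | h' | h'
    · exact hasFreePair_or_commute_of_inv_right (nested s⁻¹ h1' h2' (Or.inl h'))
    · exact hasFreePair_or_commute_of_inv_right (nested s⁻¹ h1' h2' (Or.inr h'))
    · left
      have k1 : HalfLE g s := by simpa [mul_assoc] using h.compl
      have k2 : HalfLE g s⁻¹ := by simpa [mul_assoc] using h'.compl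
      have k3 : HalfLE (s⁻¹ * g) 1 := by simpa using k1.mul_left s⁻¹
      have k4 : HalfLE (s * g) 1 := by simpa using k2.mul_left s
      refine HasFreePair.of_freePair (isLetter_left g s) (isLetter_right g s)
        (isLetter_left g s) (isLetter_right g s).inv ?_
      have hY1 : ∀ a, HalfLE a g ∨ HalfLE a (s * g) → HalfLE (g * a) g := by
        rintro a (ha | ha)
        · exact hgg (ha.trans hg1)
        · exact hgg (ha.trans k4)
      have hY2 : ∀ a, HalfLE a g ∨ HalfLE a (s * g) → HalfLE (s * g * s⁻¹ * a) (s * g) := by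
        intro a ha
        have : HalfLE (s⁻¹ * a) 1 := by
          rcases ha with ha | ha
          · exact (ha.mul_left s⁻¹).trans k3
          · have := ha.mul_left s⁻¹
            rw [inv_mul_cancel_left] at this
            exact this.trans hg1
        simpa [mul_assoc] using this.mul_left (s * g)
      -- The set consists of the translates of `P` contained in `g P` or in `s g P`.
      refine FreePair.of_ping_pong {a | HalfLE a g ∨ HalfLE a (s * g)}
        ⟨g, Or.inl (by simp [HalfLE, one_mem])⟩ (fun a ha => Or.inl (hY1 a ha))
        (fun a ha => Or.inr (hY2 a ha)) fun a ha b hb hab => ?_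
      have e1 := hY1 a ha
      have e2 := (hY2 b hb).trans h2
      rw [← hab] at e2
      exact e1.not_le_compl e2
    · exact absurd h' (cover _ h1')
  · exact absurd h (cover _ h1)

/-- Conjugation by `g` pushes the base edge along the axis of `g`. While `g⁻¹ s g` keeps turning
`P'` into `P`, its norm drops, as `s w = g (g⁻¹ s g w) (w g⁻¹ w)` is a product inside the monoid. -/
theorem hasFreePair_or_commute_of_turn_pos (hg : g ∈ coneMonoid) (hg' : g⁻¹ ∉ coneMonoid)
    (hs : s * w ∈ coneMonoid) : HasFreePair {g, s} ∨ Commute (s * g * s⁻¹) g := by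
  induction hn : entryNorm s using Nat.strong_induction_on generalizing s with
  | _ n ih =>
    have hconj : HasFreePair {g, g⁻¹ * s * g} ∨
        Commute ((g⁻¹ * s * g) * g * (g⁻¹ * s * g)⁻¹) g →
        HasFreePair {g, s} ∨ Commute (s * g * s⁻¹) g := by
      intro h
      refine hasFreePair_or_commute_of_conj g⁻¹ ?_
      simpa only [inv_inv, inv_mul_cancel, one_mul] using h
    rcases coneMonoid_total (g⁻¹ * s * g) with h | h | h | h
    · exact hconj (hasFreePair_or_commute_of_mem hg hg' h)
    · exact hconj (hasFreePair_or_commute_of_inv_right (hasFreePair_or_commute_of_mem hg hg' h))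
    · refine hasFreePair_or_commute_of_turn hg hg' (halfLE_one.2 hs) ?_
      simpa [HalfLE, mul_assoc] using h
    · refine hconj (ih _ ?_ h rfl)
      have h1 := conj_inv_mem_coneMonoid hg
      have h2 := (entryNorm_mul hg (mul_mem h h1)).2.1 hg'
      have h3 := (entryNorm_mul h h1).1.2
      rw [show g * (g⁻¹ * s * g * w * (w * g⁻¹ * w)) = s * w by simp [mul_assoc]] at h2
      rw [entryNorm_mul_reflW] at h2 h3
      omega

/-- If `g` is a nontrivial element of the cone monoid and `s` is arbitrary, then `{g, s}` has a
free pair unless `s` preserves the axis of `g`. -/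
theorem hasFreePair_or_commute (hg : g ∈ coneMonoid) (hg' : g⁻¹ ∉ coneMonoid) :
    HasFreePair {g, s} ∨ Commute (s * g * s⁻¹) g := by
  rcases coneMonoid_total s with h | h | h | h
  · exact hasFreePair_or_commute_of_mem hg hg' h
  · exact hasFreePair_or_commute_of_inv_right (hasFreePair_or_commute_of_mem hg hg' h)
  -- Reflecting by `w` reduces to the last case, with `w g⁻¹ w` in place of `g`.
  · have h1 := conj_inv_mem_coneMonoid hg
    have h2 : (w * g⁻¹ * w)⁻¹ ∉ coneMonoid := by
      intro h2
      apply hg'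
      have := conj_inv_mem_coneMonoid h2
      simpa [mul_assoc] using this
    have h3 : w * s * w * w ∈ coneMonoid := by simpa [mul_assoc] using h
    have h4 := hasFreePair_or_commute_of_turn_pos h1 h2 h3
    have h5 := hasFreePair_or_commute_of_conj (g := g⁻¹) (s := s) w (by simpa using h4)
    refine h5.imp (fun h5 => h5.of_letters (isLetter_pair_subset (isLetter_left g s).inv
      (isLetter_right g s))) fun h5 => ?_
    have := h5.inv_inv
    simpa [mul_assoc] using this
  · exact hasFreePair_or_commute_of_turn_pos hg hg' h

/-- A matrix which is not scalar. -/
def IsNonscalar (M : GL (Fin 2) ℤ) : Prop :=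
  ¬ (M.1 0 1 = 0 ∧ M.1 1 0 = 0 ∧ M.1 0 0 = M.1 1 1)

theorem isNonscalar_of_mul_self_ne_one (h : g * g ≠ 1) : IsNonscalar g := by
  rintro ⟨h1, h2, h3⟩
  apply h
  have hd := GL_two_det g
  rw [h1, ← h3] at hd
  have : g.1 0 0 * g.1 0 0 = 1 := by
    rcases hd with hd | hd <;> nlinarith [mul_self_nonneg (g.1 0 0)]
  apply GL_two_ext <;> simp [GL_two_mul, h1, h2, ← h3, this]

/-- Scalar parts are irrelevant, and the commutator vanishes exactly when the vectors `(a - d, b,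
c)` of the two matrices are parallel. This makes commuting transitive through a nonscalar matrix. -/
theorem commute_iff_cross {M N : GL (Fin 2) ℤ} : Commute M N ↔
    M.1 0 1 * N.1 1 0 = N.1 0 1 * M.1 1 0 ∧
    (M.1 0 0 - M.1 1 1) * N.1 0 1 = (N.1 0 0 - N.1 1 1) * M.1 0 1 ∧
    (M.1 0 0 - M.1 1 1) * N.1 1 0 = (N.1 0 0 - N.1 1 1) * M.1 1 0 := by
  constructor
  · intro h
    have h' := h.eq
    have e := fun i j => congrArg (fun X : GL (Fin 2) ℤ => X.1 i j) h'
    simp only [GL_two_mul] at e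
    have e1 := e 0 0
    have e2 := e 0 1
    have e3 := e 1 0
    exact ⟨by linarith, by linarith, by linarith⟩
  · rintro ⟨h1, h2, h3⟩
    apply GL_two_ext <;> simp only [GL_two_mul] <;> linarith

theorem Commute.trans_of_isNonscalar {A B C : GL (Fin 2) ℤ} (h1 : Commute A B) (h2 : Commute B C)
    (hB : IsNonscalar B) : Commute A C := by
  rw [commute_iff_cross] at *
  obtain ⟨a1, a2, a3⟩ := h1
  obtain ⟨b1, b2, b3⟩ := h2
  unfold IsNonscalar at hB
  rw [← sub_eq_zero (a := B.1 0 0)] at hB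
  generalize A.1 0 0 - A.1 1 1 = xa at *
  generalize B.1 0 0 - B.1 1 1 = xb at *
  generalize C.1 0 0 - C.1 1 1 = xc at *
  generalize A.1 0 1 = pa at *
  generalize B.1 0 1 = pb at *
  generalize C.1 0 1 = pc at *
  generalize A.1 1 0 = qa at *
  generalize B.1 1 0 = qb at *
  generalize C.1 1 0 = qc at *
  by_cases h1 : pb = 0
  · by_cases h2 : qb = 0
    · have h3 : xb ≠ 0 := fun h => hB ⟨h1, h2, h⟩
      subst h1 h2
      have : pa = 0 := by simpa [h3] using a2.symm
      have : qa = 0 := by simpa [h3] using a3.symm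
      have : pc = 0 := by simpa [h3] using b2
      have : qc = 0 := by simpa [h3] using b3
      simp_all
    · refine ⟨?_, ?_, ?_⟩ <;> apply mul_left_cancel₀ h2
      · linear_combination qc * a1 + qa * b1
      · linear_combination pc * a3 + qa * b2 - xc * a1
      · linear_combination qc * a3 + qa * b3
  · refine ⟨?_, ?_, ?_⟩ <;> apply mul_left_cancel₀ h1
    · linear_combination pa * b1 + pc * a1
    · linear_combination pc * a2 + pa * b2
    · linear_combination qc * a2 + pa * b3 + xc * a1

/-- The matrices normalizing the centralizer of `g`; these are the ones preserving the axis
of `g`. -/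
def axisStabilizer (g : GL (Fin 2) ℤ) : Subgroup (GL (Fin 2) ℤ) :=
  Subgroup.normalizer (Subgroup.centralizer {g})

theorem IsNonscalar.conj (h : IsNonscalar g) (s : GL (Fin 2) ℤ) : IsNonscalar (s * g * s⁻¹) := by
  have key : ∀ M : GL (Fin 2) ℤ, ¬ IsNonscalar M ↔ ∀ N, Commute M N := by
    intro M
    simp only [IsNonscalar, not_not]
    constructor
    · rintro ⟨h1, h2, h3⟩ N
      rw [commute_iff_cross, h1, h2, h3]
      simp
    · intro H
      have e1 := commute_iff_cross.1 (H reflW)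
      have e2 := commute_iff_cross.1 (H swapF)
      simp at e1 e2
      omega
  by_contra hcon
  rw [key] at hcon
  refine (key g).2 (fun N => ?_) h
  have := hcon (s * N * s⁻¹)
  exact (Commute.conj_iff s).1 this

/-- By transitivity of commuting, `g` and `s g s⁻¹` have the same centralizer. -/
theorem mem_axisStabilizer (hg : IsNonscalar g) (h : Commute (s * g * s⁻¹) g) :
    s ∈ axisStabilizer g := by
  rw [axisStabilizer, Subgroup.mem_normalizer_iff]
  intro k
  rw [Subgroup.mem_centralizer_singleton_iff, Subgroup.mem_centralizer_singleton_iff]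
  change Commute k g ↔ Commute (s * k * s⁻¹) g
  rw [← Commute.conj_iff s]
  constructor
  · exact fun hk => hk.trans_of_isNonscalar h (hg.conj s)
  · exact fun hk => hk.trans_of_isNonscalar h.symm hg

theorem axisStabilizer_eq_of_commute {h : GL (Fin 2) ℤ} (hg : IsNonscalar g) (hh : IsNonscalar h)
    (hc : Commute g h) : axisStabilizer g = axisStabilizer h := by
  unfold axisStabilizer
  congr 2
  ext k
  rw [Subgroup.mem_centralizer_singleton_iff, Subgroup.mem_centralizer_singleton_iff]
  change Commute k g ↔ Commute k h
  exact ⟨fun hk => hk.trans_of_isNonscalar hc hg, fun hk => hk.trans_of_isNonscalar hc.symm hh⟩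

theorem axisStabilizer_ne_top (hg : IsNonscalar g) : axisStabilizer g ≠ ⊤ := by
  intro htop
  have key : ∀ s : GL (Fin 2) ℤ, Commute (s * g * s⁻¹) g := by
    intro s
    have hs : s ∈ axisStabilizer g := htop ▸ Subgroup.mem_top s
    rw [axisStabilizer, Subgroup.mem_normalizer_iff] at hs
    have := (hs g).1 (Subgroup.mem_centralizer_singleton_iff.2 rfl)
    exact Subgroup.mem_centralizer_singleton_iff.1 this
  have e1 := commute_iff_cross.1 (key reflW)
  have e2 := commute_iff_cross.1 (key swapF)
  have e3 := commute_iff_cross.1 (key lowerL)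
  have l00 : lowerL⁻¹.1 0 0 = 1 := rfl
  have l01 : lowerL⁻¹.1 0 1 = 0 := rfl
  have l10 : lowerL⁻¹.1 1 0 = -1 := rfl
  have l11 : lowerL⁻¹.1 1 1 = 1 := rfl
  simp [GL_two_mul, l00, l01, l10, l11] at e1 e2 e3
  unfold IsNonscalar at hg
  by_cases hx : g.1 0 0 = g.1 1 1
  · have hb : g.1 0 1 = 0 := by
      rcases e3.2.1 with h | h <;> omega
    have hc : g.1 1 0 = 0 := by simpa [hb] using e2.1
    exact hg ⟨hb, hc, hx⟩
  · have hx' : g.1 0 0 - g.1 1 1 ≠ 0 := sub_ne_zero.2 hx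
    have hb : g.1 0 1 = 0 := by
      have : (g.1 0 0 - g.1 1 1) * g.1 0 1 = 0 := by linarith [e1.1]
      simpa [hx'] using this
    have hc : g.1 1 0 = 0 := by
      have : (g.1 0 0 - g.1 1 1) * g.1 1 0 = 0 := by linarith [e1.2]
      simpa [hx'] using this
    have h3 := e3.2.2
    rw [hb, hc] at h3
    have : (g.1 0 0 - g.1 1 1) * (g.1 0 0 - g.1 1 1) = 0 := by linarith
    simp [hx'] at this

end Skew

/-! ### Free pairs from one hyperbolic letter or from two opposite turns. -/

section LowerBound

local notation "w" => reflW

variable {S : Set (GL (Fin 2) ℤ)} {g s t u : GL (Fin 2) ℤ}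

theorem exists_mem_not_mem_of_closure_eq_top {G : Type u} [Group G] {S : Set G} {H : Subgroup G}
    (hS : Subgroup.closure S = ⊤) (hH : H ≠ ⊤) : ∃ s ∈ S, s ∉ H := by
  by_contra! h
  exact hH (top_le_iff.1 (hS ▸ (Subgroup.closure_le H).2 h))

theorem closure_conj_eq_top {G : Type u} [Group G] {S : Set G} (hS : Subgroup.closure S = ⊤)
    (c : G) : Subgroup.closure ((fun s => c * s * c⁻¹) '' S) = ⊤ := by
  have := MonoidHom.map_closure (MulAut.conj c).toMonoidHom S
  rw [hS, ← MonoidHom.range_eq_map, MonoidHom.range_eq_top.2 (MulAut.conj c).surjective] at this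
  exact this.symm

/-- A generating set containing an element of infinite order which skewers a half-tree contains
a short free pair. -/
theorem hasFreePair_of_skewer (hS : Subgroup.closure S = ⊤) (hg : IsLetter S g)
    {x : GL (Fin 2) ℤ} (h : HalfLE (g * x) x) (hsq : g * g ≠ 1) : HasFreePair S := by
  have hns := isNonscalar_of_mul_self_ne_one hsq
  obtain ⟨s, hs, hs'⟩ := exists_mem_not_mem_of_closure_eq_top hS (axisStabilizer_ne_top hns)
  have h1 : x⁻¹ * g * x⁻¹⁻¹ ∈ coneMonoid := by simpa [HalfLE, mul_assoc] using h
  have h2 : (x⁻¹ * g * x⁻¹⁻¹)⁻¹ ∉ coneMonoid := by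
    refine inv_not_mem_of_mul_self_ne_one h1 fun h2 => hsq ?_
    have := congrArg (fun z => x * z * x⁻¹) h2
    simpa [mul_assoc] using this
  rcases hasFreePair_or_commute_of_conj (s := s) x⁻¹ (hasFreePair_or_commute h1 h2) with h | h
  · exact h.of_letters (isLetter_pair_subset hg (IsLetter.of_mem hs))
  · exact absurd (mem_axisStabilizer hns h) hs'

theorem inv_mul_reflW_mem (h : s * w ∈ coneMonoid) : s⁻¹ * w ∈ coneMonoid := by
  simpa [mul_assoc] using conj_inv_mem_coneMonoid h

theorem reflW_mul_inv_mem (h : w * s ∈ coneMonoid) : w * s⁻¹ ∈ coneMonoid := by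
  simpa [mul_assoc] using conj_inv_mem_coneMonoid h

theorem reflW_mul_mem_of_inv_mem (h : (s * w)⁻¹ ∈ coneMonoid) : w * s ∈ coneMonoid := by
  simpa [mul_assoc] using conj_inv_mem_coneMonoid h

theorem mul_reflW_mem_of_inv_mem (h : (w * s)⁻¹ ∈ coneMonoid) : s * w ∈ coneMonoid := by
  simpa [mul_assoc] using conj_inv_mem_coneMonoid h

theorem mul_inv_not_mem {m n : GL (Fin 2) ℤ} (hm : m ∈ coneMonoid) (hn : n ∈ coneMonoid)
    (h : ¬ (m⁻¹ ∈ coneMonoid ∧ n⁻¹ ∈ coneMonoid)) : (m * n)⁻¹ ∉ coneMonoid := by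
  intro h'
  refine h ⟨?_, ?_⟩
  · simpa using mul_mem hn h'
  · simpa using mul_mem h' hm

/-- `s` turns the half-tree `P'` into `P`, `t` turns `P` into `P'`, and not both preserve the
edge between `P` and `P'`. -/
structure IsTurnPair (s t : GL (Fin 2) ℤ) : Prop where
  left : s * reflW ∈ coneMonoid
  right : reflW * t ∈ coneMonoid
  not_both : ¬ ((s * reflW)⁻¹ ∈ coneMonoid ∧ (reflW * t)⁻¹ ∈ coneMonoid)

theorem IsTurnPair.mem (h : IsTurnPair s t) : s * t ∈ coneMonoid := by
  simpa [mul_assoc] using mul_mem h.left h.right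

theorem IsTurnPair.inv_not_mem (h : IsTurnPair s t) : (s * t)⁻¹ ∉ coneMonoid := by
  simpa [mul_assoc] using mul_inv_not_mem h.left h.right h.not_both

theorem IsTurnPair.inv_left (h : IsTurnPair s t) : IsTurnPair s⁻¹ t := by
  refine ⟨inv_mul_reflW_mem h.left, h.right, fun hb => h.not_both ⟨?_, hb.2⟩⟩
  have h1 : w * s ∈ coneMonoid := by simpa using hb.1
  simpa using reflW_mul_inv_mem h1

theorem IsTurnPair.inv_right (h : IsTurnPair s t) : IsTurnPair s t⁻¹ := by
  refine ⟨h.left, reflW_mul_inv_mem h.right, fun hb => h.not_both ⟨hb.1, ?_⟩⟩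
  have h1 : t * w ∈ coneMonoid := by simpa using hb.2
  simpa using inv_mul_reflW_mem h1

theorem IsTurnPair.not_commute (h : IsTurnPair s t) : ¬ Commute s t := by
  intro hc
  have h1 := conj_inv_mem_coneMonoid (mul_mem h.right h.left)
  have h2 : w * (w * t * (s * w))⁻¹ * w = (s * t)⁻¹ := by
    rw [hc.eq]
    simp [mul_assoc]
  exact h.inv_not_mem (h2 ▸ h1)

theorem eq_one_or_of_not_isNonscalar (h : ¬ IsNonscalar g) : g = 1 ∨ g = -1 := by
  unfold IsNonscalar at h
  push Not at h
  obtain ⟨h1, h2, h3⟩ := h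
  have hd := GL_two_det g
  rw [h1, ← h3] at hd
  have : g.1 0 0 * g.1 0 0 = 1 := by
    rcases hd with hd | hd <;> nlinarith [mul_self_nonneg (g.1 0 0)]
  rcases mul_self_eq_one_iff.1 this with h | h
  · left; apply GL_two_ext <;> simp [h1, h2, ← h3, h]
  · right; apply GL_two_ext <;> simp [h1, h2, ← h3, h]

theorem IsTurnPair.sq_of_commute {a b : GL (Fin 2) ℤ} (hab : ¬ Commute a b)
    (h : Commute (a * a) b) : a * a = 1 ∨ a * a = -1 := by
  apply eq_one_or_of_not_isNonscalar
  intro hns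
  exact hab (((Commute.refl a).mul_right (Commute.refl a)).trans_of_isNonscalar h hns)

/-- All of `s t`, `s⁻¹ t`, `s t⁻¹` lie strictly in the monoid. If they commute, then `s²` commutes
with `t` and `t²` with `s`; since `s` and `t` do not commute, both squares are scalar. -/
theorem IsTurnPair.hasFreePair_or_sq (h : IsTurnPair s t) :
    HasFreePair {s, t} ∨ ((s * s = 1 ∨ s * s = -1) ∧ (t * t = 1 ∨ t * t = -1)) := by
  have ls := isLetter_left s t
  have lt := isLetter_right s t
  rcases commute_or_freePair_of_mem h.mem h.inv_not_mem h.inv_left.mem h.inv_left.inv_not_mem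
    with h1 | h1
  · rcases commute_or_freePair_of_mem h.mem h.inv_not_mem h.inv_right.mem h.inv_right.inv_not_mem
      with h2 | h2
    · right
      refine ⟨sq_of_commute h.not_commute ?_, sq_of_commute (fun hc => h.not_commute hc.symm) ?_⟩
      · have := congrArg (fun z => s * z * t⁻¹ * s) h1.eq
        simpa [mul_assoc, Commute, SemiconjBy] using this
      · have := congrArg (fun z => t * s⁻¹ * z * t) h2.eq
        simpa [mul_assoc, Commute, SemiconjBy] using this
    · exact Or.inl ⟨s, t, s, t⁻¹, 1, ls, lt, ls, lt.inv, IsLetter.one _, by simpa using h2⟩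
  · exact Or.inl ⟨s, t, s⁻¹, t, 1, ls, lt, ls.inv, lt, IsLetter.one _, by simpa using h1⟩

/-- Both conjugates equal `t s`, which is the inverse of `s t` up to sign. So `s` and `t` preserve
the axis of `s t`. -/
theorem commute_conj_of_sq (hs : s * s = 1 ∨ s * s = -1) (ht : t * t = 1 ∨ t * t = -1) :
    Commute (s * (s * t) * s⁻¹) (s * t) ∧ Commute (t * (s * t) * t⁻¹) (s * t) := by
  have e : s * (s * t) * s⁻¹ = t * s := by
    rcases hs with hs | hs
    · rw [← mul_assoc, hs, one_mul, inv_eq_of_mul_eq_one_right hs]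
    · have : s⁻¹ = -s := inv_eq_of_mul_eq_one_right (by rw [mul_neg, hs, neg_neg])
      rw [← mul_assoc, hs, this]
      simp
  have e2 : t * (s * t) * t⁻¹ = t * s := by group
  have e3 : Commute (t * s) (s * t) := by
    have h1 : t * s * (s * t) = t * (s * s) * t := by simp only [mul_assoc]
    have h2 : s * t * (t * s) = s * (t * t) * s := by simp only [mul_assoc]
    rw [Commute, SemiconjBy, h1, h2]
    rcases hs with hs | hs <;> rcases ht with ht | ht <;> simp [hs, ht]
  rw [e, e2]
  exact ⟨e3, e3⟩

/-- Some generator `u` does not preserve the axis of `s t`. If `u` preserves `P`, then `s t` and `u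
s t` are free, with lengths exactly two and three. Otherwise `u` forms a turn pair with `s` or `t`,
giving a second word of length two; commuting with `s t` would put `u` in the axis stabilizer. -/
theorem hasFreePair_of_turnPair (hS : Subgroup.closure S = ⊤) (hs : IsLetter S s)
    (ht : IsLetter S t) (h : IsTurnPair s t) : HasFreePair S := by
  have hg := h.mem
  have hg' := h.inv_not_mem
  have hns := isNonscalar_of_mul_self_ne_one (mul_self_ne_one_of_inv_not_mem hg hg')
  obtain ⟨u, hu, hu'⟩ := exists_mem_not_mem_of_closure_eq_top hS (axisStabilizer_ne_top hns)
  by_contra hno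
  have fixing : ∀ u, IsLetter S u → u ∈ coneMonoid → u ∈ axisStabilizer (s * t) := by
    intro u hu hm
    have hsq : u * u = 1 := by
      by_contra hsq
      exact hno (hasFreePair_of_skewer hS hu (x := 1) (by simpa [HalfLE] using hm) hsq)
    have hm' : u⁻¹ ∈ coneMonoid := by rwa [inv_eq_of_mul_eq_one_right hsq]
    by_cases h1 : u = 1 ∨ u = -1
    · apply mem_axisStabilizer hns
      rcases h1 with rfl | rfl <;> simp
    · exact absurd ⟨s, t, u, s, t, hs, ht, hu, hs, ht,
        by rw [mul_assoc u]; exact freePair_mul_left hg hg' hm hm' h1⟩ hno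
  have right : IsLetter S u → IsTurnPair s u → u ∈ axisStabilizer (s * t) := by
    intro hu hp
    have hns' := isNonscalar_of_mul_self_ne_one
      (mul_self_ne_one_of_inv_not_mem hp.mem hp.inv_not_mem)
    rcases hp.hasFreePair_or_sq with hf | ⟨h1, h2⟩
    · exact absurd (hf.of_letters (isLetter_pair_subset hs hu)) hno
    rcases commute_or_freePair_of_mem hg hg' hp.mem hp.inv_not_mem with hc | hf
    · rw [axisStabilizer_eq_of_commute hns hns' hc]
      exact mem_axisStabilizer hns' (commute_conj_of_sq h1 h2).2
    · exact absurd ⟨s, t, s, u, 1, hs, ht, hs, hu, IsLetter.one _, by simpa using hf⟩ hno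
  have left : IsLetter S u → IsTurnPair u t → u ∈ axisStabilizer (s * t) := by
    intro hu hp
    have hns' := isNonscalar_of_mul_self_ne_one
      (mul_self_ne_one_of_inv_not_mem hp.mem hp.inv_not_mem)
    rcases hp.hasFreePair_or_sq with hf | ⟨h1, h2⟩
    · exact absurd (hf.of_letters (isLetter_pair_subset hu ht)) hno
    rcases commute_or_freePair_of_mem hg hg' hp.mem hp.inv_not_mem with hc | hf
    · rw [axisStabilizer_eq_of_commute hns hns' hc]
      exact mem_axisStabilizer hns' (commute_conj_of_sq h1 h2).1
    · exact absurd ⟨s, t, u, t, 1, hs, ht, hu, ht, IsLetter.one _, by simpa using hf⟩ hno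
  have hl := IsLetter.of_mem hu
  apply hu'
  rcases coneMonoid_total u with hm | hm | hm | hm
  · exact fixing u hl hm
  · simpa using inv_mem (fixing _ hl.inv hm)
  -- If `s` and `u` both merely invert the base edge, then `u` also turns `P'` into `P` and can be
  -- paired with `t`, which is then strict.
  · by_cases hb : (s * w)⁻¹ ∈ coneMonoid ∧ (w * u)⁻¹ ∈ coneMonoid
    · exact left hl ⟨mul_reflW_mem_of_inv_mem hb.2, h.right, fun h3 => h.not_both ⟨hb.1, h3.2⟩⟩
    · exact right hl ⟨h.left, hm, hb⟩
  · by_cases hb : (u * w)⁻¹ ∈ coneMonoid ∧ (w * t)⁻¹ ∈ coneMonoid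
    · exact right hl ⟨h.left, reflW_mul_mem_of_inv_mem hb.1, fun h3 => h.not_both ⟨h3.1, hb.2⟩⟩
    · exact left hl ⟨hm, h.right, hb⟩

end LowerBound

/-! ### Moving the base edge: every finite generating set has a free pair. -/

section Descent

local notation "w" => reflW

/-- The matrices preserving the bilinear form with matrix `A`. -/
def formStabilizer (A : Matrix (Fin 2) (Fin 2) ℤ) : Subgroup (GL (Fin 2) ℤ) where
  carrier := {g | g.1.transpose * A * g.1 = A}
  one_mem' := by simp
  mul_mem' := by
    intro a b ha hb
    simp only [Set.mem_ofPred_eq, Units.val_mul, Matrix.transpose_mul] at *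
    calc b.1.transpose * a.1.transpose * A * (a.1 * b.1)
        = b.1.transpose * (a.1.transpose * A * a.1) * b.1 := by simp only [Matrix.mul_assoc]
      _ = A := by rw [ha, hb]
  inv_mem' := by
    intro a ha
    simp only [Set.mem_ofPred_eq] at *
    have h1 : a.1 * a⁻¹.1 = 1 := a.mul_inv
    have h2 : a⁻¹.1.transpose * a.1.transpose = 1 := by rw [← Matrix.transpose_mul, h1]; simp
    calc a⁻¹.1.transpose * A * a⁻¹.1 = a⁻¹.1.transpose * (a.1.transpose * A * a.1) * a⁻¹.1 := by
          rw [ha]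
      _ = (a⁻¹.1.transpose * a.1.transpose) * A * (a.1 * a⁻¹.1) := by simp only [Matrix.mul_assoc]
      _ = A := by rw [h1, h2, Matrix.one_mul, Matrix.mul_one]

theorem mem_formStabilizer {A : Matrix (Fin 2) (Fin 2) ℤ} {g : GL (Fin 2) ℤ} :
    g ∈ formStabilizer A ↔ g.1.transpose * A * g.1 = A := Iff.rfl

instance (A : Matrix (Fin 2) (Fin 2) ℤ) (g : GL (Fin 2) ℤ) : Decidable (g ∈ formStabilizer A) :=
  inferInstanceAs (Decidable (g.1.transpose * A * g.1 = A))

theorem formStabilizer_ne_top_of {A : Matrix (Fin 2) (Fin 2) ℤ} (h : lowerL ∉ formStabilizer A) :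
    formStabilizer A ≠ ⊤ := fun htop => h (htop ▸ Subgroup.mem_top _)

variable {S : Set (GL (Fin 2) ℤ)} {s : GL (Fin 2) ℤ}

/-- `s` maps the half-tree `P'` strictly into `P`. -/
def StrictTurn (s : GL (Fin 2) ℤ) : Prop := s * w ∈ coneMonoid ∧ (s * w)⁻¹ ∉ coneMonoid

/-- The matrices `±1` and the swap up to sign. -/
def FixesEdge (s : GL (Fin 2) ℤ) : Prop := (s = 1 ∨ s = -1) ∨ s = swapF ∨ s = -swapF

/-- A letter mapping `P` into itself must be an involution, since otherwise `hasFreePair_of_skewer`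
applies; hence it preserves `P`. -/
theorem fixesEdge_or_of_mem (hS : Subgroup.closure S = ⊤) (hno : ¬ HasFreePair S)
    (hs : IsLetter S s) (h : s ∈ coneMonoid) : FixesEdge s := by
  have hsq : s * s = 1 := by
    by_contra hsq
    exact hno (hasFreePair_of_skewer hS hs (x := 1) (by simpa [HalfLE] using h) hsq)
  exact eq_of_mem_of_inv_mem h (by rwa [inv_eq_of_mul_eq_one_right hsq])

theorem FixesEdge.inv (h : FixesEdge s) : FixesEdge s⁻¹ := by
  rcases h with (rfl | rfl) | rfl | rfl <;> simp [FixesEdge, inv_neg]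

/-- If no letter turned strictly, all of them would stabilize the base edge and preserve `x² + y²`.
-/
theorem exists_strictTurn (hS : Subgroup.closure S = ⊤) (hno : ¬ HasFreePair S) :
    ∃ s ∈ S, StrictTurn s ∨ StrictTurn (w * s * w) := by
  have hone : formStabilizer 1 ≠ ⊤ := formStabilizer_ne_top_of (by decide)
  obtain ⟨s, hs, hs'⟩ := exists_mem_not_mem_of_closure_eq_top hS hone
  have hE : ∀ g, FixesEdge g → g ∈ formStabilizer 1 := by
    rintro g ((rfl | rfl) | rfl | rfl) <;> decide
  have hw : w ∈ formStabilizer 1 := by decide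
  refine ⟨s, hs, ?_⟩
  have hl := IsLetter.of_mem hs
  rcases coneMonoid_total s with h | h | h | h
  · exact absurd (hE _ (fixesEdge_or_of_mem hS hno hl h)) hs'
  · exact absurd (by simpa using inv_mem (hE _ (fixesEdge_or_of_mem hS hno hl.inv h))) hs'
  · right
    refine ⟨by simpa [mul_assoc] using h, fun h2 => hs' ?_⟩
    have h3 : (w * s)⁻¹ ∈ coneMonoid := by simpa [mul_assoc] using h2
    simpa using mul_mem hw (hE _ (eq_of_mem_of_inv_mem h h3))
  · left
    refine ⟨h, fun h2 => hs' ?_⟩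
    simpa [mul_assoc] using mul_mem (hE _ (eq_of_mem_of_inv_mem h h2)) hw

/-- A letter turning against `s₀` would form a turn pair with it, so all letters point to the same
side of the edge. -/
theorem fixesEdge_or_strictTurn (hS : Subgroup.closure S = ⊤) (hno : ¬ HasFreePair S)
    {s₀ : GL (Fin 2) ℤ} (hs₀ : s₀ ∈ S) (h₀ : StrictTurn s₀) (hs : s ∈ S) :
    FixesEdge s ∨ StrictTurn s := by
  have hl := IsLetter.of_mem hs
  have hneg : ¬ w * s ∈ coneMonoid := fun h =>
    hno (hasFreePair_of_turnPair hS (IsLetter.of_mem hs₀) hl ⟨h₀.1, h, fun hb => h₀.2 hb.1⟩)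
  rcases coneMonoid_total s with h | h | h | h
  · exact Or.inl (fixesEdge_or_of_mem hS hno hl h)
  · exact Or.inl (by simpa using (fixesEdge_or_of_mem hS hno hl.inv h).inv)
  · exact absurd h hneg
  · exact Or.inr ⟨h, fun h2 => hneg (reflW_mul_mem_of_inv_mem h2)⟩

theorem not_hasFreePair_conj (hno : ¬ HasFreePair S) (c : GL (Fin 2) ℤ) :
    ¬ HasFreePair ((fun s => c * s * c⁻¹) '' S) := fun h => hno (h.of_conj c)

theorem fixesEdge_or_strictTurn_conj (hS : Subgroup.closure S = ⊤) (hno : ¬ HasFreePair S)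
    (c : GL (Fin 2) ℤ) {s₀ : GL (Fin 2) ℤ} (hs₀ : s₀ ∈ S) (h₀ : StrictTurn (c * s₀ * c⁻¹))
    (hs : s ∈ S) : FixesEdge (c * s * c⁻¹) ∨ StrictTurn (c * s * c⁻¹) :=
  fixesEdge_or_strictTurn (closure_conj_eq_top hS c) (not_hasFreePair_conj hno c)
    (Set.mem_image_of_mem _ hs₀) h₀ (Set.mem_image_of_mem _ hs)

theorem StrictTurn.two_lt (h : StrictTurn s) : 2 < entryNorm s := by
  have := (entryNorm_mul (one_mem _) h.1).2.2 h.2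
  rw [one_mul, entryNorm_mul_reflW] at this
  exact lt_of_le_of_lt (by decide) this

theorem FixesEdge.entryNorm_eq (h : FixesEdge s) : entryNorm s = 2 := by
  rcases h with (rfl | rfl) | rfl | rfl <;> decide

/-- A turning letter gets shorter because `s w = e (e⁻¹ s e w) e`, using `w e⁻¹ w = e`. Among the
letters fixing the edge, `±1` keep their norm and `±swapF` are excluded by `hf`. -/
theorem sum_entryNorm_conj_lt {S : Finset (GL (Fin 2) ℤ)}
    (hS : Subgroup.closure (S : Set (GL (Fin 2) ℤ)) = ⊤)
    (hno : ¬ HasFreePair (S : Set (GL (Fin 2) ℤ))) {s₀ s₁ e : GL (Fin 2) ℤ} (hs₀ : s₀ ∈ S)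
    (h₀ : StrictTurn s₀) (hs₁ : s₁ ∈ S) (h₁ : StrictTurn (e⁻¹ * s₁ * e)) (he : e ∈ coneMonoid)
    (he' : e⁻¹ ∉ coneMonoid) (hew : w * e⁻¹ * w = e)
    (hf : ¬ FixesEdge (e⁻¹ * swapF * e) ∧ ¬ StrictTurn (e⁻¹ * swapF * e)) :
    ∑ s ∈ S, entryNorm (e⁻¹ * s * e) < ∑ s ∈ S, entryNorm s := by
  have key : ∀ s ∈ S, FixesEdge (e⁻¹ * s * e) ∨ StrictTurn (e⁻¹ * s * e) := by
    intro s hs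
    have := fixesEdge_or_strictTurn_conj hS hno e⁻¹ hs₁ (by simpa using h₁) hs
    simpa using this
  have hlt : ∀ s ∈ S, StrictTurn s → entryNorm (e⁻¹ * s * e) < entryNorm s := by
    intro s hs hst
    rcases key s hs with h | h
    · rw [h.entryNorm_eq]
      exact hst.two_lt
    · have h2 := (entryNorm_mul he (mul_mem h.1 he)).2.1 he'
      have h3 := (entryNorm_mul h.1 he).1.2
      have h4 : e * (e⁻¹ * s * e * w * e) = s * w := by
        nth_rw 3 [← hew]
        simp [mul_assoc]
      rw [h4] at h2
      rw [entryNorm_mul_reflW] at h2 h3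
      omega
  refine Finset.sum_lt_sum (fun s hs => ?_) ⟨s₀, hs₀, hlt s₀ hs₀ h₀⟩
  rcases fixesEdge_or_strictTurn hS hno hs₀ h₀ hs with h | h
  · rcases h with (rfl | rfl) | rfl | rfl
    · simp
    · simp
    · exact absurd (key _ hs) (not_or.2 hf)
    · exfalso
      have := key _ hs
      simp only [mul_neg, neg_mul] at this
      rcases this with h | h
      · apply hf.1
        simp only [FixesEdge, neg_eq_iff_eq_neg, neg_neg] at h ⊢
        tauto
      · apply hf.2
        refine ⟨mem_of_neg_mem (by simpa using h.1), fun h3 => h.2 ?_⟩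
        simpa [inv_neg] using neg_mem_coneMonoid h3
  · exact (hlt s hs h).le

/-- If `a, d < b`, then `a d ≤ (b - 1)²` and `b c ≥ b²`, so a difference of one forces `b = 1`. If
`a = b` or `d = b`, the difference factors. -/
theorem eq_one_of_mul_sub_mul_eq_one {a b c d : ℤ} (ha : 0 ≤ a) (hd : 0 ≤ d) (hab : a ≤ b)
    (hdb : d ≤ b) (hbc : b ≤ c) (hdet : b * c - a * d = 1)
    (hM : 2 < a + b + c + d) (hsum : 2 < b - a + b + (b + c - a - d) + (b - d)) :
    b = 1 ∧ c = 1 ∧ ((a = 0 ∧ d = 1) ∨ (a = 1 ∧ d = 0)) := by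
  rcases hab.eq_or_lt with rfl | hab
  · have h1 : a * (c - d) = 1 := by linarith
    rcases Int.mul_eq_one_iff_eq_one_or_neg_one.1 h1 with ⟨h2, h3⟩ | ⟨h2, h3⟩ <;> omega
  · rcases hdb.eq_or_lt with rfl | hdb
    · have h1 : d * (c - a) = 1 := by linarith
      rcases Int.mul_eq_one_iff_eq_one_or_neg_one.1 h1 with ⟨h2, h3⟩ | ⟨h2, h3⟩ <;> omega
    · have h1 : a * d ≤ (b - 1) * (b - 1) :=
        mul_le_mul (by omega) (by omega) hd (by omega)
      have h2 : b * b ≤ b * c := mul_le_mul_of_nonneg_left hbc (by omega)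
      have h3 : b = 1 := by nlinarith
      subst h3
      omega

/-- The entries are those of `s * reflW`, for a letter `s` turning `P'` into `P` and moving each of
the half-trees `lowerL P`, `upperR P` off itself. The two solutions are rotations of orders three
and six about the common vertex. -/
theorem turning_entries {a b c d : ℤ} (ha : 0 ≤ a) (hb : 0 ≤ b) (hc : 0 ≤ c) (hd : 0 ≤ d)
    (hdet : a * d - b * c = 1 ∨ a * d - b * c = -1) (hM : 2 < a + b + c + d)
    (hL : (0 ≤ a - b ∧ 0 ≤ -b ∧ 0 ≤ a + d - b - c ∧ 0 ≤ d - b) ∨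
      (a - b ≤ 0 ∧ -b ≤ 0 ∧ a + d - b - c ≤ 0 ∧ d - b ≤ 0))
    (hL' : 2 < (a - b).natAbs + b.natAbs + (a + d - b - c).natAbs + (d - b).natAbs)
    (hR : (0 ≤ a - c ∧ 0 ≤ -c ∧ 0 ≤ a + d - b - c ∧ 0 ≤ d - c) ∨
      (a - c ≤ 0 ∧ -c ≤ 0 ∧ a + d - b - c ≤ 0 ∧ d - c ≤ 0))
    (hR' : 2 < (a - c).natAbs + c.natAbs + (a + d - b - c).natAbs + (d - c).natAbs) :
    b = 1 ∧ c = 1 ∧ ((a = 0 ∧ d = 1) ∨ (a = 1 ∧ d = 0)) := by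
  have hb0 : b ≠ 0 := by
    rintro rfl
    have h1 : a * d = 1 := by
      have := mul_nonneg ha hd
      omega
    rcases Int.mul_eq_one_iff_eq_one_or_neg_one.1 h1 with ⟨rfl, rfl⟩ | ⟨rfl, rfl⟩
    · have : c ≠ 2 := by
        rintro rfl
        norm_num at hL'
      omega
    · omega
  have hc0 : c ≠ 0 := by
    rintro rfl
    have h1 : a * d = 1 := by
      have := mul_nonneg ha hd
      omega
    rcases Int.mul_eq_one_iff_eq_one_or_neg_one.1 h1 with ⟨rfl, rfl⟩ | ⟨rfl, rfl⟩
    · have : b ≠ 2 := by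
        rintro rfl
        norm_num at hR'
      omega
    · omega
  have hL := hL.resolve_left (by omega)
  have hR := hR.resolve_left (by omega)
  obtain ⟨l1, l2, l3, l4⟩ := hL
  obtain ⟨r1, r2, -, r4⟩ := hR
  have hle : a * d ≤ b * c := mul_le_mul (by omega) (by omega) hd hb
  have hdet' : b * c - a * d = 1 := by omega
  rcases le_total b c with h | h
  · exact eq_one_of_mul_sub_mul_eq_one ha hd (by omega) (by omega) h hdet' hM (by omega)
  · have := eq_one_of_mul_sub_mul_eq_one (b := c) (c := b) ha hd (by omega) (by omega) h
      (by linarith) (by linarith) (by omega)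
    tauto

/-- The form preserved by the stabilizer of a vertex of the tree. -/
def vertexForm : Matrix (Fin 2) (Fin 2) ℤ := !![2, -1; -1, 2]

theorem StrictTurn.neg (h : StrictTurn s) : StrictTurn (-s) := by
  refine ⟨by simpa using neg_mem_coneMonoid h.1, fun h3 => h.2 ?_⟩
  simpa [inv_neg] using neg_mem_coneMonoid h3

theorem mem_vertexStabilizer_of_entries (hb : -s.1 0 1 = 1) (hc : s.1 1 0 = 1)
    (had : (s.1 0 0 = 0 ∧ -s.1 1 1 = 1) ∨ (s.1 0 0 = 1 ∧ -s.1 1 1 = 0)) :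
    s ∈ formStabilizer vertexForm := by
  rw [mem_formStabilizer]
  rw [neg_eq_iff_eq_neg] at hb
  ext i j
  rcases had with ⟨ha, hd⟩ | ⟨ha, hd⟩ <;>
    rw [neg_eq_iff_eq_neg] at hd <;>
    fin_cases i <;> fin_cases j <;>
      simp [Matrix.mul_apply, Fin.sum_univ_two, vertexForm, ha, hb, hc, hd]

theorem mem_vertexStabilizer_of_turn_of_nonneg (h : StrictTurn s)
    (hL : StrictTurn (w * (lowerL⁻¹ * s * lowerL) * w))
    (hR : StrictTurn (w * (upperR⁻¹ * s * upperR) * w))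
    (hpos : 0 ≤ (s * w).1 0 0 ∧ 0 ≤ (s * w).1 0 1 ∧ 0 ≤ (s * w).1 1 0 ∧ 0 ≤ (s * w).1 1 1) :
    s ∈ formStabilizer vertexForm := by
  have l00 : lowerL⁻¹.1 0 0 = 1 := rfl
  have l01 : lowerL⁻¹.1 0 1 = 0 := rfl
  have l10 : lowerL⁻¹.1 1 0 = -1 := rfl
  have l11 : lowerL⁻¹.1 1 1 = 1 := rfl
  have r00 : upperR⁻¹.1 0 0 = 1 := rfl
  have r01 : upperR⁻¹.1 0 1 = -1 := rfl
  have r10 : upperR⁻¹.1 1 0 = 0 := rfl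
  have r11 : upperR⁻¹.1 1 1 = 1 := rfl
  have n1 := h.two_lt
  have n2 := hL.two_lt
  have n3 := hR.two_lt
  have c2 := mem_coneMonoid.1 hL.1
  have c3 := mem_coneMonoid.1 hR.1
  have hdet := GL_two_det s
  simp only [entryNorm, GL_two_mul, l00, l01, l10, l11, r00, r01, r10, r11, reflW_00, reflW_01,
    reflW_10, reflW_11, lowerL_00, lowerL_01, lowerL_10, lowerL_11, upperR_00, upperR_01,
    upperR_10, upperR_11, mul_zero, zero_mul, one_mul, mul_one, add_zero, zero_add, mul_neg,
    neg_mul, neg_neg, Int.natAbs_neg] at n1 n2 n3 c2 c3 hpos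
  clear h hL hR l00 l01 l10 l11 r00 r01 r10 r11
  suffices H : -s.1 0 1 = 1 ∧ s.1 1 0 = 1 ∧ ((s.1 0 0 = 0 ∧ -s.1 1 1 = 1) ∨
      (s.1 0 0 = 1 ∧ -s.1 1 1 = 0)) from
    mem_vertexStabilizer_of_entries H.1 H.2.1 H.2.2
  generalize s.1 0 0 = a at *
  generalize s.1 0 1 = b at *
  generalize s.1 1 0 = c at *
  generalize s.1 1 1 = d at *
  have p1 : 0 ≤ a := by omega
  have p2 : 0 ≤ -b := by omega
  have p3 : 0 ≤ c := by omega
  have p4 : 0 ≤ -d := by omega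
  refine turning_entries p1 p2 p3 p4 ?_ ?_ ?_ ?_ ?_ ?_
  · rcases hdet with h | h
    · right; linarith
    · left; linarith
  all_goals clear hdet
  · omega
  · refine c2.imp (fun h => ?_) fun h => ?_ <;>
      exact ⟨by linarith [h.1], by linarith [h.2.1], by linarith [h.2.2.1], by linarith [h.2.2.2]⟩
  · rw [show a - -b = a + b by ring, Int.natAbs_neg,
      show a + -d - -b - c = -(-a + c + (-b + d)) by ring, Int.natAbs_neg,
      show -d - -b = -(-b + d) by ring, Int.natAbs_neg]
    exact n2
  · refine c3.imp (fun h => ?_) fun h => ?_ <;>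
      exact ⟨by linarith [h.1], by linarith [h.2.2.1], by linarith [h.2.1], by linarith [h.2.2.2]⟩
  · rw [show a - c = a + -c by ring, show a + -d - -b - c = a + -c + (b + -d) by ring,
      show -d - c = -(c + d) by ring, Int.natAbs_neg]
    omega

theorem mem_vertexStabilizer_of_turn (h : StrictTurn s)
    (hL : StrictTurn (w * (lowerL⁻¹ * s * lowerL) * w))
    (hR : StrictTurn (w * (upperR⁻¹ * s * upperR) * w)) : s ∈ formStabilizer vertexForm := by
  rcases mem_coneMonoid.1 h.1 with hpos | hneg
  · exact mem_vertexStabilizer_of_turn_of_nonneg h hL hR hpos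
  · have h1 := mem_vertexStabilizer_of_turn_of_nonneg h.neg (by simpa using hL.neg)
      (by simpa using hR.neg) (by
        simp only [neg_mul, Units.val_neg, Matrix.neg_apply]
        omega)
    have h2 : (-1 : GL (Fin 2) ℤ) ∈ formStabilizer vertexForm := by decide
    simpa using mul_mem h2 h1

theorem FixesEdge.mem_of_conj {e : GL (Fin 2) ℤ} (h : FixesEdge (e⁻¹ * s * e))
    (he : e = lowerL ∨ e = upperR) : s ∈ formStabilizer vertexForm := by
  have key : ∀ k, FixesEdge k → e * k * e⁻¹ ∈ formStabilizer vertexForm := by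
    rcases he with rfl | rfl <;> rintro g ((rfl | rfl) | rfl | rfl) <;> decide
  have := key _ h
  rwa [show e * (e⁻¹ * s * e) * e⁻¹ = s by group] at this

/-- The swap exchanges the half-trees `lowerL P` and `upperR P`, so at either of their edges it
turns the wrong way. -/
theorem not_fixesEdge_swapF_conj {e : GL (Fin 2) ℤ} (he : e = lowerL ∨ e = upperR) :
    ¬ FixesEdge (e⁻¹ * swapF * e) ∧ ¬ StrictTurn (e⁻¹ * swapF * e) := by
  have l00 : lowerL⁻¹.1 0 0 = 1 := rfl
  have l01 : lowerL⁻¹.1 0 1 = 0 := rfl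
  have l10 : lowerL⁻¹.1 1 0 = -1 := rfl
  have l11 : lowerL⁻¹.1 1 1 = 1 := rfl
  have r00 : upperR⁻¹.1 0 0 = 1 := rfl
  have r01 : upperR⁻¹.1 0 1 = -1 := rfl
  have r10 : upperR⁻¹.1 1 0 = 0 := rfl
  have r11 : upperR⁻¹.1 1 1 = 1 := rfl
  constructor
  · intro h
    have := h.entryNorm_eq
    rcases he with rfl | rfl <;> revert this <;> decide
  · intro h
    have h1 := mem_coneMonoid.1 h.1
    rcases he with rfl | rfl <;> simp [GL_two_mul, l00, l01, l10, l11, r00, r01, r10, r11] at h1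

/-- Two further edges leave the endpoint of the base edge inside `P`. If a letter turns into the
half-tree beyond one of them, moving there lowers the sum. Otherwise, at all three edges, the
letters point to their common vertex or fix the edge; then all preserve `vertexForm` and cannot
generate. -/
theorem exists_sum_entryNorm_conj_lt {S : Finset (GL (Fin 2) ℤ)}
    (hS : Subgroup.closure (S : Set (GL (Fin 2) ℤ)) = ⊤)
    (hno : ¬ HasFreePair (S : Set (GL (Fin 2) ℤ))) {s₀ : GL (Fin 2) ℤ} (hs₀ : s₀ ∈ S)
    (h₀ : StrictTurn s₀) :
    ∃ c : GL (Fin 2) ℤ, ∑ s ∈ S, entryNorm (c * s * c⁻¹) < ∑ s ∈ S, entryNorm s := by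
  have he : ∀ e : GL (Fin 2) ℤ, e = lowerL ∨ e = upperR →
      e ∈ coneMonoid ∧ e⁻¹ ∉ coneMonoid ∧ w * e⁻¹ * w = e := by
    rintro e (rfl | rfl)
    · refine ⟨lowerL_mem_coneMonoid, fun h => ?_, Units.ext (by decide)⟩
      have := mul_self_eq_one_of_inv_mem lowerL_mem_coneMonoid h
      exact absurd (congrArg Units.val this) (by decide)
    · refine ⟨upperR_mem_coneMonoid, fun h => ?_, Units.ext (by decide)⟩
      have := mul_self_eq_one_of_inv_mem upperR_mem_coneMonoid h
      exact absurd (congrArg Units.val this) (by decide)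
  by_contra! hcon
  have hdesc : ∀ e : GL (Fin 2) ℤ, e = lowerL ∨ e = upperR → ∀ s₁ ∈ S,
      ¬ StrictTurn (e⁻¹ * s₁ * e) := by
    intro e hE s₁ hs₁ h₁
    obtain ⟨k1, k2, k3⟩ := he e hE
    have := sum_entryNorm_conj_lt hS hno hs₀ h₀ hs₁ h₁ k1 k2 k3 (not_fixesEdge_swapF_conj hE)
    have h2 := hcon e⁻¹
    rw [inv_inv] at h2
    omega
  have hneg : ∀ e : GL (Fin 2) ℤ, e = lowerL ∨ e = upperR → ∀ s ∈ S,
      FixesEdge (e⁻¹ * s * e) ∨ StrictTurn (w * (e⁻¹ * s * e) * w) := by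
    intro e hE s hs
    obtain ⟨_, ⟨s₁, hs₁, rfl⟩, h₁⟩ := exists_strictTurn (closure_conj_eq_top hS e⁻¹)
      (not_hasFreePair_conj hno e⁻¹)
    have h₁ := h₁.resolve_left (by simpa using hdesc e hE s₁ hs₁)
    have := fixesEdge_or_strictTurn_conj hS hno (w * e⁻¹) hs₁ (by simpa [mul_assoc] using h₁) hs
    refine this.imp (fun h => ?_) fun h => by simpa [mul_assoc] using h
    have h2 : FixesEdge (w * (w * e⁻¹ * s * (w * e⁻¹)⁻¹) * w) := by
      rcases h with (h | h) | h | h <;> rw [h]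
      · left; left; simp
      · left; right; simp
      · right; right; apply Units.ext; decide
      · right; left; apply Units.ext; decide
    simpa [mul_assoc] using h2
  obtain ⟨s, hs, hs'⟩ := exists_mem_not_mem_of_closure_eq_top hS
    (formStabilizer_ne_top_of (A := vertexForm) (by decide))
  apply hs'
  rcases hneg lowerL (Or.inl rfl) s hs with h | hL
  · exact h.mem_of_conj (Or.inl rfl)
  rcases hneg upperR (Or.inr rfl) s hs with h | hR
  · exact h.mem_of_conj (Or.inr rfl)
  rcases fixesEdge_or_strictTurn hS hno hs₀ h₀ hs with h | h
  · have : ∀ k, FixesEdge k → k ∈ formStabilizer vertexForm := by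
      rintro k ((rfl | rfl) | rfl | rfl) <;> decide
    exact this s h
  · exact mem_vertexStabilizer_of_turn h hL hR

/-- Every finite generating set of `GL(2, ℤ)` has a free pair of lengths at most two and three. -/
theorem hasFreePair_of_closure_eq_top {S : Finset (GL (Fin 2) ℤ)}
    (hS : Subgroup.closure (S : Set (GL (Fin 2) ℤ)) = ⊤) :
    HasFreePair (S : Set (GL (Fin 2) ℤ)) := by
  classical
  induction hn : ∑ s ∈ S, entryNorm s using Nat.strong_induction_on generalizing S with
  | _ n ih =>
    by_contra hno
    have hconj : ∀ c : GL (Fin 2) ℤ, ((S.image fun s => c * s * c⁻¹ : Finset _) : Set _) =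
        (fun s => c * s * c⁻¹) '' (S : Set (GL (Fin 2) ℤ)) := fun c => Finset.coe_image
    have hsum : ∀ (f : GL (Fin 2) ℤ → ℕ) (c : GL (Fin 2) ℤ),
        ∑ s ∈ S.image (fun s => c * s * c⁻¹), f s = ∑ s ∈ S, f (c * s * c⁻¹) := fun f c =>
      Finset.sum_image fun a _ b _ hab => (MulAut.conj c).injective hab
    have hdesc : ∀ c : GL (Fin 2) ℤ, ¬ ∑ s ∈ S, entryNorm (c * s * c⁻¹) < n := by
      intro c hc
      refine hno (HasFreePair.of_conj c ?_)
      rw [← hconj]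
      refine ih _ hc ?_ (hsum _ _)
      rw [hconj]
      exact closure_conj_eq_top hS c
    obtain ⟨s₀, hs₀, h₀ | h₀⟩ := exists_strictTurn hS hno
    · obtain ⟨c, hc⟩ := exists_sum_entryNorm_conj_lt hS hno hs₀ h₀
      exact hdesc c (hn ▸ hc)
    -- Letters pointing to the other side: reflect by `w` first, which leaves all norms unchanged.
    · have h1 := closure_conj_eq_top hS w
      have h2 := not_hasFreePair_conj hno w
      rw [← hconj] at h1 h2
      obtain ⟨c, hc⟩ := exists_sum_entryNorm_conj_lt h1 h2 (s₀ := w * s₀ * w)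
        (Finset.mem_image.2 ⟨s₀, hs₀, by simp⟩) h₀
      rw [hsum, hsum] at hc
      refine hdesc (c * w) ?_
      simpa [mul_assoc, hn] using hc

end Descent

/-! ### Normal forms for the triangle group and the upper bound. -/

section Coxeter

/-- The relations of the triangle group `(2, 3, ∞)`. -/
structure IsCoxeterTriple {G : Type u} [Group G] (a b c : G) : Prop where
  a_sq : a * a = 1
  b_sq : b * b = 1
  c_sq : c * c = 1
  comm : b * a = a * b
  braid : c * b * c = b * c * b

/-- Products of the words `a c` and `a b c` of total length at most `n`. -/
inductive CoxeterWord {G : Type u} [Group G] (a b c : G) : ℕ → G → Prop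
  | one (n : ℕ) : CoxeterWord a b c n 1
  | two {n : ℕ} {v : G} : CoxeterWord a b c n v → CoxeterWord a b c (n + 2) (a * c * v)
  | three {n : ℕ} {v : G} : CoxeterWord a b c n v → CoxeterWord a b c (n + 3) (a * b * c * v)

/-- The elements of the finite dihedral group generated by `b` and `c`. -/
def prefixes {G : Type u} [Group G] (b c : G) : Fin 6 → G := ![1, b, c, b * c, c * b, b * c * b]

/-- The lengths of the elements of `prefixes`. -/
def prefixLength : Fin 6 → ℕ := ![0, 1, 1, 2, 2, 3]

/-- The elements of the Klein four-group generated by `a` and `b`. -/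
def suffixes {G : Type u} [Group G] (a b : G) : Fin 4 → G := ![1, a, b, a * b]

/-- Elements of the form `x v z` of total length at most `n`. -/
def CoxeterForm {G : Type u} [Group G] (a b c : G) (n : ℕ) (g : G) : Prop :=
  ∃ (i : Fin 6) (m : ℕ) (v : G) (j : Fin 4), CoxeterWord a b c m v ∧ prefixLength i + m ≤ n ∧
    g = prefixes b c i * v * suffixes a b j

variable {G : Type u} [Group G] {a b c : G}

theorem CoxeterWord.succ {n : ℕ} {v : G} (h : CoxeterWord a b c n v) :
    CoxeterWord a b c (n + 1) v := by
  induction h with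
  | one n => exact .one _
  | two _ ih => exact ih.two
  | three _ ih => exact ih.three

theorem CoxeterWord.mono {m n : ℕ} {v : G} (h : CoxeterWord a b c m v) (hmn : m ≤ n) :
    CoxeterWord a b c n v := by
  induction hmn with
  | refl => exact h
  | step _ ih => exact ih.succ

namespace IsCoxeterTriple

variable (H : IsCoxeterTriple a b c)

include H

theorem a_mul_a (x : G) : a * (a * x) = x := by rw [← mul_assoc, H.a_sq, one_mul]

theorem b_mul_b (x : G) : b * (b * x) = x := by rw [← mul_assoc, H.b_sq, one_mul]

theorem c_mul_c (x : G) : c * (c * x) = x := by rw [← mul_assoc, H.c_sq, one_mul]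

theorem b_mul_a (x : G) : b * (a * x) = a * (b * x) := by rw [← mul_assoc, H.comm, mul_assoc]

theorem b_mul_suffix (j : Fin 4) : ∃ j', b * suffixes a b j = suffixes a b j' := by
  fin_cases j
  exacts [⟨2, by simp [suffixes]⟩, ⟨3, by simp [suffixes, H.comm]⟩, ⟨0, by simp [suffixes, H.b_sq]⟩,
    ⟨1, by simp [suffixes, H.b_mul_a, H.b_sq]⟩]

theorem a_mul_suffix (j : Fin 4) : ∃ j', a * suffixes a b j = suffixes a b j' := by
  fin_cases j
  exacts [⟨1, by simp [suffixes]⟩, ⟨0, by simp [suffixes, H.a_sq]⟩, ⟨3, by simp [suffixes]⟩,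
    ⟨2, by simp [suffixes, H.a_mul_a]⟩]

/-- As `b` commutes with `a`, it exchanges a leading `ac` with a leading `abc`; on the empty word it
passes into the suffix. The cost is at most one. -/
theorem b_mul_word {m : ℕ} {v : G} (h : CoxeterWord a b c m v) (j : Fin 4) :
    ∃ v' j', CoxeterWord a b c (m + 1) v' ∧ b * (v * suffixes a b j) = v' * suffixes a b j' := by
  cases h with
  | one m =>
    obtain ⟨j', h⟩ := H.b_mul_suffix j
    exact ⟨1, j', .one _, by simpa using h⟩
  | @two n v h => exact ⟨a * b * c * v, j, h.three, by simp [mul_assoc, H.b_mul_a]⟩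
  | @three n v h =>
    exact ⟨a * c * v, j, h.two.mono (by omega), by simp [mul_assoc, H.b_mul_a, H.b_mul_b]⟩

theorem a_mul_word {m : ℕ} {v : G} (h : CoxeterWord a b c m v) (j : Fin 4) :
    (∃ j', a * (v * suffixes a b j) = suffixes a b j') ∨
    (∃ n v', m = n + 2 ∧ CoxeterWord a b c n v' ∧
      a * (v * suffixes a b j) = c * (v' * suffixes a b j)) ∨
    ∃ n v', m = n + 3 ∧ CoxeterWord a b c n v' ∧
      a * (v * suffixes a b j) = b * (c * (v' * suffixes a b j)) := by
  cases h with
  | one m =>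
    obtain ⟨j', h⟩ := H.a_mul_suffix j
    exact Or.inl ⟨j', by simpa using h⟩
  | @two n v h => exact Or.inr (Or.inl ⟨n, v, rfl, h, by simp [mul_assoc, H.a_mul_a]⟩)
  | @three n v h => exact Or.inr (Or.inr ⟨n, v, rfl, h, by simp [mul_assoc, H.a_mul_a]⟩)

theorem form_b_mul {n : ℕ} {g : G} (h : CoxeterForm a b c n g) :
    CoxeterForm a b c (n + 1) (b * g) := by
  obtain ⟨i, m, v, j, hv, hn, rfl⟩ := h
  fin_cases i <;> simp only [prefixLength] at hn
  · exact ⟨1, m, v, j, hv, by simp [prefixLength] at hn ⊢; omega, by simp [prefixes, mul_assoc]⟩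
  · exact ⟨0, m, v, j, hv, by simp [prefixLength] at hn ⊢; omega,
      by simp [prefixes, mul_assoc, H.b_mul_b]⟩
  · exact ⟨3, m, v, j, hv, by simp [prefixLength] at hn ⊢; omega, by simp [prefixes, mul_assoc]⟩
  · exact ⟨2, m, v, j, hv, by simp [prefixLength] at hn ⊢; omega,
      by simp [prefixes, mul_assoc, H.b_mul_b]⟩
  · exact ⟨5, m, v, j, hv, by simp [prefixLength] at hn ⊢; omega, by simp [prefixes, mul_assoc]⟩
  · exact ⟨4, m, v, j, hv, by simp [prefixLength] at hn ⊢; omega,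
      by simp [prefixes, mul_assoc, H.b_mul_b]⟩

theorem form_c_mul {n : ℕ} {g : G} (h : CoxeterForm a b c n g) :
    CoxeterForm a b c (n + 1) (c * g) := by
  have hbr : ∀ x, c * (b * (c * x)) = b * (c * (b * x)) := fun x => by
    rw [← mul_assoc, ← mul_assoc, H.braid]; simp only [mul_assoc]
  obtain ⟨i, m, v, j, hv, hn, rfl⟩ := h
  fin_cases i <;> simp only [prefixLength] at hn
  · exact ⟨2, m, v, j, hv, by simp [prefixLength] at hn ⊢; omega, by simp [prefixes, mul_assoc]⟩
  · exact ⟨4, m, v, j, hv, by simp [prefixLength] at hn ⊢; omega, by simp [prefixes, mul_assoc]⟩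
  · exact ⟨0, m, v, j, hv, by simp [prefixLength] at hn ⊢; omega,
      by simp [prefixes, mul_assoc, H.c_mul_c]⟩
  · exact ⟨5, m, v, j, hv, by simp [prefixLength] at hn ⊢; omega,
      by simp [prefixes, mul_assoc, hbr]⟩
  · exact ⟨1, m, v, j, hv, by simp [prefixLength] at hn ⊢; omega,
      by simp [prefixes, mul_assoc, H.c_mul_c]⟩
  · refine ⟨3, m, v, j, hv, by simp [prefixLength] at hn ⊢; omega, ?_⟩
    simp [prefixes, mul_assoc, hbr, H.b_mul_b]

/-- Behind the prefix `1` or `b`, the letter `a` cancels a leading `a` of the word or enters the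
suffix. With `c` or `bc` it forms a new syllable. With `cb` or `bcb` the final `b` first moves into
the word. -/
theorem form_a_mul {n : ℕ} {g : G} (h : CoxeterForm a b c n g) :
    CoxeterForm a b c (n + 1) (a * g) := by
  obtain ⟨i, m, v, j, hv, hn, rfl⟩ := h
  fin_cases i <;> simp [prefixLength] at hn
  · rcases H.a_mul_word hv j with ⟨j', h⟩ | ⟨k, v', rfl, hv', h⟩ | ⟨k, v', rfl, hv', h⟩
    · exact ⟨0, 0, 1, j', .one _, by simp [prefixLength], by simp [prefixes, h]⟩
    · exact ⟨2, k, v', j, hv', by simp [prefixLength]; omega, by simp [prefixes, mul_assoc, h]⟩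
    · exact ⟨3, k, v', j, hv', by simp [prefixLength]; omega, by simp [prefixes, mul_assoc, h]⟩
  · rcases H.a_mul_word hv j with ⟨j', h⟩ | ⟨k, v', rfl, hv', h⟩ | ⟨k, v', rfl, hv', h⟩
    · exact ⟨1, 0, 1, j', .one _, by simp [prefixLength],
        by simp [prefixes, mul_assoc, ← H.b_mul_a, h]⟩
    · exact ⟨3, k, v', j, hv', by simp [prefixLength]; omega,
        by simp [prefixes, mul_assoc, ← H.b_mul_a, h]⟩
    · exact ⟨2, k, v', j, hv', by simp [prefixLength]; omega,
        by simp [prefixes, mul_assoc, ← H.b_mul_a, h, H.b_mul_b]⟩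
  · exact ⟨0, m + 2, _, j, hv.two, by simp [prefixLength]; omega, by simp [prefixes, mul_assoc]⟩
  · exact ⟨0, m + 3, _, j, hv.three, by simp [prefixLength]; omega, by simp [prefixes, mul_assoc]⟩
  · obtain ⟨v', j', hv', h⟩ := H.b_mul_word hv j
    exact ⟨0, m + 3, _, j', hv'.two, by simp [prefixLength]; omega,
      by simp [prefixes, mul_assoc, h]⟩
  · obtain ⟨v', j', hv', h⟩ := H.b_mul_word hv j
    exact ⟨0, m + 4, _, j', hv'.three, by simp [prefixLength]; omega,
      by simp [prefixes, mul_assoc, h]⟩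

omit H in
theorem form_one (n : ℕ) : CoxeterForm a b c n 1 :=
  ⟨0, 0, 1, 0, .one _, by simp [prefixLength], by simp [prefixes, suffixes]⟩

theorem form_list_prod (l : List G) (hl : ∀ x ∈ l, x = a ∨ x = b ∨ x = c) :
    CoxeterForm a b c l.length l.prod := by
  induction l with
  | nil => exact form_one 0
  | cons x l ih =>
    have := ih fun y hy => hl y (List.mem_cons_of_mem _ hy)
    rw [List.prod_cons, List.length_cons]
    rcases hl x List.mem_cons_self with rfl | rfl | rfl
    exacts [H.form_a_mul this, H.form_b_mul this, H.form_c_mul this]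

theorem form_of_wordLength_le [DecidableEq G] {n : ℕ} {g : G}
    (hg : wordLength ({a, b, c} : Finset G) g ≤ n) : CoxeterForm a b c n g := by
  obtain ⟨l, hl, rfl, hlen⟩ := (wordLength_le_iff _ g n).1 hg
  obtain ⟨i, m, v, j, hv, hm, h⟩ := H.form_list_prod l fun x hx => by
    have ha := inv_eq_of_mul_eq_one_right H.a_sq
    have hb := inv_eq_of_mul_eq_one_right H.b_sq
    have hc := inv_eq_of_mul_eq_one_right H.c_sq
    simpa [inv_eq_iff_eq_inv, ha, hb, hc] using hl x hx
  exact ⟨i, m, v, j, hv, hm.trans hlen, h⟩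

omit H in
-- The summand `1` makes the recursion homogeneous in spite of the empty word; the constant `3`
-- covers `n ≤ 2`.
theorem _root_.CoxeterWord.exists_finset {α : ℝ} (hα : 1 ≤ α) (hroot : α ^ 3 = α + 1) (n : ℕ) :
    ∃ E : Finset G, (∀ v, CoxeterWord a b c n v → v ∈ E) ∧ (E.card : ℝ) + 1 ≤ 3 * α ^ n := by
  classical
  induction n using Nat.strong_induction_on with
  | _ n ih =>
    match n with
    | 0 =>
      refine ⟨{1}, fun v hv => ?_, by norm_num⟩
      cases hv; simp
    | 1 =>
      refine ⟨{1}, fun v hv => ?_, by norm_num; linarith⟩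
      cases hv; simp
    | 2 =>
      refine ⟨{1, a * c}, fun v hv => ?_, ?_⟩
      · cases hv with
        | one => simp
        | two h => cases h; simp
      · have h1 : (({1, a * c} : Finset G).card : ℝ) ≤ 2 := by exact_mod_cast Finset.card_le_two
        nlinarith
    | n + 3 =>
      obtain ⟨A, hA, hAc⟩ := ih (n + 1) (by omega)
      obtain ⟨B, hB, hBc⟩ := ih n (by omega)
      refine ⟨insert 1 (A.image (a * c * ·) ∪ B.image (a * b * c * ·)), fun v hv => ?_, ?_⟩
      · cases hv with
        | one => simp
        | two h =>
          exact Finset.mem_insert_of_mem (Finset.mem_union_left _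
            (Finset.mem_image_of_mem _ (hA _ h)))
        | three h =>
          exact Finset.mem_insert_of_mem (Finset.mem_union_right _
            (Finset.mem_image_of_mem _ (hB _ h)))
      · have h1 : (insert 1 (A.image (a * c * ·) ∪ B.image (a * b * c * ·))).card ≤
            A.card + B.card + 1 :=
          (Finset.card_insert_le _ _).trans (Nat.add_le_add_right ((Finset.card_union_le _ _).trans
            (Nat.add_le_add Finset.card_image_le Finset.card_image_le)) 1)
        have h2 : ((insert 1 (A.image (a * c * ·) ∪ B.image (a * b * c * ·))).card : ℝ) ≤
            A.card + B.card + 1 := by exact_mod_cast h1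
        have h3 : α ^ (n + 3) = α ^ (n + 1) + α ^ n := by rw [pow_add, hroot]; ring
        rw [h3]
        linarith

theorem expGrowthRate_le [DecidableEq G] {α : ℝ} (hα : 1 ≤ α) (hroot : α ^ 3 = α + 1) :
    expGrowthRate ({a, b, c} : Finset G) ≤ α := by
  -- `72 = 6 · 4 · 3`: prefixes, suffixes and the constant of `CoxeterWord.exists_finset`.
  refine expGrowthRate_le_of_growthFunction_le (K := 72) (by norm_num) (by linarith) fun n => ?_
  obtain ⟨E, hE, hcard⟩ := CoxeterWord.exists_finset (a := a) (b := b) (c := c) hα hroot n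
  let T : Finset G := ((Finset.univ : Finset (Fin 6)) ×ˢ E ×ˢ (Finset.univ : Finset (Fin 4))).image
    fun p => prefixes b c p.1 * p.2.1 * suffixes a b p.2.2
  have hT : T.card ≤ 24 * E.card := by
    refine Finset.card_image_le.trans ?_
    simp only [Finset.card_product, Finset.card_univ, Fintype.card_fin]
    omega
  have hle : growthFunction ({a, b, c} : Finset G) n ≤ T.card := by
    rw [← Set.ncard_coe_finset]
    refine Set.ncard_le_ncard (fun g hg => ?_) T.finite_toSet
    obtain ⟨i, m, v, j, hv, hm, rfl⟩ := H.form_of_wordLength_le hg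
    exact Finset.mem_coe.2 (Finset.mem_image.2
      ⟨(i, v, j), by simp [hE v (hv.mono (by omega))], rfl⟩)
  have h1 : (growthFunction ({a, b, c} : Finset G) n : ℝ) ≤ 24 * E.card := by
    exact_mod_cast hle.trans hT
  linarith

end IsCoxeterTriple

end Coxeter

/-! ### Faithfulness of the normal form in `PGL(2, ℤ)`. -/

section Kernel

local notation "w" => reflW

open Matrix

/-- The third generating reflection. -/
def reflC : GL (Fin 2) ℤ := reflW * lowerL

theorem GL_two_unit_scalar (x : ℤˣ) :
    GeneralLinearGroup.scalar (Fin 2) x = 1 ∨ GeneralLinearGroup.scalar (Fin 2) x = -1 := by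
  rcases Int.units_eq_one_or x with rfl | rfl
  · exact Or.inl (map_one _)
  · right
    apply GL_two_ext <;> simp

theorem mk_eq_mk_iff_GL_two {g h : GL (Fin 2) ℤ} :
    ProjGenLinGroup.mk g = ProjGenLinGroup.mk h ↔ g = h ∨ g = -h := by
  rw [ProjGenLinGroup.mk_eq_mk_iff]
  constructor
  · rintro ⟨x, rfl⟩
    rcases GL_two_unit_scalar x with h | h <;> simp [h]
  · rintro (rfl | rfl)
    · exact ⟨1, by simp⟩
    · refine ⟨-1, ?_⟩
      rw [show GeneralLinearGroup.scalar (Fin 2) (-1 : ℤˣ) = -1 by apply GL_two_ext <;> simp]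
      simp

theorem mk_neg_GL_two (g : GL (Fin 2) ℤ) :
    ProjGenLinGroup.mk (-g) = ProjGenLinGroup.mk g :=
  mk_eq_mk_iff_GL_two.2 (Or.inr rfl)

theorem isCoxeterTriple_mk : IsCoxeterTriple (ProjGenLinGroup.mk w) (ProjGenLinGroup.mk swapF)
    (ProjGenLinGroup.mk reflC) := by
  constructor <;> simp only [← map_mul, ← map_one ProjGenLinGroup.mk, mk_eq_mk_iff_GL_two] <;>
    decide

variable {Γ : Type u} [Group Γ] {a b c : Γ}

/-- Images of Coxeter words under a homomorphism to `PGL(2, ℤ)`. -/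
theorem CoxeterWord.exists_lift (φ : Γ →* ProjGenLinGroup (Fin 2) ℤ)
    (ha : φ a = ProjGenLinGroup.mk w) (hb : φ b = ProjGenLinGroup.mk swapF)
    (hc : φ c = ProjGenLinGroup.mk reflC) {n : ℕ} {v : Γ} (h : CoxeterWord a b c n v) :
    ∃ V : GL (Fin 2) ℤ, V ∈ coneMonoid ∧ φ v = ProjGenLinGroup.mk V ∧
      ((v = 1 ∧ V = 1) ∨ (v = a * c ∧ V = w * reflC) ∨ (v = a * b * c ∧ V = w * swapF * reflC) ∨
        3 < entryNorm V) := by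
  have h1 : w * reflC ∈ coneMonoid := by
    have := lowerL_mem_coneMonoid
    simpa [reflC] using this
  have h2 : w * swapF * reflC ∈ coneMonoid := by
    have h3 : w * swapF * reflC = -(swapF * lowerL) := by decide
    rw [h3]
    exact neg_mem_coneMonoid (mul_mem swapF_mem_coneMonoid lowerL_mem_coneMonoid)
  -- Both syllables have norm three and each further syllable strictly increases it, so only words
  -- of at most one syllable stay at norm three or less.
  have step : ∀ (X : GL (Fin 2) ℤ) (x v : Γ), X ∈ coneMonoid → X * X ≠ 1 → entryNorm X = 3 →
      (∃ V : GL (Fin 2) ℤ, V ∈ coneMonoid ∧ φ v = ProjGenLinGroup.mk V ∧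
        ((v = 1 ∧ V = 1) ∨ (v = a * c ∧ V = w * reflC) ∨
          (v = a * b * c ∧ V = w * swapF * reflC) ∨ 3 < entryNorm V)) →
      φ x = ProjGenLinGroup.mk X → ∃ V : GL (Fin 2) ℤ, V ∈ coneMonoid ∧
        φ (x * v) = ProjGenLinGroup.mk V ∧ ((x * v = x ∧ V = X) ∨ 3 < entryNorm V) := by
    rintro X x v hX hXX hX3 ⟨V, hV, hv, hcase⟩ hx
    refine ⟨X * V, mul_mem hX hV, by rw [map_mul, map_mul, hx, hv], ?_⟩
    have hlt := (entryNorm_mul hX hV).2.1 (inv_not_mem_of_mul_self_ne_one hX hXX)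
    have n1 : entryNorm (w * reflC) = 3 := by decide
    have n2 : entryNorm (w * swapF * reflC) = 3 := by decide
    rcases hcase with ⟨rfl, rfl⟩ | ⟨-, rfl⟩ | ⟨-, rfl⟩ | h
    · left; simp
    · right; omega
    · right; omega
    · right; omega
  induction h with
  | one n => exact ⟨1, one_mem _, by simp, Or.inl ⟨rfl, rfl⟩⟩
  | @two n v _ ih =>
    obtain ⟨V, h3, h4, h5⟩ := step (w * reflC) (a * c) v h1 (by decide) (by decide) ih
      (by simp [ha, hc])
    exact ⟨V, h3, h4, by tauto⟩
  | @three n v _ ih =>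
    obtain ⟨V, h3, h4, h5⟩ := step (w * swapF * reflC) (a * b * c) v h2 (by decide) (by decide) ih
      (by simp [ha, hb, hc])
    exact ⟨V, h3, h4, by tauto⟩

/-- If `x v z` maps to `1`, the image of `v` is `x⁻¹ z⁻¹` up to sign; this bound leaves at most one
syllable, a finite check. -/
theorem entryNorm_prefix_suffix : ∀ (i : Fin 6) (j : Fin 4),
    entryNorm ((prefixes swapF reflC i)⁻¹ * (suffixes w swapF j)⁻¹) ≤ 3 := by decide

theorem prefix_mul_suffix_eq : ∀ (i : Fin 6) (j : Fin 4),
    (prefixes swapF reflC i * suffixes w swapF j = 1 ∨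
      prefixes swapF reflC i * suffixes w swapF j = -1) → (i = 0 ∧ j = 0) ∨ (i = 1 ∧ j = 2) := by
  decide

theorem prefix_mul_suffix_ne : ∀ (i : Fin 6) (j : Fin 4),
    ¬ (prefixes swapF reflC i * (w * reflC) * suffixes w swapF j = 1 ∨
      prefixes swapF reflC i * (w * reflC) * suffixes w swapF j = -1) ∧
    ¬ (prefixes swapF reflC i * (w * swapF * reflC) * suffixes w swapF j = 1 ∨
      prefixes swapF reflC i * (w * swapF * reflC) * suffixes w swapF j = -1) := by
  decide

theorem map_prefixes {G H : Type*} [Group G] [Group H] (φ : G →* H) (b c : G) (i : Fin 6) :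
    φ (prefixes b c i) = prefixes (φ b) (φ c) i := by
  fin_cases i <;> simp [prefixes]

theorem map_suffixes {G H : Type*} [Group G] [Group H] (φ : G →* H) (a b : G) (j : Fin 4) :
    φ (suffixes a b j) = suffixes (φ a) (φ b) j := by
  fin_cases j <;> simp [suffixes]

theorem IsCoxeterTriple.exists_form (H : IsCoxeterTriple a b c) {g : Γ}
    (hg : g ∈ Subgroup.closure {a, b, c}) : ∃ n, CoxeterForm a b c n g := by
  have step : ∀ x ∈ ({a, b, c} : Set Γ), ∀ y, (∃ n, CoxeterForm a b c n y) →
      x⁻¹ = x ∧ ∃ n, CoxeterForm a b c n (x * y) := by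
    rintro x hx y ⟨n, hn⟩
    rcases hx with rfl | rfl | rfl
    exacts [⟨inv_eq_of_mul_eq_one_right H.a_sq, n + 1, H.form_a_mul hn⟩,
      ⟨inv_eq_of_mul_eq_one_right H.b_sq, n + 1, H.form_b_mul hn⟩,
      ⟨inv_eq_of_mul_eq_one_right H.c_sq, n + 1, H.form_c_mul hn⟩]
  induction hg using Subgroup.closure_induction_left with
  | one => exact ⟨0, IsCoxeterTriple.form_one 0⟩
  | mul_left x hx y _ ih => exact (step x hx y ih).2
  | inv_mul_cancel x hx y _ ih =>
    obtain ⟨h1, h2⟩ := step x hx y ih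
    rwa [h1]

/-- A group generated by a Coxeter triple embeds in `PGL(2, ℤ)` as soon as its generators map to
the standard ones. -/
theorem IsCoxeterTriple.injective (H : IsCoxeterTriple a b c)
    (hgen : Subgroup.closure {a, b, c} = ⊤) (φ : Γ →* ProjGenLinGroup (Fin 2) ℤ)
    (ha : φ a = ProjGenLinGroup.mk w) (hb : φ b = ProjGenLinGroup.mk swapF)
    (hc : φ c = ProjGenLinGroup.mk reflC) : Function.Injective φ := by
  rw [injective_iff_map_eq_one]
  intro g hg
  obtain ⟨n, i, m, v, j, hv, -, rfl⟩ := H.exists_form (hgen ▸ Subgroup.mem_top g)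
  obtain ⟨V, hV, hφv, hcase⟩ := hv.exists_lift φ ha hb hc
  rw [map_mul, map_mul, map_prefixes, map_suffixes, ha, hb, hc, hφv, ← map_prefixes,
    ← map_suffixes, ← map_mul, ← map_mul, ← map_one ProjGenLinGroup.mk,
    mk_eq_mk_iff_GL_two] at hg
  rcases hcase with ⟨rfl, rfl⟩ | ⟨-, rfl⟩ | ⟨-, rfl⟩ | h
  · rw [mul_one] at hg ⊢
    -- The second solution is `b * b`, as `b` occurs both as a prefix and as a suffix.
    rcases prefix_mul_suffix_eq i j hg with ⟨rfl, rfl⟩ | ⟨rfl, rfl⟩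
    · simp [prefixes, suffixes]
    · simp [prefixes, suffixes, H.b_sq]
  · exact absurd hg (prefix_mul_suffix_ne i j).1
  · exact absurd hg (prefix_mul_suffix_ne i j).2
  · exfalso
    have hVeq : V = (prefixes swapF reflC i)⁻¹ * (suffixes w swapF j)⁻¹ ∨
        V = -((prefixes swapF reflC i)⁻¹ * (suffixes w swapF j)⁻¹) := by
      refine hg.imp (fun h => ?_) fun h => ?_
      · have := congrArg (fun z => (prefixes swapF reflC i)⁻¹ * z * (suffixes w swapF j)⁻¹) h
        simpa [mul_assoc] using this
      · have := congrArg (fun z => (prefixes swapF reflC i)⁻¹ * z * (suffixes w swapF j)⁻¹) h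
        simpa [mul_assoc] using this
    have := entryNorm_prefix_suffix i j
    rcases hVeq with rfl | rfl
    · omega
    · rw [entryNorm_neg] at h
      omega

end Kernel

/-! ### Generators of `GL(2, ℤ)`, dihedral subgroups and amalgams. -/

section Amalgams

local notation "w" => reflW

open Matrix

/-- The reflections produce the standard generators `S` and `T` of `SL(2, ℤ)`, and `w` has
determinant `-1`. -/
theorem closure_reflections_eq_top :
    Subgroup.closure {w, swapF, reflC} = (⊤ : Subgroup (GL (Fin 2) ℤ)) := by
  set H := Subgroup.closure ({w, swapF, reflC} : Set (GL (Fin 2) ℤ)) with hH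
  have hw : w ∈ H := Subgroup.subset_closure (by simp)
  have hf : swapF ∈ H := Subgroup.subset_closure (by simp)
  have hc : reflC ∈ H := Subgroup.subset_closure (by simp)
  have hS : SpecialLinearGroup.toGL ModularGroup.S = swapF * w := by decide
  have hT : SpecialLinearGroup.toGL ModularGroup.T = swapF * (w * reflC) * swapF := by decide
  have hSL : ∀ A : SpecialLinearGroup (Fin 2) ℤ, SpecialLinearGroup.toGL A ∈ H := by
    intro A
    have hA : A ∈ Subgroup.closure {ModularGroup.S, ModularGroup.T} :=
      SpecialLinearGroup.SL2Z_generators ▸ Subgroup.mem_top A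
    have hle : Subgroup.closure {ModularGroup.S, ModularGroup.T} ≤
        H.comap SpecialLinearGroup.toGL := by
      rw [Subgroup.closure_le]
      rintro x (rfl | rfl)
      · simp only [Subgroup.coe_comap, Set.mem_preimage, SetLike.mem_coe, hS]
        exact mul_mem hf hw
      · simp only [Subgroup.coe_comap, Set.mem_preimage, SetLike.mem_coe, hT]
        exact mul_mem (mul_mem hf (mul_mem hw hc)) hf
    exact hle hA
  have hdet : ∀ g : GL (Fin 2) ℤ, g.1.det = 1 → g ∈ H := by
    intro g hg
    have := hSL ⟨g.1, hg⟩
    rwa [show SpecialLinearGroup.toGL ⟨g.1, hg⟩ = g from Units.ext rfl] at this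
  rw [eq_top_iff]
  intro g _
  rcases GL_two_det g with h | h
  · exact hdet g (by rw [Matrix.det_fin_two]; exact h)
  · have := hdet (w * g) (by
      rw [Matrix.det_fin_two]
      simp only [GL_two_mul, reflW_00, reflW_01, reflW_10, reflW_11]
      linarith)
    simpa using mul_mem hw this

theorem closure_mk_reflections_eq_top : Subgroup.closure {ProjGenLinGroup.mk w,
    ProjGenLinGroup.mk swapF, ProjGenLinGroup.mk reflC} =
      (⊤ : Subgroup (ProjGenLinGroup (Fin 2) ℤ)) := by
  have := MonoidHom.map_closure ProjGenLinGroup.mk ({w, swapF, reflC} : Set (GL (Fin 2) ℤ))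
  rw [closure_reflections_eq_top, ← MonoidHom.range_eq_map,
    MonoidHom.range_eq_top.2 ProjGenLinGroup.mk_surjective] at this
  rw [this]
  simp [Set.image_insert_eq, Set.image_singleton]

/-- The homomorphism from `C₂` given by an involution. -/
def c2Hom {G : Type u} [Group G] (g : G) (hg : g * g = 1) : C2 →* G where
  toFun x := g ^ x.toAdd.val
  map_one' := by simp
  map_mul' := by
    have h2 : ∀ x : C2, x = 1 ∨ x = Multiplicative.ofAdd 1 := by decide
    intro x y
    rcases h2 x with rfl | rfl <;> rcases h2 y with rfl | rfl
    · simp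
    · simp
    · simp
    · have : (Multiplicative.toAdd (Multiplicative.ofAdd (1 : ZMod 2) *
        Multiplicative.ofAdd (1 : ZMod 2))).val = 0 := by decide
      rw [this]
      have h1 : (Multiplicative.toAdd (Multiplicative.ofAdd (1 : ZMod 2))).val = 1 := by decide
      rw [h1, pow_one, hg, pow_zero]

/-- The dihedral group of order six as the stabilizer of a vertex. -/
def d6Hom : DihedralGroup 3 →* GL (Fin 2) ℤ where
  toFun
    | .r i => (swapF * reflC) ^ i.val
    | .sr i => swapF * (swapF * reflC) ^ i.val
  map_one' := by decide
  map_mul' := by decide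

/-- The dihedral group of order eight generated by the coordinate reflections. -/
def d8Hom : DihedralGroup 4 →* GL (Fin 2) ℤ where
  toFun
    | .r i => (swapF * w) ^ i.val
    | .sr i => swapF * (swapF * w) ^ i.val
  map_one' := by decide
  map_mul' := by decide

/-- The dihedral group of order twelve as a subgroup of `GL(2, ℤ)`. -/
def d12Hom : DihedralGroup 6 →* GL (Fin 2) ℤ where
  toFun
    -- The sign turns an element of order three into one of order six with cube `-1`, matching the
    -- central rotation under `d8Hom`.
    | .r i => (-(reflC * swapF)) ^ i.val
    | .sr i => swapF * (-(reflC * swapF)) ^ i.val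
  map_one' := by decide
  map_mul' := by decide

section Universal

variable {A B : Type u} {C : Type v} [Group A] [Group B] [Group C] {φ : C →* A} {ψ : C →* B}

/-- The map from the left factor to the amalgam. -/
def amalgamInl (φ : C →* A) (ψ : C →* B) : A →* Amalgam φ ψ :=
  Monoid.PushoutI.of (φ := amalgamHom φ ψ) false

/-- The map from the right factor to the amalgam. -/
def amalgamInr (φ : C →* A) (ψ : C →* B) : B →* Amalgam φ ψ :=
  Monoid.PushoutI.of (φ := amalgamHom φ ψ) true

theorem amalgamInl_apply_eq (x : C) : amalgamInl φ ψ (φ x) = amalgamInr φ ψ (ψ x) :=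
  (Monoid.PushoutI.of_apply_eq_base (amalgamHom φ ψ) false x).trans
    (Monoid.PushoutI.of_apply_eq_base (amalgamHom φ ψ) true x).symm

/-- The two maps out of the factors, as a family. -/
def amalgamFamily {K : Type*} [Group K] (f : A →* K) (g : B →* K) :
    ∀ i, AmalgamFactor A B i →* K
  | false => f
  | true => g

/-- The universal property of the amalgam. -/
def amalgamLift {K : Type*} [Group K] (f : A →* K) (g : B →* K) (h : f.comp φ = g.comp ψ) :
    Amalgam φ ψ →* K :=
  Monoid.PushoutI.lift (amalgamFamily f g) (f.comp φ) (by
    rintro (_ | _)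
    · rfl
    · exact h.symm)

@[simp] theorem amalgamLift_inl {K : Type*} [Group K] (f : A →* K) (g : B →* K)
    (h : f.comp φ = g.comp ψ) (x : A) : amalgamLift f g h (amalgamInl φ ψ x) = f x :=
  Monoid.PushoutI.lift_of (φ := amalgamHom φ ψ) (amalgamFamily f g) (f.comp φ) _ (i := false) x

@[simp] theorem amalgamLift_inr {K : Type*} [Group K] (f : A →* K) (g : B →* K)
    (h : f.comp φ = g.comp ψ) (x : B) : amalgamLift f g h (amalgamInr φ ψ x) = g x :=
  Monoid.PushoutI.lift_of (φ := amalgamHom φ ψ) (amalgamFamily f g) (f.comp φ) _ (i := true) x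

theorem amalgam_subgroup_eq_top {H : Subgroup (Amalgam φ ψ)} (hl : ∀ x, amalgamInl φ ψ x ∈ H)
    (hr : ∀ x, amalgamInr φ ψ x ∈ H) : H = ⊤ := by
  rw [eq_top_iff]
  intro g _
  induction g using Monoid.PushoutI.induction_on with
  | of i x =>
    cases i
    · exact hl x
    · exact hr x
  | base x =>
    rw [← Monoid.PushoutI.of_apply_eq_base (amalgamHom φ ψ) false x]
    exact hl (φ x)
  | mul x y hx hy => exact mul_mem (hx trivial) (hy trivial)

theorem enatCard_quotient_range [Finite A] [Finite C] (hφ : Function.Injective φ) {n : ℕ}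
    (h : Nat.card A = Nat.card C * n) : ENat.card (A ⧸ φ.range) = n := by
  have h1 := φ.range.card_mul_index
  have h2 : Nat.card φ.range = Nat.card C :=
    Nat.card_congr (MonoidHom.ofInjective hφ).toEquiv.symm
  rw [h2, h] at h1
  have h3 : φ.range.index = n := Nat.eq_of_mul_eq_mul_left Nat.card_pos h1
  rw [ENat.card_eq_coe_natCard, ← h3]
  rfl

end Universal

theorem isNondegenerateAmalgam_c2 : IsNondegenerateAmalgam c2ToKlein c2ToD6 := by
  have h1 : Function.Injective c2ToKlein := by decide
  have h2 : Function.Injective c2ToD6 := by decide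
  have c2 : Nat.card C2 = 2 := by rw [Nat.card_eq_fintype_card]; decide
  refine ⟨h1, h2, ?_⟩
  rw [enatCard_quotient_range h1 (n := 2) (by rw [Nat.card_prod, c2]),
    enatCard_quotient_range h2 (n := 3) (by rw [DihedralGroup.nat_card, c2])]
  decide

theorem isNondegenerateAmalgam_klein : IsNondegenerateAmalgam kleinToD8 kleinToD12 := by
  have h1 : Function.Injective kleinToD8 := by decide
  have h2 : Function.Injective kleinToD12 := by decide
  have c2 : Nat.card C2 = 2 := by rw [Nat.card_eq_fintype_card]; decide
  refine ⟨h1, h2, ?_⟩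
  rw [enatCard_quotient_range h1 (n := 2) (by rw [Nat.card_prod, DihedralGroup.nat_card, c2]),
    enatCard_quotient_range h2 (n := 3) (by rw [Nat.card_prod, DihedralGroup.nat_card, c2])]
  decide

end Amalgams

/-! ### The two isomorphisms and the value of the minimal growth rate. -/

section Isomorphisms

local notation "w" => reflW

open Matrix

theorem prefixes_mem {G : Type u} [Group G] {b c : G} {H : Subgroup G} (hb : b ∈ H) (hc : c ∈ H)
    (i : Fin 6) : prefixes b c i ∈ H := by
  fin_cases i
  exacts [one_mem H, hb, hc, mul_mem hb hc, mul_mem hc hb, mul_mem (mul_mem hb hc) hb]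

theorem suffixes_mem {G : Type u} [Group G] {a b : G} {H : Subgroup G} (ha : a ∈ H) (hb : b ∈ H)
    (j : Fin 4) : suffixes a b j ∈ H := by
  fin_cases j
  exacts [one_mem H, ha, hb, mul_mem ha hb]

/-- The generator of the first factor of `C₂ × C₂`. -/
def kleinFst : C2 × C2 := (Multiplicative.ofAdd 1, 1)

/-- The generator of the second factor of `C₂ × C₂`. -/
def kleinSnd : C2 × C2 := (1, Multiplicative.ofAdd 1)

theorem c2Hom_ofAdd_one {G : Type u} [Group G] (g : G) (hg : g * g = 1) :
    c2Hom g hg (Multiplicative.ofAdd 1) = g := by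
  change g ^ (1 : ZMod 2).val = g
  rw [show (1 : ZMod 2).val = 1 from rfl, pow_one]

theorem mk_mul_self_reflections :
    (ProjGenLinGroup.mk w * ProjGenLinGroup.mk w = 1) ∧
    (ProjGenLinGroup.mk swapF * ProjGenLinGroup.mk swapF = 1) := by
  simp [← map_mul]

/-- The Klein four-group as the stabilizer of an edge. -/
def kleinHom : C2 × C2 →* ProjGenLinGroup (Fin 2) ℤ :=
  MonoidHom.noncommCoprod (c2Hom (ProjGenLinGroup.mk swapF) mk_mul_self_reflections.2)
    (c2Hom (ProjGenLinGroup.mk w) mk_mul_self_reflections.1) fun x y => by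
      refine Commute.pow_pow ?_ _ _
      exact isCoxeterTriple_mk.comm

theorem kleinHom_fst : kleinHom kleinFst = ProjGenLinGroup.mk swapF := by
  change c2Hom (ProjGenLinGroup.mk swapF) _ (Multiplicative.ofAdd 1) *
    c2Hom (ProjGenLinGroup.mk w) _ 1 = _
  rw [c2Hom_ofAdd_one, map_one, mul_one]

theorem kleinHom_snd : kleinHom kleinSnd = ProjGenLinGroup.mk w := by
  change c2Hom (ProjGenLinGroup.mk swapF) _ 1 *
    c2Hom (ProjGenLinGroup.mk w) _ (Multiplicative.ofAdd 1) = _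
  rw [c2Hom_ofAdd_one, map_one, one_mul]

/-- The comparison map to `PGL(2, ℤ)`. -/
def amalgamToPGL : Amalgam c2ToKlein c2ToD6 →* ProjGenLinGroup (Fin 2) ℤ :=
  amalgamLift kleinHom (ProjGenLinGroup.mk.comp d6Hom) (by
    have h2 : ∀ x : C2, x = 1 ∨ x = Multiplicative.ofAdd 1 := by decide
    refine MonoidHom.ext fun x => ?_
    rcases h2 x with rfl | rfl
    · simp
    · have e : d6Hom (c2ToD6 (Multiplicative.ofAdd 1)) = swapF := by decide
      simp only [MonoidHom.comp_apply, e]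
      exact kleinHom_fst)

/-- The isomorphism `PGL(2, ℤ) ≃ (C₂ × C₂) *_{C₂} D₆`. -/
theorem amalgamToPGL_bijective : Function.Bijective amalgamToPGL := by
  set l := amalgamInl c2ToKlein c2ToD6
  set r := amalgamInr c2ToKlein c2ToD6
  have hb : l kleinFst = r (.sr 0) := by
    have := amalgamInl_apply_eq (φ := c2ToKlein) (ψ := c2ToD6) (Multiplicative.ofAdd 1)
    rwa [show c2ToD6 (Multiplicative.ofAdd 1) = .sr 0 by decide] at this
  have h : IsCoxeterTriple (l kleinSnd) (l kleinFst) (r (.sr 1)) := by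
    constructor
    · rw [← map_mul, ← map_one l]; exact congrArg l (by decide)
    · rw [← map_mul, ← map_one l]; exact congrArg l (by decide)
    · rw [← map_mul, ← map_one r]; exact congrArg r (by decide)
    · rw [← map_mul, ← map_mul]; exact congrArg l (by decide)
    · simp only [hb, ← map_mul]; exact congrArg r (by decide)
  have ha' : amalgamToPGL (l kleinSnd) = ProjGenLinGroup.mk w := by
    rw [amalgamToPGL, amalgamLift_inl, kleinHom_snd]
  have hb' : amalgamToPGL (l kleinFst) = ProjGenLinGroup.mk swapF := by
    rw [amalgamToPGL, amalgamLift_inl, kleinHom_fst]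
  have hc' : amalgamToPGL (r (.sr 1)) = ProjGenLinGroup.mk reflC := by
    have e : d6Hom (.sr 1) = reflC := by decide
    simp [amalgamToPGL, r, e]
  constructor
  · refine h.injective ?_ amalgamToPGL ha' hb' hc'
    set K := Subgroup.closure {l kleinSnd, l kleinFst, r (.sr 1)}
    have ka : l kleinSnd ∈ K := Subgroup.subset_closure (by simp)
    have kb : l kleinFst ∈ K := Subgroup.subset_closure (by simp)
    have kc : r (.sr 1) ∈ K := Subgroup.subset_closure (by simp)
    refine amalgam_subgroup_eq_top (fun x => ?_) fun x => ?_
    · obtain ⟨j, rfl⟩ := (by decide : ∀ x, ∃ j, x = suffixes kleinSnd kleinFst j) x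
      change l _ ∈ K
      rw [map_suffixes]
      exact suffixes_mem ka kb j
    · obtain ⟨i, rfl⟩ := (by decide : ∀ x : DihedralGroup 3, ∃ i, x = prefixes (.sr 0) (.sr 1) i) x
      change r _ ∈ K
      rw [map_prefixes]
      exact prefixes_mem (hb ▸ kb) kc i
  · rw [← MonoidHom.range_eq_top, eq_top_iff, ← closure_mk_reflections_eq_top, Subgroup.closure_le]
    rintro x (rfl | rfl | rfl)
    exacts [⟨_, ha'⟩, ⟨_, hb'⟩, ⟨_, hc'⟩]

/-- The comparison map to `GL(2, ℤ)`. -/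
def amalgamToGL : Amalgam kleinToD8 kleinToD12 →* GL (Fin 2) ℤ :=
  amalgamLift d8Hom d12Hom (by
    have : ∀ x, d8Hom (kleinToD8 x) = d12Hom (kleinToD12 x) := by decide
    exact MonoidHom.ext this)

/-- The isomorphism `GL(2, ℤ) ≃ D₈ *_{C₂ × C₂} D₁₂`. -/
theorem amalgamToGL_bijective : Function.Bijective amalgamToGL := by
  set l := amalgamInl kleinToD8 kleinToD12 with hl
  set r := amalgamInr kleinToD8 kleinToD12 with hr
  have hb : l (.sr 0) = r (.sr 0) := by
    have := amalgamInl_apply_eq (φ := kleinToD8) (ψ := kleinToD12) kleinSnd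
    rwa [show kleinToD8 kleinSnd = .sr 0 by decide,
      show kleinToD12 kleinSnd = .sr 0 by decide] at this
  have hz : l (.r 2) = r (.r 3) := by
    have := amalgamInl_apply_eq (φ := kleinToD8) (ψ := kleinToD12) kleinFst
    rwa [show kleinToD8 kleinFst = .r 2 by decide,
      show kleinToD12 kleinFst = .r 3 by decide] at this
  have ga : amalgamToGL (l (.sr 1)) = w := by
    rw [amalgamToGL, amalgamLift_inl]; decide
  have gb : amalgamToGL (l (.sr 0)) = swapF := by
    rw [amalgamToGL, amalgamLift_inl]; decide
  have gc : amalgamToGL (r (.sr 2)) = reflC := by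
    rw [amalgamToGL, amalgamLift_inr]; decide
  have gz : amalgamToGL (l (.r 2)) = -1 := by
    rw [amalgamToGL, amalgamLift_inl]; decide
  -- The chosen reflections of the square commute only up to the central rotation `ζ`. The Coxeter
  -- relations therefore hold in the quotient by `ζ`, which embeds in `PGL(2, ℤ)`; injectivity
  -- upstairs follows since `ζ` maps to `-1`.
  set ζ := l (.r 2) with hζ
  have hcent : ∀ g, ζ * g = g * ζ := by
    have : Subgroup.centralizer {ζ} = ⊤ := by
      refine amalgam_subgroup_eq_top (fun x => ?_) fun x => ?_
      · rw [Subgroup.mem_centralizer_singleton_iff, ← hl, hζ, ← map_mul, ← map_mul]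
        exact congrArg l ((by decide : ∀ x : DihedralGroup 4, x * .r 2 = .r 2 * x) x)
      · rw [Subgroup.mem_centralizer_singleton_iff, ← hr, hz, ← map_mul, ← map_mul]
        exact congrArg r ((by decide : ∀ x : DihedralGroup 6, x * .r 3 = .r 3 * x) x)
    intro g
    have hg : g ∈ Subgroup.centralizer {ζ} := this ▸ Subgroup.mem_top g
    exact (Subgroup.mem_centralizer_singleton_iff.1 hg).symm
  have hζ2 : ζ * ζ = 1 := by
    rw [hζ, ← map_mul, ← map_one l]; exact congrArg l (by decide)
  have hmem : ∀ g ∈ Subgroup.zpowers ζ, g = 1 ∨ g = ζ := by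
    rintro _ ⟨k, rfl⟩
    rcases Int.even_or_odd' k with ⟨m, rfl | rfl⟩
    · left
      simp [_root_.zpow_mul, zpow_ofNat, pow_two, hζ2]
    · right
      simp [_root_.zpow_add, _root_.zpow_mul, zpow_ofNat, pow_two, hζ2]
  have hnormal : (Subgroup.zpowers ζ).Normal := by
    refine ⟨fun n hn g => ?_⟩
    rcases hmem n hn with rfl | rfl
    · simp
    · rw [← hcent, mul_inv_cancel_right]
      exact hn
  let π := QuotientGroup.mk' (Subgroup.zpowers ζ)
  have hπζ : π ζ = 1 := (QuotientGroup.eq_one_iff ζ).2 (Subgroup.mem_zpowers ζ)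
  let Φ : Amalgam kleinToD8 kleinToD12 ⧸ Subgroup.zpowers ζ →* ProjGenLinGroup (Fin 2) ℤ :=
    QuotientGroup.lift _ (ProjGenLinGroup.mk.comp amalgamToGL) (by
      intro x hx
      rcases hmem x hx with rfl | rfl
      · simp
      · rw [MonoidHom.mem_ker, MonoidHom.comp_apply, gz, mk_neg_GL_two, map_one])
  have hΦ : ∀ g, Φ (π g) = ProjGenLinGroup.mk (amalgamToGL g) := fun g => rfl
  have h : IsCoxeterTriple (π (l (.sr 1))) (π (l (.sr 0))) (π (r (.sr 2))) := by
    constructor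
    · rw [← map_mul, ← map_mul, ← map_one π, ← map_one l]; exact congrArg (π <| l ·) (by decide)
    · rw [← map_mul, ← map_mul, ← map_one π, ← map_one l]; exact congrArg (π <| l ·) (by decide)
    · rw [← map_mul, ← map_mul, ← map_one π, ← map_one r]; exact congrArg (π <| r ·) (by decide)
    · have e : l (.sr 0) * l (.sr 1) = ζ * (l (.sr 1) * l (.sr 0)) := by
        simp only [hζ, ← map_mul]; exact congrArg l (by decide)
      rw [← map_mul, e, map_mul, hπζ, one_mul, map_mul]
    · simp only [hb, ← map_mul]; exact congrArg (π <| r ·) (by decide)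
  constructor
  · have hinj : Function.Injective Φ := by
      refine h.injective ?_ Φ (by rw [hΦ, ga]) (by rw [hΦ, gb]) (by rw [hΦ, gc])
      set K := Subgroup.closure {π (l (.sr 1)), π (l (.sr 0)), π (r (.sr 2))}
      have ka : π (l (.sr 1)) ∈ K := Subgroup.subset_closure (by simp)
      have kb : π (l (.sr 0)) ∈ K := Subgroup.subset_closure (by simp)
      have kc : π (r (.sr 2)) ∈ K := Subgroup.subset_closure (by simp)
      have htop : K.comap π = ⊤ := by
        refine amalgam_subgroup_eq_top (fun x => ?_) fun x => ?_
        · change π (l x) ∈ K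
          obtain ⟨j, hj⟩ := (by decide : ∀ x : DihedralGroup 4, ∃ j,
            x = suffixes (.sr 1) (.sr 0) j ∨ x = .r 2 * suffixes (.sr 1) (.sr 0) j) x
          have := suffixes_mem ka kb j
          rw [← map_suffixes, ← map_suffixes] at this
          rcases hj with rfl | rfl
          · exact this
          · rwa [map_mul, map_mul, ← hζ, hπζ, one_mul]
        · change π (r x) ∈ K
          obtain ⟨i, hi⟩ := (by decide : ∀ x : DihedralGroup 6, ∃ i,
            x = prefixes (.sr 0) (.sr 2) i ∨ x = .r 3 * prefixes (.sr 0) (.sr 2) i) x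
          rw [hb] at kb
          have := prefixes_mem kb kc i
          rw [← map_prefixes, ← map_prefixes] at this
          rcases hi with rfl | rfl
          · exact this
          · rwa [map_mul, map_mul, ← hz, hπζ, one_mul]
      rw [eq_top_iff]
      intro g _
      obtain ⟨g, rfl⟩ := QuotientGroup.mk'_surjective _ g
      have : g ∈ K.comap π := htop ▸ Subgroup.mem_top g
      exact this
    rw [injective_iff_map_eq_one]
    intro g hg
    have h1 : π g = 1 := hinj (by rw [hΦ, hg, map_one, map_one])
    rcases hmem g ((QuotientGroup.eq_one_iff g).1 h1) with rfl | rfl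
    · rfl
    · rw [gz] at hg
      exact absurd hg (by decide)
  · rw [← MonoidHom.range_eq_top, eq_top_iff, ← closure_reflections_eq_top, Subgroup.closure_le]
    rintro x (rfl | rfl | rfl)
    exacts [⟨_, ga⟩, ⟨_, gb⟩, ⟨_, gc⟩]

instance : Finite (ProjGenLinGroup.mk (n := Fin 2) (R := ℤ)).ker := by
  have : ((ProjGenLinGroup.mk (n := Fin 2) (R := ℤ)).ker : Set (GL (Fin 2) ℤ)) ⊆ {1, -1} := by
    intro g hg
    have h : ProjGenLinGroup.mk g = ProjGenLinGroup.mk 1 := by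
      rw [map_one]; exact MonoidHom.mem_ker.1 hg
    simpa using mk_eq_mk_iff_GL_two.1 h
  exact (Set.toFinite {1, -1}).subset this

theorem group_fg_of_closure {G : Type u} [Group G] {a b c : G}
    (h : Subgroup.closure {a, b, c} = ⊤) : Group.FG G := by
  classical
  exact Group.fg_def.2 ⟨{a, b, c}, by simpa using h⟩

theorem minGrowthRate_GL_eq_PGL :
    minGrowthRate (GL (Fin 2) ℤ) = minGrowthRate (ProjGenLinGroup (Fin 2) ℤ) :=
  minGrowthRate_eq_of_surjective ProjGenLinGroup.mk ProjGenLinGroup.mk_surjective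

/-- The minimal growth rate of `PGL(2, ℤ)` is the plastic number. -/
theorem minGrowthRate_PGL {α : ℝ} (hα : 1 ≤ α) (hroot : α ^ 3 = α + 1) :
    minGrowthRate (ProjGenLinGroup (Fin 2) ℤ) = α := by
  classical
  apply le_antisymm
  · refine (minGrowthRate_le ?_).trans (isCoxeterTriple_mk.expGrowthRate_le hα hroot)
    simpa using closure_mk_reflections_eq_top
  · rw [← minGrowthRate_GL_eq_PGL]
    exact le_minGrowthRate (group_fg_of_closure closure_reflections_eq_top) fun S hS =>
      (hasFreePair_of_closure_eq_top hS).le_expGrowthRate hα hroot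

theorem exists_plastic_number : ∃ α : ℝ, 1 ≤ α ∧ α ^ 3 = α + 1 ∧ α < Real.sqrt 2 ∧
    ∀ x : ℝ, (0 < x ∧ x ^ 3 - x - 1 = 0) ↔ x = α := by
  have hcont : ContinuousOn (fun x : ℝ => x ^ 3 - x - 1) (Set.Icc 1 2) := by fun_prop
  obtain ⟨α, ⟨h1, -⟩, hα⟩ := intermediate_value_Icc (by norm_num : (1 : ℝ) ≤ 2) hcont
    (show (0 : ℝ) ∈ _ by constructor <;> norm_num)
  have hα : α ^ 3 - α - 1 = 0 := hα
  refine ⟨α, h1, by linarith, ?_, fun x => ⟨fun ⟨hx, hx3⟩ => ?_, ?_⟩⟩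
  · apply Real.lt_sqrt_of_sq_lt
    -- If `α² ≥ 2`, then `α + 1 = α³ ≥ 2α`, so `α ≤ 1`.
    by_contra! h
    nlinarith
  · have h2 : (x - α) * (x ^ 2 + x * α + α ^ 2 - 1) = 0 := by linear_combination hx3 - hα
    have h3 : x ^ 2 + x * α + α ^ 2 - 1 ≠ 0 := by nlinarith
    exact sub_eq_zero.1 ((mul_eq_zero.1 h2).resolve_right h3)
  · rintro rfl
    exact ⟨by linarith, hα⟩

end Isomorphisms

theorem mainTheorem4 :
    ∃ α : ℝ,
      -- `α` is the unique positive root of `z ^ 3 - z - 1`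
      (∀ x : ℝ, (0 < x ∧ x ^ 3 - x - 1 = 0) ↔ x = α) ∧
      -- the decompositions of `PGL(2, ℤ)` and `GL(2, ℤ)` as amalgamated products
      IsNondegenerateAmalgam c2ToKlein c2ToD6 ∧
      Nonempty (Matrix.ProjGenLinGroup (Fin 2) ℤ ≃* Amalgam c2ToKlein c2ToD6) ∧
      IsNondegenerateAmalgam kleinToD8 kleinToD12 ∧
      Nonempty (Matrix.GeneralLinearGroup (Fin 2) ℤ ≃* Amalgam kleinToD8 kleinToD12) ∧
      -- the minimal growth rates
      minGrowthRate (Matrix.ProjGenLinGroup (Fin 2) ℤ) = α ∧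
      minGrowthRate (Matrix.GeneralLinearGroup (Fin 2) ℤ) = α ∧
      -- the value `α` is attained by an amalgamated product
      (∃ (A B C : Type) (_ : Group A) (_ : Group B) (_ : Group C) (φ : C →* A) (ψ : C →* B),
        IsNondegenerateAmalgam φ ψ ∧ Group.FG (Amalgam φ ψ) ∧
          minGrowthRate (Amalgam φ ψ) = α) ∧
      -- there is an amalgamated product with minimal growth rate less than `√2`
      (∃ (A B C : Type) (_ : Group A) (_ : Group B) (_ : Group C) (φ : C →* A) (ψ : C →* B),
        IsNondegenerateAmalgam φ ψ ∧ Group.FG (Amalgam φ ψ) ∧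
          minGrowthRate (Amalgam φ ψ) < Real.sqrt 2) := by
  obtain ⟨α, h1, hroot, hlt, huniq⟩ := exists_plastic_number
  have hPGL := minGrowthRate_PGL h1 hroot
  let e := MulEquiv.ofBijective amalgamToPGL amalgamToPGL_bijective
  have hAm : minGrowthRate (Amalgam c2ToKlein c2ToD6) = α := (minGrowthRate_congr e).trans hPGL
  have hfg : Group.FG (Amalgam c2ToKlein c2ToD6) := by
    have := group_fg_of_closure closure_mk_reflections_eq_top
    exact Group.fg_of_surjective (f := e.symm.toMonoidHom) e.symm.surjective
  refine ⟨α, huniq, isNondegenerateAmalgam_c2, ⟨e.symm⟩, isNondegenerateAmalgam_klein,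
    ⟨(MulEquiv.ofBijective amalgamToGL amalgamToGL_bijective).symm⟩, hPGL,
    minGrowthRate_GL_eq_PGL.trans hPGL, ?_, ?_⟩
  · exact ⟨C2 × C2, DihedralGroup 3, C2, inferInstance, inferInstance, inferInstance, c2ToKlein,
      c2ToD6, isNondegenerateAmalgam_c2, hfg, hAm⟩
  · exact ⟨C2 × C2, DihedralGroup 3, C2, inferInstance, inferInstance, inferInstance, c2ToKlein,
      c2ToD6, isNondegenerateAmalgam_c2, hfg, hAm.trans_lt hlt⟩
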